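/- For a finite simple undirected graph $G$ and an integer $k\ge 1$, call $G$ \emph{$k$-choosable} if for every assignment of lists $L(v)\subset\mathbb{N}$ with $|L(v)|=k$ to the vertices $v\in V_G$ there is a proper colouring $f$ of $G$ with $f(v)\in L(v)$ for all $v$. A \emph{2-choosable deletion set} of $G$ is a set $A\subseteq V_G$ such that the induced subgraph $G[V_G\setminus A]$ is 2-choosable. The problem Min-2-Choosable-Del asks, given $G$, for a 2-choosable deletion set of minimum size. \textbf{Theorem.} Min-2-Choosable-Del can be approximated in polynomial time within a factor of $O(\log |V_G|)$. That is, there are a constant $C$ and a deterministic algorithm (a random access machine with unit-cost addition, truncated subtraction and indirect addressing) which, given the adjacency matrix of any graph $G$ with $n$ vertices, halts after a number of steps bounded by a fixed polynomial in $n$ and outputs a 2-choosable deletion set $A$ of $G$ with $$|A|\;\le\; C\,\log n\cdot \min\{|B| : B \text{ is a 2-choosable deletion set of } G\}$$ for $n \ge 1$; if $n=0$, it outputs $A=\emptyset$. -/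

import Mathlib

/-! ### Choosability and deletion sets -/

/-- `G` is `k`-choosable: for every assignment of lists `L v ⊂ ℕ` of exactly `k` permissible colours
to the vertices, `G` has a proper colouring that takes the colour of each vertex from its list. -/
def SimpleGraph.Choosable {V : Type*} (G : SimpleGraph V) (k : ℕ) : Prop :=
  ∀ L : V → Finset ℕ, (∀ v, (L v).card = k) → ∃ f : G.Coloring ℕ, ∀ v, f v ∈ L v

/-- `A` is a `k`-choosable deletion set of `G`: the induced subgraph `G[V ∖ A]` is
`k`-choosable. -/
def SimpleGraph.IsChoosableDeletionSet {V : Type*} (G : SimpleGraph V) (k : ℕ)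
    (A : Finset V) : Prop :=
  (G.induce {v | v ∉ A}).Choosable k

/-! ### Random access machines

Programs of a deterministic random access machine, in structured form.  The data are natural
numbers, held in variables (addressed directly) and in arrays (addressed indirectly, through the
value of a variable).  The only arithmetic operations are addition and truncated subtraction, so
that counting one step per instruction and per test is polynomially equivalent to counting the
steps of a Turing machine. -/

namespace RAM

/-- A store: `var x` is the value of the variable `x`, and `arr a i` is the `i`-th cell of the
array `a`. A program only mentions finitely many variables and arrays. -/
structure Store where
  var : ℕ → ℕ
  arr : ℕ → ℕ → ℕ

/-- The store after the variable `x` has been given the value `c`. -/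
def Store.setVar (s : Store) (x c : ℕ) : Store where
  var := Function.update s.var x c
  arr := s.arr

/-- The store after the `i`-th cell of the array `a` has been given the value `c`. -/
def Store.setArr (s : Store) (a i c : ℕ) : Store where
  var := s.var
  arr := Function.update s.arr a (Function.update (s.arr a) i c)

/-- Programs. -/
inductive Prog : Type
  /-- `x := c` for a fixed number `c` -/
  | const (x c : ℕ) : Prog
  /-- `x := y + z` -/
  | add (x y z : ℕ) : Prog
  /-- `x := max (y - z) 0` -/
  | sub (x y z : ℕ) : Prog
  /-- `x := a[y]` -/
  | load (x a y : ℕ) : Prog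
  /-- `a[y] := x` -/
  | store (a y x : ℕ) : Prog
  /-- `p; q` -/
  | seq (p q : Prog) : Prog
  /-- `if x ≠ 0 then p else q` -/
  | cond (x : ℕ) (p q : Prog) : Prog
  /-- `while x ≠ 0 do p` -/
  | loop (x : ℕ) (p : Prog) : Prog

/-- `Exec p s t s'`: the program `p`, started in the store `s`, halts after exactly `t` steps, and
then the store is `s'`. Every basic instruction takes one step, and so does every test of a
conditional or of a loop. -/
inductive Exec : Prog → Store → ℕ → Store → Prop
  | const (x c : ℕ) (s : Store) :
      Exec (.const x c) s 1 (s.setVar x c)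
  | add (x y z : ℕ) (s : Store) :
      Exec (.add x y z) s 1 (s.setVar x (s.var y + s.var z))
  | sub (x y z : ℕ) (s : Store) :
      Exec (.sub x y z) s 1 (s.setVar x (s.var y - s.var z))
  | load (x a y : ℕ) (s : Store) :
      Exec (.load x a y) s 1 (s.setVar x (s.arr a (s.var y)))
  | store (a y x : ℕ) (s : Store) :
      Exec (.store a y x) s 1 (s.setArr a (s.var y) (s.var x))
  | seq {p q : Prog} {s₁ s₂ s₃ : Store} {t u : ℕ} :
      Exec p s₁ t s₂ → Exec q s₂ u s₃ → Exec (.seq p q) s₁ (t + u) s₃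
  | cond_true {x : ℕ} {p q : Prog} {s s' : Store} {t : ℕ} :
      s.var x ≠ 0 → Exec p s t s' → Exec (.cond x p q) s (t + 1) s'
  | cond_false {x : ℕ} {p q : Prog} {s s' : Store} {t : ℕ} :
      s.var x = 0 → Exec q s t s' → Exec (.cond x p q) s (t + 1) s'
  | loop_done {x : ℕ} {p : Prog} {s : Store} :
      s.var x = 0 → Exec (.loop x p) s 1 s
  | loop_step {x : ℕ} {p : Prog} {s₁ s₂ s₃ : Store} {t u : ℕ} :
      s₁.var x ≠ 0 → Exec p s₁ t s₂ → Exec (.loop x p) s₂ u s₃ →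
        Exec (.loop x p) s₁ (t + u + 1) s₃

/-- The machine is deterministic: the running time and the final store are determined by the
program and the initial store. -/
theorem Exec.deterministic {p : Prog} {s s₁ s₂ : Store} {t₁ t₂ : ℕ}
    (h₁ : Exec p s t₁ s₁) (h₂ : Exec p s t₂ s₂) : t₁ = t₂ ∧ s₁ = s₂ := by
  induction h₁ generalizing t₂ s₂ with
  | const | add | sub | load | store => cases h₂; exact ⟨rfl, rfl⟩
  | seq _ _ ih₁ ih₂ =>
    cases h₂ with
    | seq a b =>
      obtain ⟨rfl, rfl⟩ := ih₁ a
      obtain ⟨rfl, rfl⟩ := ih₂ b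
      exact ⟨rfl, rfl⟩
  | cond_true h _ ih =>
    cases h₂ with
    | cond_true _ a => obtain ⟨rfl, rfl⟩ := ih a; exact ⟨rfl, rfl⟩
    | cond_false h' _ => exact absurd h' h
  | cond_false h _ ih =>
    cases h₂ with
    | cond_true h' _ => exact absurd h h'
    | cond_false _ a => obtain ⟨rfl, rfl⟩ := ih a; exact ⟨rfl, rfl⟩
  | loop_done h =>
    cases h₂ with
    | loop_done _ => exact ⟨rfl, rfl⟩
    | loop_step h' _ _ => exact absurd h h'
  | loop_step h _ _ ih₁ ih₂ =>
    cases h₂ with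
    | loop_done h' => exact absurd h' h
    | loop_step _ a b =>
      obtain ⟨rfl, rfl⟩ := ih₁ a
      obtain ⟨rfl, rfl⟩ := ih₂ b
      exact ⟨rfl, rfl⟩

open Classical in
/-- The initial store for the input graph `G` on the vertices `0, …, n - 1`: variable `0` holds
`n`, array `0` holds the adjacency matrix of `G` row by row (the entry of `(i, j)` is in cell
`i * n + j`), and everything else is `0`. -/
noncomputable def inputGraph {n : ℕ} (G : SimpleGraph (Fin n)) : Store where
  var x := if x = 0 then n else 0
  arr a m := if a = 0 ∧ ∃ i j : Fin n, G.Adj i j ∧ m = i * n + j then 1 else 0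

/-- The vertex set that a store presents as output: the vertices `v` whose cell in array `1` is
not `0`. -/
def outputSet (n : ℕ) (s : Store) : Finset (Fin n) :=
  Finset.univ.filter fun v => s.arr 1 v ≠ 0

/-- `p` is an algorithm that turns every finite graph, given by its adjacency matrix, into a vertex
set, in time polynomial in the number `n` of vertices. -/
def Prog.IsPolyTimeOnGraphs (p : Prog) : Prop :=
  ∃ q : Polynomial ℕ, ∀ (n : ℕ) (G : SimpleGraph (Fin n)),
    ∃ t s, Exec p (inputGraph G) t s ∧ t ≤ q.eval n

/-- The output of `p` on every graph `G` is a `k`-choosable deletion set of `G` whose size is at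
most `ρ n` times the size of every (hence of a smallest) `k`-choosable deletion set of `G`, where
`n` is the number of vertices of `G`. -/
def Prog.ApproximatesMinChoosableDel (p : Prog) (k : ℕ) (ρ : ℕ → ℝ) : Prop :=
  ∀ (n : ℕ) (G : SimpleGraph (Fin n)), ∃ t s, Exec p (inputGraph G) t s ∧
    G.IsChoosableDeletionSet k (outputSet n s) ∧
    ∀ B : Finset (Fin n), G.IsChoosableDeletionSet k B →
      ((outputSet n s).card : ℝ) ≤ ρ n * (B.card : ℝ)

end RAM

/-!
The approximation algorithm is greedy. It repeatedly removes all vertices of degree at most one,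
which does not matter for 2-choosability because such vertices can be coloured last
(`ChoosableOn.of_sdiff_low`), disregards the components that are 2-choosable, and moves a vertex
of maximum degree in what is left to the solution.

It finds few vertices because connected 2-choosable graphs are sparse. By the theorem of Erdős,
Rubin and Taylor, such a graph of minimum degree at least two is an even cycle, or consists of
three internally disjoint paths of even length between two vertices, two of these paths being of
length two. Here the theorem is expressed by degrees: the graph is bipartite, and its vertices of
degree other than two, if there are any, form a *theta pair*, that is, they are two vertices of
degree three with two common neighbours of degree two. Necessity
(`ChoosableCore.exists_thetaPair`) rests on list assignments to paths and cycles. The lists on a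
cycle can be chosen such that any one prescribed colour of a given vertex is refuted
(`refuter_of_link`), and the lists on the interior of a path of length at least three such that
any prescribed pair of colours of its ends is forbidden (`forbids_of_link`). Two disjoint refuters
of one vertex, a theta graph with two paths of length at least three, and four parallel paths, two
of them of length two, are excluded in this way. For sufficiency
(`Conn.choosableOn_of_thetaPair`), colours are transferred along an induced path that contains all
but one or two of the vertices (`IndPath.extends_cases`).

Consequently, a connected 2-choosable graph has at most one edge more than it has vertices
(`Conn.sum_card_nb_le`). Let `H` be a graph of minimum degree at least two without 2-choosable
components, `d` its maximum degree and `B` a deletion set of `H`. Then the excess of `H`, the sum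
of `degree - 2` over its vertices, is at most `(4 * d - 2) * B.card` (`AllBad.excess_le`). If
`d ≥ 3`, the deletion of a vertex of degree `d` decreases the excess by at least `d - 2`, that is,
by a fraction of at least `1 / (10 * B.card)`; hence this happens `O(B.card * log n)` times. If
`d = 2`, the deletion and the subsequent removals eliminate a whole component, which contains a
vertex of `B`. A potential function combines the two cases (`AllBad.potential_add_one_le`), and
`greedy_correct` sums up.

The algorithm recognizes the components that are not 2-choosable by the above description: they
contain an odd closed walk, or a vertex of degree other than two that is not in a theta pair with
all further ones (`not_choosableOn_comp_iff`). All of this is computed by sums over the vertices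
and by iterations. The program is therefore written in a small language for matrices, in which a
matrix is filled with the values of a term, and commands are repeated `n` times;
`Cmd.runs_compile` shows once and for all that such commands can be carried out by the machine in
polynomial time.
-/

namespace SimpleGraph

/-! ### List colourings of a part of the vertex set -/

section Gadgets

variable {V : Type*} {G : SimpleGraph V}

/-- `f` is a proper colouring of the subgraph of `G` induced by `S`. -/
def ProperOn (G : SimpleGraph V) (S : Set V) (f : V → ℕ) : Prop :=
  ∀ x ∈ S, ∀ y ∈ S, G.Adj x y → f x ≠ f y

theorem ProperOn.mono {S T : Set V} {f : V → ℕ} (h : G.ProperOn T f) (hST : S ⊆ T) :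
    G.ProperOn S f :=
  fun x hx y hy => h x (hST hx) y (hST hy)

/-- The subgraph of `G` induced by `S` is 2-choosable; the lists and colourings are defined on all
vertices, but only their values on `S` matter. -/
def ChoosableOn (G : SimpleGraph V) (S : Finset V) : Prop :=
  ∀ L : V → Finset ℕ, (∀ v, (L v).card = 2) → ∃ f : V → ℕ, (∀ v ∈ S, f v ∈ L v) ∧ G.ProperOn S f

theorem ChoosableOn.mono {S T : Finset V} (h : G.ChoosableOn T) (hST : S ⊆ T) :
    G.ChoosableOn S := fun L hL => by
  obtain ⟨f, hf, hp⟩ := h L hL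
  exact ⟨f, fun v hv => hf v (hST hv), hp.mono (by exact_mod_cast hST)⟩

/-- Some assignment of 2-element lists to the vertices of `W` rules out the colour `s` at `u`
together with the colour `t` at `v`. -/
def Forbids (G : SimpleGraph V) (W : Set V) (u v : V) (s t : ℕ) : Prop :=
  ∃ L : V → Finset ℕ, (∀ x, (L x).card = 2) ∧ ∀ f : V → ℕ, (∀ x ∈ W, f x ∈ L x) →
    G.ProperOn (insert u (insert v W)) f → f u = s → f v ≠ t

/-- Any given colour of `v` can be ruled out by an assignment of 2-element lists to `W`. -/
def Refuter (G : SimpleGraph V) (W : Set V) (v : V) : Prop :=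
  ∀ a, G.Forbids W v v a a

theorem Forbids.mono {W W' : Set V} {u v : V} {s t : ℕ} (h : G.Forbids W u v s t) (hW : W ⊆ W') :
    G.Forbids W' u v s t := by
  obtain ⟨L, hL, h⟩ := h
  exact ⟨L, hL, fun f hf hp => h f (fun x hx => hf x (hW hx))
    (hp.mono (Set.insert_subset_insert (Set.insert_subset_insert hW)))⟩

theorem Refuter.mono {W W' : Set V} {v : V} (h : G.Refuter W v) (hW : W ⊆ W') :
    G.Refuter W' v := fun a => (h a).mono hW

/-- `Link G u l v`: the vertices of the list `l` form, in this order, the interior of a walk from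
`u` to `v`. -/
def Link (G : SimpleGraph V) : V → List V → V → Prop
  | u, [], v => G.Adj u v
  | u, w :: l, v => G.Adj u w ∧ Link G w l v

@[simp] theorem link_nil {u v : V} : G.Link u [] v ↔ G.Adj u v := Iff.rfl

@[simp] theorem link_cons {u w v : V} {l : List V} :
    G.Link u (w :: l) v ↔ G.Adj u w ∧ G.Link w l v := Iff.rfl

theorem link_append {u v x : V} {l₁ l₂ : List V} :
    G.Link u (l₁ ++ x :: l₂) v ↔ G.Link u l₁ x ∧ G.Link x l₂ v := by
  induction l₁ generalizing u with
  | nil => simp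
  | cons w l₁ ih => simp [ih, and_assoc]

theorem Link.reverse {u v : V} {l : List V} (h : G.Link u l v) : G.Link v l.reverse u := by
  induction l generalizing u with
  | nil => exact SimpleGraph.Adj.symm h
  | cons w l ih =>
    rw [List.reverse_cons, link_append]
    exact ⟨ih h.2, h.1.symm⟩

theorem exists_fresh (a b : ℕ) : ∃ c : ℕ, c ≠ a ∧ c ≠ b :=
  ⟨a + b + 1, by omega, by omega⟩

/-- A walk with at least two interior vertices can forbid any pair of colours of its ends; one
interior vertex suffices if the two colours differ. -/
theorem forbids_of_link {u v : V} {l : List V} (h : G.Link u l v) (hl : l.Nodup) {s t : ℕ}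
    (hst : (l ≠ [] ∧ s ≠ t) ∨ 2 ≤ l.length) : G.Forbids {x | x ∈ l} u v s t := by
  classical
  induction l generalizing u s with
  | nil => simp at hst
  | cons w l ih =>
    rcases l with _ | ⟨w', l'⟩
    · have hne : s ≠ t := by simpa using hst
      refine ⟨fun _ => {s, t}, fun _ => Finset.card_pair hne, fun f hf hp hu hv => ?_⟩
      have h1 := hp u (by simp) w (by simp) h.1
      have h2 := hp w (by simp) v (by simp) h.2
      have h3 : f w = s ∨ f w = t := by simpa using hf w (by simp)
      omega
    · obtain ⟨c, hcs, hct⟩ := exists_fresh s t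
      obtain ⟨L, hL, hLf⟩ := ih h.2 (List.nodup_cons.1 hl).2 (s := c) (Or.inl ⟨by simp, hct⟩)
      have hw : w ∉ w' :: l' := (List.nodup_cons.1 hl).1
      refine ⟨Function.update L w {s, c}, fun x => ?_, fun f hf hp hu => ?_⟩
      · by_cases hx : x = w
        · subst hx; simpa using Finset.card_pair hcs.symm
        · simpa [hx] using hL x
      · have h1 := hp u (by simp) w (by simp) h.1
        have h3 : f w = s ∨ f w = c := by
          simpa using hf w (by simp)
        refine hLf f (fun x hx => ?_) (hp.mono ?_) (by omega)
        · have hxw : x ≠ w := fun e => hw (e ▸ hx)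
          simpa [hxw] using hf x (List.mem_cons_of_mem _ hx)
        · intro x hx
          simp only [Set.mem_insert_iff, Set.mem_ofPred_eq, List.mem_cons] at hx ⊢
          tauto

/-- A closed walk rules out any colour of its base point. -/
theorem refuter_of_link {v : V} {l : List V} (h : G.Link v l v) (hl : l.Nodup)
    (h2 : 2 ≤ l.length) : G.Refuter {x | x ∈ l} v :=
  fun _ => forbids_of_link h hl (Or.inr h2)

theorem Refuter.extend {v w : V} {W : Set V} (h : G.Refuter W w) (hvw : G.Adj v w) (hw : w ∉ W) :
    G.Refuter (insert w W) v := by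
  classical
  intro a
  obtain ⟨L, hL, hLf⟩ := h (a + 1)
  refine ⟨Function.update L w {a, a + 1}, fun x => ?_, fun f hf hp hu _ => ?_⟩
  · by_cases hx : x = w
    · subst hx; simp
    · simpa [hx] using hL x
  · have h1 := hp v (by simp) w (by simp) hvw
    have h3 : f w = a ∨ f w = a + 1 := by simpa using hf w (by simp)
    have h4 : f w = a + 1 := by omega
    refine hLf f (fun x hx => ?_) (hp.mono ?_) h4 h4
    · have hxw : x ≠ w := fun e => hw (e ▸ hx)
      simpa [hxw] using hf x (Set.mem_insert_of_mem _ hx)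
    · intro x hx
      simp only [Set.mem_insert_iff] at hx ⊢
      tauto

theorem Refuter.extend_link {x z : V} {l : List V} {W : Set V} (h : G.Refuter W x)
    (hl : G.Link x l z) (hn : (x :: l).Nodup) (hW : ∀ y ∈ x :: l, y ∉ W) :
    G.Refuter (W ∪ {y | y ∈ x :: l}) z := by
  induction l generalizing x W with
  | nil =>
    refine (h.extend (SimpleGraph.Adj.symm hl) (hW x (by simp))).mono ?_
    intro y hy
    simp only [Set.mem_insert_iff, Set.mem_union, Set.mem_ofPred_eq, List.mem_cons] at hy ⊢
    tauto
  | cons w l ih =>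
    have hn' := List.nodup_cons.1 hn
    refine (ih (h.extend (hl.1.symm) (hW x (by simp))) hl.2 hn'.2 ?_).mono ?_
    · intro y hy hy'
      rcases hy' with rfl | hy'
      · exact hn'.1 hy
      · exact hW y (List.mem_cons_of_mem _ hy) hy'
    · intro y hy
      simp only [Set.mem_insert_iff, Set.mem_union, Set.mem_ofPred_eq, List.mem_cons] at hy ⊢
      tauto

/-- Lists on two disjoint sets, together with lists on the other vertices, form one list
assignment. -/
theorem ChoosableOn.glue {K : Finset V} (h : G.ChoosableOn K) {W₁ W₂ : Set V}
    (hd : Disjoint W₁ W₂) {L₀ L₁ L₂ : V → Finset ℕ} (h₀ : ∀ x, (L₀ x).card = 2)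
    (h₁ : ∀ x, (L₁ x).card = 2) (h₂ : ∀ x, (L₂ x).card = 2) (hW₁ : W₁ ⊆ K) (hW₂ : W₂ ⊆ K) :
    ∃ f : V → ℕ, (∀ x ∈ W₁, f x ∈ L₁ x) ∧ (∀ x ∈ W₂, f x ∈ L₂ x) ∧
      (∀ x ∈ K, x ∉ W₁ → x ∉ W₂ → f x ∈ L₀ x) ∧ G.ProperOn K f := by
  classical
  obtain ⟨f, hf, hp⟩ := h (fun x => if x ∈ W₁ then L₁ x else if x ∈ W₂ then L₂ x else L₀ x)
    (fun x => by split_ifs <;> simp [*])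
  refine ⟨f, fun x hx => ?_, fun x hx => ?_, fun x hx hx₁ hx₂ => ?_, hp⟩
  · simpa [hx] using hf x (hW₁ hx)
  · simpa [hx, Set.disjoint_right.1 hd hx] using hf x (hW₂ hx)
  · simpa [hx₁, hx₂] using hf x hx

/-- Two disjoint refuters of the same vertex rule out both colours of its list. -/
theorem not_choosableOn_of_refuters {K : Finset V} {W₁ W₂ : Set V} {v : V} (h₁ : G.Refuter W₁ v)
    (h₂ : G.Refuter W₂ v) (hd : Disjoint W₁ W₂) (hv : v ∈ K) (hW₁ : W₁ ⊆ K) (hW₂ : W₂ ⊆ K)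
    (hv₁ : v ∉ W₁) (hv₂ : v ∉ W₂) : ¬ G.ChoosableOn K := by
  intro h
  obtain ⟨L₁, hL₁, hf₁⟩ := h₁ 0
  obtain ⟨L₂, hL₂, hf₂⟩ := h₂ 1
  obtain ⟨f, hW₁', hW₂', h₀, hp⟩ := h.glue hd (L₀ := fun _ => {0, 1}) (by simp) hL₁ hL₂ hW₁ hW₂
  have hc : f v = 0 ∨ f v = 1 := by simpa using h₀ v hv hv₁ hv₂
  have key : ∀ W : Set V, W ⊆ K → G.ProperOn (insert v (insert v W)) f := fun W hW =>
    hp.mono (by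
      intro x hx
      simp only [Set.mem_insert_iff] at hx
      rcases hx with rfl | rfl | hx
      exacts [hv, hv, hW hx])
  rcases hc with hc | hc
  · exact hf₁ f hW₁' (key _ hW₁) hc hc
  · exact hf₂ f hW₂' (key _ hW₂) hc hc

/-- Along a walk all of whose vertices have the list `{0, 1}` the colours alternate. -/
theorem two_colours_link {u v : V} {l : List V} (h : G.Link u l v) :
    (∀ f : V → ℕ, (∀ x ∈ u :: v :: l, f x = 0 ∨ f x = 1) →
      G.ProperOn {x | x ∈ u :: v :: l} f → f u = f v) ∨
    (∀ f : V → ℕ, (∀ x ∈ u :: v :: l, f x = 0 ∨ f x = 1) →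
      G.ProperOn {x | x ∈ u :: v :: l} f → f u ≠ f v) := by
  induction l generalizing u with
  | nil => exact Or.inr fun f _ hp => hp u (by simp) v (by simp) h
  | cons w l ih =>
    have hsub : ∀ x ∈ w :: v :: l, x ∈ u :: v :: w :: l := by
      intro x hx; simp only [List.mem_cons] at hx ⊢; tauto
    have hmono : ∀ f : V → ℕ, G.ProperOn {x | x ∈ u :: v :: w :: l} f →
        G.ProperOn {x | x ∈ w :: v :: l} f := fun f hp => hp.mono hsub
    rcases ih h.2 with h' | h'
    · refine Or.inr fun f hf hp => ?_
      have e1 := h' f (fun x hx => hf x (hsub x hx)) (hmono f hp)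
      have e2 := hp u (by simp) w (by simp) h.1
      omega
    · refine Or.inl fun f hf hp => ?_
      have e1 := h' f (fun x hx => hf x (hsub x hx)) (hmono f hp)
      have e2 := hp u (by simp) w (by simp) h.1
      have a1 := hf u (by simp)
      have a2 := hf v (by simp)
      have a3 := hf w (by simp)
      omega

/-- A theta graph two of whose three paths have at least two interior vertices is not
2-choosable: with the list `{0, 1}` on the ends and on the third path, the third path rules out two
of the four pairs of colours of the ends, and the other two paths rule out one pair each. -/
theorem not_choosableOn_of_theta {K : Finset V} {u v : V} {l₁ l₂ l₃ : List V} (hu : u ∈ K)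
    (hv : v ∈ K) (h₁ : G.Link u l₁ v) (h₂ : G.Link u l₂ v) (h₃ : G.Link u l₃ v)
    (hn₁ : l₁.Nodup) (hn₂ : l₂.Nodup) (hK₁ : ∀ x ∈ l₁, x ∈ K) (hK₂ : ∀ x ∈ l₂, x ∈ K)
    (hK₃ : ∀ x ∈ l₃, x ∈ K) (d₁₂ : ∀ x ∈ l₁, x ∉ l₂) (d₁₃ : ∀ x ∈ u :: v :: l₃, x ∉ l₁)
    (d₂₃ : ∀ x ∈ u :: v :: l₃, x ∉ l₂) (hl₁ : 2 ≤ l₁.length) (hl₂ : 2 ≤ l₂.length) :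
    ¬ G.ChoosableOn K := by
  intro h
  have main : ∀ s₁ t₁ s₂ t₂ : ℕ, ∃ f : V → ℕ, (∀ x ∈ u :: v :: l₃, f x = 0 ∨ f x = 1) ∧
      G.ProperOn {x | x ∈ u :: v :: l₃} f ∧ (f u = s₁ → f v ≠ t₁) ∧ (f u = s₂ → f v ≠ t₂) := by
    intro s₁ t₁ s₂ t₂
    obtain ⟨L₁, hL₁, hf₁⟩ := forbids_of_link h₁ hn₁ (s := s₁) (t := t₁) (Or.inr hl₁)
    obtain ⟨L₂, hL₂, hf₂⟩ := forbids_of_link h₂ hn₂ (s := s₂) (t := t₂) (Or.inr hl₂)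
    obtain ⟨f, hW₁', hW₂', h₀, hp⟩ := h.glue (Set.disjoint_left.2 d₁₂) (L₀ := fun _ => {0, 1})
      (by simp) hL₁ hL₂ hK₁ hK₂
    have hK : ∀ x ∈ u :: v :: l₃, x ∈ K := by
      intro x hx
      simp only [List.mem_cons] at hx
      rcases hx with rfl | rfl | hx
      exacts [hu, hv, hK₃ x hx]
    have key : ∀ W : Set V, W ⊆ K → G.ProperOn (insert u (insert v W)) f := fun W hW =>
      hp.mono (by
        intro x hx
        simp only [Set.mem_insert_iff] at hx
        rcases hx with rfl | rfl | hx
        exacts [hu, hv, hW hx])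
    exact ⟨f, fun x hx => by simpa using h₀ x (hK x hx) (d₁₃ x hx) (d₂₃ x hx),
      hp.mono hK, hf₁ f hW₁' (key _ hK₁), hf₂ f hW₂' (key _ hK₂)⟩
  rcases two_colours_link h₃ with h' | h'
  · obtain ⟨f, hf, hp, g₁, g₂⟩ := main 0 0 1 1
    have := h' f hf hp
    have := hf u (by simp)
    omega
  · obtain ⟨f, hf, hp, g₁, g₂⟩ := main 0 1 1 0
    have := h' f hf hp
    have := hf u (by simp)
    have := hf v (by simp)
    omega

/-- Four internally disjoint paths between `u` and `v`, two of them of length two, form a graph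
that is not 2-choosable: with disjoint lists on `u` and `v`, each path rules out one pair of
colours. -/
theorem not_choosableOn_of_four_links {K : Finset V} {u v p q : V} {l₁ l₂ : List V} (hu : u ∈ K)
    (hv : v ∈ K) (hp : p ∈ K) (hq : q ∈ K) (huv : u ≠ v) (hpq : p ≠ q)
    (hup : G.Adj u p) (hpv : G.Adj p v) (huq : G.Adj u q) (hqv : G.Adj q v)
    (h₁ : G.Link u l₁ v) (h₂ : G.Link u l₂ v) (hl₁ : l₁ ≠ []) (hl₂ : l₂ ≠ [])
    (hn₁ : l₁.Nodup) (hn₂ : l₂.Nodup) (hK₁ : ∀ x ∈ l₁, x ∈ K) (hK₂ : ∀ x ∈ l₂, x ∈ K)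
    (d₁₂ : ∀ x ∈ l₁, x ∉ l₂) (d₁ : ∀ x ∈ [u, v, p, q], x ∉ l₁) (d₂ : ∀ x ∈ [u, v, p, q], x ∉ l₂) :
    ¬ G.ChoosableOn K := by
  classical
  intro h
  obtain ⟨L₁, hL₁, hf₁⟩ := forbids_of_link h₁ hn₁ (s := 0) (t := 2) (Or.inl ⟨hl₁, by simp⟩)
  obtain ⟨L₂, hL₂, hf₂⟩ := forbids_of_link h₂ hn₂ (s := 1) (t := 3) (Or.inl ⟨hl₂, by simp⟩)
  obtain ⟨f, hW₁', hW₂', h₀, hpr⟩ := h.glue (Set.disjoint_left.2 d₁₂)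
    (L₀ := fun x => if x = v then {2, 3} else if x = p then {0, 3} else if x = q then {1, 2}
      else {0, 1})
    (by intro x; split_ifs <;> simp) hL₁ hL₂ hK₁ hK₂
  have key : ∀ W : Set V, W ⊆ K → G.ProperOn (insert u (insert v W)) f := fun W hW =>
    hpr.mono (by
      intro x hx
      simp only [Set.mem_insert_iff] at hx
      rcases hx with rfl | rfl | hx
      exacts [hu, hv, hW hx])
  have g₁ := hf₁ f hW₁' (key _ hK₁)
  have g₂ := hf₂ f hW₂' (key _ hK₂)
  have cu := h₀ u hu (d₁ u (by simp)) (d₂ u (by simp))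
  have cv := h₀ v hv (d₁ v (by simp)) (d₂ v (by simp))
  have cp := h₀ p hp (d₁ p (by simp)) (d₂ p (by simp))
  have cq := h₀ q hq (d₁ q (by simp)) (d₂ q (by simp))
  simp [huv, hup.ne, huq.ne] at cu
  simp at cv
  simp [hpv.ne] at cp
  simp [hqv.ne, hpq.symm] at cq
  have e1 := hpr u hu p hp hup
  have e2 := hpr p hp v hv hpv
  have e3 := hpr u hu q hq huq
  have e4 := hpr q hq v hv hqv
  omega

end Gadgets

/-! ### Connected parts, components and paths -/

section Components

open Classical in
/-- The neighbours of `v` in `S`. -/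
noncomputable def nb {V : Type*} (G : SimpleGraph V) (S : Finset V) (v : V) : Finset V :=
  S.filter (G.Adj v)

variable {V : Type*} {G : SimpleGraph V}

@[simp] theorem mem_nb {S : Finset V} {v w : V} : w ∈ G.nb S v ↔ w ∈ S ∧ G.Adj v w := by
  simp [nb]

theorem nb_mono {S T : Finset V} (h : S ⊆ T) (v : V) : G.nb S v ⊆ G.nb T v := fun w hw => by
  rw [mem_nb] at hw ⊢
  exact ⟨h hw.1, hw.2⟩

/-- The subgraph induced by `K` is connected, expressed by cuts: an edge of `K` leaves every
nonempty proper part of `K`. -/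
def Conn (G : SimpleGraph V) (K : Finset V) : Prop :=
  ∀ Y ⊆ K, Y.Nonempty → Y ≠ K → ∃ x ∈ Y, ∃ y ∈ K, y ∉ Y ∧ G.Adj x y

/-- The edges of `G` with both ends in `S`. -/
def within (G : SimpleGraph V) (S : Finset V) : SimpleGraph V where
  Adj a b := G.Adj a b ∧ a ∈ S ∧ b ∈ S
  symm := ⟨fun _ _ h => ⟨h.1.symm, h.2.2, h.2.1⟩⟩
  loopless := ⟨fun _ h => h.1.ne rfl⟩

open Classical in
/-- The vertex set of the connected component of `v` in the subgraph induced by `S`. -/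
noncomputable def comp (G : SimpleGraph V) (S : Finset V) (v : V) : Finset V :=
  S.filter ((G.within S).Reachable v)

theorem mem_comp {S : Finset V} {v w : V} :
    w ∈ G.comp S v ↔ w ∈ S ∧ (G.within S).Reachable v w := by
  simp [comp]

theorem comp_subset {S : Finset V} {v : V} : G.comp S v ⊆ S := fun _ h => (mem_comp.1 h).1

theorem self_mem_comp {S : Finset V} {v : V} (h : v ∈ S) : v ∈ G.comp S v :=
  mem_comp.2 ⟨h, Reachable.refl v⟩

theorem comp_closed {S : Finset V} {v x y : V} (hx : x ∈ G.comp S v) (hy : y ∈ S)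
    (h : G.Adj x y) : y ∈ G.comp S v := by
  have := mem_comp.1 hx
  exact mem_comp.2 ⟨hy, this.2.trans (Adj.reachable (G := G.within S) ⟨h, this.1, hy⟩)⟩

theorem comp_eq_of_mem {S : Finset V} {v w : V} (h : w ∈ G.comp S v) :
    G.comp S w = G.comp S v := by
  have hvw := (mem_comp.1 h).2
  ext x
  rw [mem_comp, mem_comp]
  exact ⟨fun h => ⟨h.1, hvw.trans h.2⟩, fun h => ⟨h.1, hvw.symm.trans h.2⟩⟩

theorem comp_mono {S T : Finset V} (h : S ⊆ T) (v : V) : G.comp S v ⊆ G.comp T v := fun w hw => by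
  rw [mem_comp] at hw ⊢
  refine ⟨h hw.1, hw.2.mono ?_⟩
  intro a b hab
  exact ⟨hab.1, h hab.2.1, h hab.2.2⟩

theorem nb_comp {S : Finset V} {v x : V} (hx : x ∈ G.comp S v) :
    G.nb (G.comp S v) x = G.nb S x := by
  ext w
  simp only [mem_nb]
  exact ⟨fun h => ⟨comp_subset h.1, h.2⟩, fun h => ⟨comp_closed hx h.1 h.2, h.2⟩⟩

/-- A part of `S` that no edge of `S` leaves contains the components of its vertices. -/
theorem comp_subset_of_closed {S Y : Finset V} {v : V} (hv : v ∈ Y)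
    (hY : ∀ x ∈ Y, ∀ y ∈ S, G.Adj x y → y ∈ Y) : G.comp S v ⊆ Y := by
  intro w hw
  obtain ⟨p⟩ := (mem_comp.1 hw).2
  clear hw
  induction p with
  | nil => exact hv
  | cons h p ih => exact ih (hY _ hv _ h.2.2 h.1)

theorem conn_comp {S : Finset V} {v : V} : G.Conn (G.comp S v) := by
  intro Y hY ⟨a, ha⟩ hne
  by_contra! hcl
  apply hne
  apply Finset.Subset.antisymm hY
  rw [← comp_eq_of_mem (hY ha)]
  refine comp_subset_of_closed ha fun x hx y hy hxy => ?_
  by_contra hyY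
  exact hcl x hx y (comp_closed (hY hx) hy hxy) hyY hxy

/-- In a connected set, a path from `x` that stops at its first vertex in `T`. -/
theorem Conn.exists_link_first_hit {D : Finset V} (hD : G.Conn D) {T : Set V} {x t₀ : V}
    (hx : x ∈ D) (hxT : x ∉ T) (ht₀ : t₀ ∈ D) (ht₀T : t₀ ∈ T) :
    ∃ l t, t ∈ D ∧ t ∈ T ∧ G.Link x l t ∧ (x :: l).Nodup ∧ ∀ y ∈ l, y ∈ D ∧ y ∉ T := by
  classical
  let P : V → Prop := fun x => x ∈ T ∨
    ∃ l t, t ∈ D ∧ t ∈ T ∧ G.Link x l t ∧ (x :: l).Nodup ∧ ∀ y ∈ l, y ∈ D ∧ y ∉ T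
  suffices h : ∀ x ∈ D, P x from (h x hx).resolve_left hxT
  by_contra! hbad
  obtain ⟨b, hb, hbP⟩ := hbad
  obtain ⟨a, ha, c, hc, hcY, hac⟩ := hD (D.filter fun x => ¬ P x) (Finset.filter_subset _ _)
    ⟨b, by simp [hb, hbP]⟩ (fun e => by
      have : t₀ ∈ D.filter fun x => ¬ P x := by rw [e]; exact ht₀
      exact (Finset.mem_filter.1 this).2 (Or.inl ht₀T))
  obtain ⟨haD, haP⟩ := Finset.mem_filter.1 ha
  have hcP : P c := by
    by_contra h
    exact hcY (Finset.mem_filter.2 ⟨hc, h⟩)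
  have haT : a ∉ T := fun h => haP (Or.inl h)
  by_cases hcT : c ∈ T
  · exact haP (Or.inr ⟨[], c, hc, hcT, hac, by simp, by simp⟩)
  · obtain ⟨l, t, htD, htT, hl, hn, hlT⟩ := hcP.resolve_left hcT
    by_cases hal : a ∈ c :: l
    · rcases List.mem_cons.1 hal with rfl | hal
      · exact hac.ne rfl
      · obtain ⟨l₁, l₂, rfl⟩ := List.append_of_mem hal
        refine haP (Or.inr ⟨l₂, t, htD, htT, (link_append.1 hl).2, ?_,
          fun y hy => hlT y (by simp [hy])⟩)
        exact (List.nodup_append.1 (List.nodup_cons.1 hn).2).2.1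
    · refine haP (Or.inr ⟨c :: l, t, htD, htT, ⟨hac, hl⟩, List.nodup_cons.2 ⟨hal, hn⟩, ?_⟩)
      intro y hy
      rcases List.mem_cons.1 hy with rfl | hy
      exacts [⟨hc, hcT⟩, hlT y hy]

/-- A path between two vertices adjacent to a connected set, with its interior in that set. -/
theorem Conn.exists_link {D : Finset V} (hD : G.Conn D) {x y a b : V} (ha : a ∈ D) (hb : b ∈ D)
    (hxa : G.Adj x a) (hyb : G.Adj y b) :
    ∃ l, l ≠ [] ∧ G.Link x l y ∧ l.Nodup ∧ ∀ w ∈ l, w ∈ D := by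
  by_cases hab : a = b
  · subst hab
    exact ⟨[a], by simp, ⟨hxa, hyb.symm⟩, by simp, by simpa using ha⟩
  · obtain ⟨l, t, htD, rfl, hl, hn, hlT⟩ := hD.exists_link_first_hit (T := {b}) ha hab hb rfl
    refine ⟨a :: (l ++ [t]), by simp, ⟨hxa, link_append.2 ⟨hl, hyb.symm⟩⟩, ?_, ?_⟩
    · rw [← List.cons_append]
      refine List.nodup_append.2 ⟨hn, by simp, ?_⟩
      intro u hu w hw
      rcases List.mem_singleton.1 hw with rfl
      rcases List.mem_cons.1 hu with rfl | hu
      · exact hab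
      · exact (hlT u hu).2
    · intro w hw
      simp only [List.mem_cons, List.mem_append, List.not_mem_nil, or_false] at hw
      rcases hw with rfl | hw | rfl
      exacts [ha, (hlT w hw).1, htD]

/-- A path that ends in `z`, with its other vertices in `D`, and that cannot be prolonged at its
other end `h`. -/
theorem exists_maximal_link [DecidableEq V] {D : Finset V} {z w : V} (hw : w ∈ D)
    (hwz : G.Adj w z) :
    ∃ h l, h ∈ D ∧ G.Link h l z ∧ (h :: l).Nodup ∧ (∀ y ∈ l, y ∈ D) ∧
      ∀ x ∈ D, G.Adj h x → x ∈ l := by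
  have main : ∀ (k : ℕ) (h : V) (l : List V), h ∈ D → G.Link h l z → (h :: l).Nodup →
      (∀ y ∈ l, y ∈ D) → D.card ≤ k + l.length → ∃ h l, h ∈ D ∧ G.Link h l z ∧ (h :: l).Nodup ∧
      (∀ y ∈ l, y ∈ D) ∧ ∀ x ∈ D, G.Adj h x → x ∈ l := by
    intro k
    induction k with
    | zero =>
      intro h l hh hl hn hlD hc
      have : (h :: l).toFinset ⊆ D := by
        intro y hy
        rcases List.mem_cons.1 (List.mem_toFinset.1 hy) with rfl | hy
        exacts [hh, hlD y hy]
      have := Finset.card_le_card this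
      rw [List.toFinset_card_of_nodup hn, List.length_cons] at this
      omega
    | succ k ih =>
      intro h l hh hl hn hlD hc
      by_cases hmax : ∀ x ∈ D, G.Adj h x → x ∈ l
      · exact ⟨h, l, hh, hl, hn, hlD, hmax⟩
      · push Not at hmax
        obtain ⟨x, hx, hhx, hxl⟩ := hmax
        refine ih x (h :: l) hx ⟨hhx.symm, hl⟩ (List.nodup_cons.2 ⟨?_, hn⟩) ?_ ?_
        · simp [hxl, hhx.ne.symm]
        · intro y hy
          rcases List.mem_cons.1 hy with rfl | hy
          exacts [hh, hlD y hy]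
        · rw [List.length_cons]; omega
  exact main D.card w [] hw hwz (by simp) (by simp) (by simp)

theorem exists_ne_of_two_le_card {s : Finset V} (h : 2 ≤ s.card) (a : V) : ∃ b ∈ s, b ≠ a := by
  obtain ⟨b, hb, c, hc, hbc⟩ := Finset.one_lt_card.1 (show 1 < s.card by omega)
  by_cases hba : b = a
  · exact ⟨c, hc, fun e => hbc (hba.trans e.symm)⟩
  · exact ⟨b, hb, hba⟩

/-- A set refutes a vertex `z` attached to it if no path can end in it: a maximal path from `z`
closes a cycle, which refutes the vertex where it closes, and the path carries this back to `z`. -/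
theorem refuter_of_two_le_card_nb [DecidableEq V] {D : Finset V} {z w : V} (hz : z ∉ D)
    (hw : w ∈ D) (hzw : G.Adj z w) (hD : ∀ x ∈ D, 2 ≤ (G.nb (insert z D) x).card) :
    G.Refuter D z := by
  obtain ⟨h, l, hh, hl, hn, hlD, hmax⟩ := exists_maximal_link hw hzw.symm
  have hhn := (List.nodup_cons.1 hn).1
  have hnb : ∀ x ∈ G.nb (insert z D) h, x = z ∨ x ∈ l := by
    intro x hx
    obtain ⟨hx, hhx⟩ := mem_nb.1 hx
    rcases Finset.mem_insert.1 hx with rfl | hx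
    exacts [Or.inl rfl, Or.inr (hmax x hx hhx)]
  rcases l with _ | ⟨g, l'⟩
  · obtain ⟨x, hx, hxz⟩ := exists_ne_of_two_le_card (hD h hh) z
    simpa [hxz] using hnb x hx
  · obtain ⟨x, hx, hxg⟩ := exists_ne_of_two_le_card (hD h hh) g
    have hhx := (mem_nb.1 hx).2
    rcases hnb x hx with rfl | hxl
    · refine (refuter_of_link (l := h :: g :: l') ⟨hhx.symm, hl⟩ hn (by simp)).mono ?_
      intro y hy
      rcases List.mem_cons.1 hy with rfl | hy
      exacts [hh, hlD y hy]
    · obtain ⟨l₁, l₂, rfl⟩ := List.append_of_mem ((List.mem_cons.1 hxl).resolve_left hxg)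
      rw [← List.cons_append, link_append] at hl
      rw [← List.cons_append, ← List.cons_append, List.nodup_append] at hn
      have hr := refuter_of_link (v := x) (l := h :: g :: l₁) ⟨hhx.symm, hl.1⟩ hn.1 (by simp)
      refine (hr.extend_link hl.2 hn.2.1 ?_).mono ?_
      · intro y hy hy'
        exact hn.2.2 y hy' y hy rfl
      · intro y hy
        rcases hy with hy | hy
        · rcases List.mem_cons.1 hy with rfl | hy
          exacts [hh, hlD y (by rw [← List.cons_append]; exact List.mem_append_left _ hy)]
        · exact hlD y (by rw [← List.cons_append]; exact List.mem_append_right _ hy)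

end Components

/-! ### Connected 2-choosable graphs of minimum degree two: the structure -/

section Necessity

variable {V : Type*} {G : SimpleGraph V}

/-- `K` induces a connected 2-choosable subgraph of minimum degree at least two. -/
structure ChoosableCore (G : SimpleGraph V) (K : Finset V) : Prop where
  conn : G.Conn K
  choosable : G.ChoosableOn K
  two_le : ∀ v ∈ K, 2 ≤ (G.nb K v).card

theorem ChoosableOn.exists_bipartition {K : Finset V} (h : G.ChoosableOn K) :
    ∃ χ : V → ℕ, (∀ v ∈ K, χ v = 0 ∨ χ v = 1) ∧ G.ProperOn K χ := by
  obtain ⟨f, hf, hp⟩ := h (fun _ => {0, 1}) (by simp)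
  exact ⟨f, fun v hv => by simpa using hf v hv, hp⟩

theorem ChoosableOn.no_triangle {K : Finset V} (h : G.ChoosableOn K) {a b c : V} (ha : a ∈ K)
    (hb : b ∈ K) (hc : c ∈ K) (hab : G.Adj a b) (hbc : G.Adj b c) : ¬ G.Adj a c := by
  intro hac
  obtain ⟨χ, hχ, hp⟩ := h.exists_bipartition
  have := hχ a ha
  have := hχ b hb
  have := hχ c hc
  have := hp a ha b hb hab
  have := hp b hb c hc hbc
  have := hp a ha c hc hac
  omega

variable {K : Finset V}

/-- A connected part outside a four-cycle is not attached to both ends of an edge of the cycle. -/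
theorem ChoosableOn.not_attached_to_edge (h : G.ChoosableOn K) {x₁ x₂ x₃ x₄ a b : V}
    {D : Finset V} (hx₁ : x₁ ∈ K) (hx₂ : x₂ ∈ K) (hx₃ : x₃ ∈ K) (hx₄ : x₄ ∈ K)
    (h₁₂ : G.Adj x₁ x₂) (h₂₃ : G.Adj x₂ x₃) (h₃₄ : G.Adj x₃ x₄) (h₄₁ : G.Adj x₄ x₁)
    (h₁₃ : x₁ ≠ x₃) (h₂₄ : x₂ ≠ x₄) (hD : G.Conn D) (hDK : D ⊆ K)
    (hDx : ∀ x ∈ [x₁, x₂, x₃, x₄], x ∉ D) (ha : a ∈ D) (hb : b ∈ D) (ha₁ : G.Adj x₁ a)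
    (hb₂ : G.Adj x₂ b) : False := by
  obtain ⟨l, hl0, hl, hln, hlD⟩ := hD.exists_link ha hb ha₁ hb₂
  have nx : ∀ x ∈ [x₁, x₂, x₃, x₄], x ∉ l := fun x hx hxl => hDx x hx (hlD x hxl)
  have c : 2 ≤ l.length := by
    rcases l with _ | ⟨m, _ | ⟨m', l⟩⟩
    · exact absurd rfl hl0
    · exact absurd h₁₂ (h.no_triangle hx₁ (hDK (hlD m (by simp))) hx₂ hl.1 hl.2)
    · simp
  refine not_choosableOn_of_theta hx₁ hx₂ hl (l₂ := [x₄, x₃]) (l₃ := [])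
    ⟨h₄₁.symm, h₃₄.symm, h₂₃.symm⟩ h₁₂ hln (by simpa using h₃₄.ne.symm)
    (fun x hx => hDK (hlD x hx)) (by simp [hx₃, hx₄]) (by simp) ?_ ?_ ?_ c (by simp) h
  · intro x hx hx'
    refine nx x ?_ hx
    simp only [List.mem_cons, List.not_mem_nil, or_false] at hx' ⊢
    tauto
  · intro x hx
    refine nx x ?_
    simp only [List.mem_cons, List.not_mem_nil, or_false] at hx ⊢
    tauto
  · intro x hx
    simp only [List.mem_cons, List.not_mem_nil, or_false] at hx ⊢
    rcases hx with rfl | rfl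
    · simp [h₄₁.ne.symm, h₁₃]
    · simp [h₂₄, h₂₃.ne]

/-- Disjoint connected parts outside a four-cycle are not attached to crossing pairs of opposite
vertices of the cycle. -/
theorem ChoosableOn.not_crossing (h : G.ChoosableOn K) {z p c q a₁ b₁ a₂ b₂ : V}
    {D₁ D₂ : Finset V} (hz : z ∈ K) (hp : p ∈ K) (hc : c ∈ K) (hq : q ∈ K)
    (hzp : G.Adj z p) (hcp : G.Adj c p) (hzq : G.Adj z q) (hzc : z ≠ c) (hpq : p ≠ q)
    (hcq : c ≠ q)
    (hD₁ : G.Conn D₁) (hD₂ : G.Conn D₂) (hK₁ : D₁ ⊆ K) (hK₂ : D₂ ⊆ K)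
    (hx₁ : ∀ x ∈ [z, p, c, q], x ∉ D₁) (hx₂ : ∀ x ∈ [z, p, c, q], x ∉ D₂)
    (hd : ∀ x ∈ D₁, x ∉ D₂) (ha₁ : a₁ ∈ D₁) (hb₁ : b₁ ∈ D₁) (ha₂ : a₂ ∈ D₂) (hb₂ : b₂ ∈ D₂)
    (hza : G.Adj z a₁) (hcb : G.Adj c b₁) (hpa : G.Adj p a₂) (hqb : G.Adj q b₂) : False := by
  obtain ⟨l, hl0, hl, hln, hlD⟩ := hD₁.exists_link hb₁ ha₁ hcb hza
  obtain ⟨m, hm0, hm, hmn, hmD⟩ := hD₂.exists_link ha₂ hb₂ hpa hqb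
  have nl : ∀ x ∈ [z, p, c, q], x ∉ l := fun x hx hxl => hx₁ x hx (hlD x hxl)
  have nm : ∀ x ∈ [z, p, c, q], x ∉ m := fun x hx hxl => hx₂ x hx (hmD x hxl)
  refine not_choosableOn_of_theta hp hz (l₁ := c :: l) (l₂ := m ++ [q]) (l₃ := [])
    ⟨hcp.symm, hl⟩ (link_append.2 ⟨hm, hzq.symm⟩) hzp.symm
    (List.nodup_cons.2 ⟨nl c (by simp), hln⟩) ?_ ?_ ?_ (by simp) ?_ ?_ ?_ ?_ ?_ h
  · refine List.nodup_append.2 ⟨hmn, by simp, ?_⟩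
    intro u hu w hw e
    rcases List.mem_singleton.1 hw with rfl
    exact nm w (by simp) (e ▸ hu)
  · intro x hx
    rcases List.mem_cons.1 hx with rfl | hx
    exacts [hc, hK₁ (hlD x hx)]
  · intro x hx
    rcases List.mem_append.1 hx with hx | hx
    · exact hK₂ (hmD x hx)
    · rcases List.mem_singleton.1 hx with rfl
      exact hq
  · intro x hx hx'
    rcases List.mem_cons.1 hx with rfl | hx <;> rcases List.mem_append.1 hx' with hx' | hx'
    · exact nm x (by simp) hx'
    · exact hcq (List.mem_singleton.1 hx')
    · exact hd x (hlD x hx) (hmD x hx')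
    · rcases List.mem_singleton.1 hx' with rfl
      exact nl x (by simp) hx
  · intro x hx
    simp only [List.mem_cons, List.not_mem_nil, or_false] at hx ⊢
    rcases hx with rfl | rfl
    · exact fun e => e.elim hcp.ne.symm (nl x (by simp))
    · exact fun e => e.elim hzc (nl x (by simp))
  · intro x hx
    simp only [List.mem_cons, List.not_mem_nil, or_false] at hx
    rw [List.mem_append, List.mem_singleton]
    rcases hx with rfl | rfl
    · exact fun e => e.elim (nm x (by simp)) hpq
    · exact fun e => e.elim (nm x (by simp)) hzq.ne
  · rcases l with _ | ⟨_, _⟩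
    · exact absurd rfl hl0
    · simp
  · rcases m with _ | ⟨_, _⟩
    · exact absurd rfl hm0
    · simp

variable [DecidableEq V]

/-- No vertex separates a 2-choosable core: the parts on both sides would refute it. -/
theorem ChoosableCore.conn_erase (h : G.ChoosableCore K) {z : V} (hz : z ∈ K) :
    G.Conn (K.erase z) := by
  have piece : ∀ Y ⊆ K.erase z, Y.Nonempty →
      (∀ x ∈ Y, ∀ y ∈ K.erase z, y ∉ Y → ¬ G.Adj x y) → G.Refuter Y z := by
    intro Y hY hne hcl
    have hzY : z ∉ Y := fun hzY => by simpa using hY hzY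
    have hYK : Y ⊆ K := hY.trans (Finset.erase_subset _ _)
    have hadj : ∀ x ∈ Y, ∀ y ∈ K, y ∉ Y → G.Adj x y → y = z := by
      intro x hx y hy hyY hxy
      by_contra hyz
      exact hcl x hx y (Finset.mem_erase.2 ⟨hyz, hy⟩) hyY hxy
    obtain ⟨x, hx, y, hy, hyY, hxy⟩ := h.conn Y hYK hne (fun e => hzY (e ▸ hz))
    have hyz := hadj x hx y hy hyY hxy
    subst hyz
    refine refuter_of_two_le_card_nb hzY hx hxy.symm fun w hw => ?_
    refine (h.two_le w (hYK hw)).trans (Finset.card_le_card fun v hv => ?_)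
    obtain ⟨hv, hwv⟩ := mem_nb.1 hv
    refine mem_nb.2 ⟨?_, hwv⟩
    by_cases hvY : v ∈ Y
    · exact Finset.mem_insert_of_mem hvY
    · rw [hadj w hw v hv hvY hwv]
      exact Finset.mem_insert_self _ _
  intro Y hY hne hYne
  by_contra! hcl
  have hne' : (K.erase z \ Y).Nonempty := by
    rw [Finset.sdiff_nonempty]
    exact fun h' => hYne (Finset.Subset.antisymm hY h')
  have hsub : K.erase z \ Y ⊆ K.erase z := Finset.sdiff_subset
  refine not_choosableOn_of_refuters (piece Y hY hne hcl) (piece _ hsub hne' ?_) ?_ hz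
    (fun x hx => Finset.mem_of_mem_erase (hY hx))
    (fun x hx => Finset.mem_of_mem_erase (hsub hx))
    (fun hzY => by simpa using hY hzY) (fun hzY => by simpa using hsub hzY) h.choosable
  · intro x hx y hy hyn hxy
    have hyY : y ∈ Y := by simpa [hy] using hyn
    exact hcl y hyY x (hsub hx) (Finset.mem_sdiff.1 hx).2 hxy.symm
  · exact Set.disjoint_left.2 fun x hx hx' => (Finset.mem_sdiff.1 hx').2 hx

/-- Every branch vertex of a 2-choosable core lies on a four-cycle: otherwise it is an end of a
theta graph at most one of whose paths has length at most two. -/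
theorem ChoosableCore.exists_four_cycle (h : G.ChoosableCore K) {z : V} (hz : z ∈ K)
    (h3 : 3 ≤ (G.nb K z).card) :
    ∃ p ∈ K, ∃ q ∈ K, ∃ c ∈ K, p ≠ q ∧ z ≠ c ∧ G.Adj z p ∧ G.Adj z q ∧ G.Adj c p ∧ G.Adj c q := by
  by_contra! hno
  have no_tri : ∀ a b, a ∈ K → b ∈ K → G.Adj z a → G.Adj a b → G.Adj z b → False :=
    fun a b ha hb hza hab hzb => h.choosable.no_triangle hz ha hb hza hab hzb
  obtain ⟨p, hp, p', hp', hpp'⟩ := Finset.one_lt_card.1 (show 1 < (G.nb K z).card by omega)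
  have hz_erase : ∀ x, x ∈ G.nb K z → x ∈ K.erase z := fun x hx => by
    obtain ⟨hxK, hzx⟩ := mem_nb.1 hx
    exact Finset.mem_erase.2 ⟨hzx.ne.symm, hxK⟩
  -- A cycle through `z` on which only the first vertex `p` and the last vertex `q` are
  -- adjacent to `z`.
  obtain ⟨l₀, q, hqD, ⟨hqN, hqp⟩, hl₀, hn₀, hl₀T⟩ := (h.conn_erase hz).exists_link_first_hit
    (T := {x | x ∈ G.nb K z ∧ x ≠ p}) (x := p) (t₀ := p') (hz_erase p hp) (by simp)
    (hz_erase p' hp') ⟨hp', hpp'.symm⟩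
  set l := p :: (l₀ ++ [q]) with hl_def
  have hzp := (mem_nb.1 hp).2
  have hzq := (mem_nb.1 hqN).2
  have hlK : ∀ x ∈ l, x ∈ K.erase z := by
    intro x hx
    simp only [hl_def, List.mem_cons, List.mem_append, List.not_mem_nil, or_false] at hx
    rcases hx with rfl | hx | rfl
    exacts [hz_erase _ hp, (hl₀T x hx).1, hqD]
  have hln : l.Nodup := by
    rw [hl_def, ← List.cons_append]
    refine List.nodup_append.2 ⟨hn₀, by simp, ?_⟩
    intro u hu w hw
    rcases List.mem_singleton.1 hw with rfl
    rcases List.mem_cons.1 hu with rfl | hu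
    · exact fun e => hqp e.symm
    · rintro rfl
      exact (hl₀T u hu).2 ⟨hqN, hqp⟩
  have hlz : G.Link z l z := ⟨hzp, link_append.2 ⟨hl₀, hzq.symm⟩⟩
  -- The component `D`, outside the cycle, of a third neighbour of `z` has another attachment `y` on
  -- the cycle, since `z` does not separate it.
  obtain ⟨r, hr, hrp, hrq⟩ : ∃ r ∈ G.nb K z, r ≠ p ∧ r ≠ q := by
    have : ((G.nb K z).erase p).erase q |>.Nonempty := by
      rw [← Finset.card_pos]
      have h1 := Finset.pred_card_le_card_erase (s := G.nb K z) (a := p)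
      have h2 := Finset.pred_card_le_card_erase (s := (G.nb K z).erase p) (a := q)
      omega
    obtain ⟨r, hr⟩ := this
    simp only [Finset.mem_erase] at hr
    exact ⟨r, hr.2.2, hr.2.1, hr.1⟩
  have hrl : r ∉ l := by
    intro hrl
    simp only [hl_def, List.mem_cons, List.mem_append, List.not_mem_nil, or_false] at hrl
    rcases hrl with rfl | hrl | rfl
    · exact hrp rfl
    · exact (hl₀T r hrl).2 ⟨hr, hrp⟩
    · exact hrq rfl
  obtain ⟨hrK, hzr⟩ := mem_nb.1 hr
  let R := (K.erase z).filter fun x => x ∉ l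
  have hrR : r ∈ R := Finset.mem_filter.2 ⟨hz_erase r hr, hrl⟩
  let D := G.comp R r
  have hDR : D ⊆ R := comp_subset
  have hD : ∀ x ∈ D, x ∈ K ∧ x ≠ z ∧ x ∉ l := fun x hx => by
    obtain ⟨h1, h2⟩ := Finset.mem_filter.1 (hDR hx)
    exact ⟨Finset.mem_of_mem_erase h1, Finset.ne_of_mem_erase h1, h2⟩
  obtain ⟨x, hx, y, hy, hyD, hxy⟩ := h.conn_erase hz D
    (fun x hx => (Finset.mem_filter.1 (hDR hx)).1) ⟨r, self_mem_comp hrR⟩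
    (fun e => (hD p (e ▸ hz_erase p hp)).2.2 (by simp [hl_def]))
  have hyl : y ∈ l := by
    by_contra hyl
    exact hyD (comp_closed hx (Finset.mem_filter.2 ⟨hy, hyl⟩) hxy)
  have hyK : y ∈ K := Finset.mem_of_mem_erase hy
  have hzy : z ≠ y := (Finset.ne_of_mem_erase hy).symm
  obtain ⟨l', hl'0, hl', hl'n, hl'D⟩ :=
    (conn_comp : G.Conn D).exists_link (self_mem_comp hrR) hx hzr hxy.symm
  obtain ⟨l₁, l₂, hl12⟩ := List.append_of_mem hyl
  have hlz' := hlz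
  rw [hl12, link_append] at hlz'
  have h₁ := hlz'.1
  have h₂ := hlz'.2.reverse
  have hln' := hln
  rw [hl12, List.nodup_append, List.nodup_cons] at hln'
  obtain ⟨hn₁, ⟨hyl₂, hn₂⟩, hd₁₂⟩ := hln'
  have hK₁ : ∀ x ∈ l₁, x ∈ K.erase z := fun x hx => hlK x (by simp [hl12, hx])
  have hK₂ : ∀ x ∈ l₂, x ∈ K.erase z := fun x hx => hlK x (by simp [hl12, hx])
  have hyl₁ : y ∉ l₁ := fun hy => hd₁₂ y hy y (by simp) rfl
  have hd₁₂' : ∀ x ∈ l₁, x ∉ l₂ := fun x hx hx' => hd₁₂ x hx x (by simp [hx']) rfl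
  have hz₁ : z ∉ l₁ := fun hx => by simpa using hK₁ z hx
  have hz₂ : z ∉ l₂ := fun hx => by simpa using hK₂ z hx
  have hz' : z ∉ l' := fun hx => (hD z (hl'D z hx)).2.1 rfl
  have hy' : y ∉ l' := fun hx => (hD y (hl'D y hx)).2.2 hyl
  have hd₁ : ∀ x ∈ l', x ∉ l₁ := fun x hx hx' =>
    (hD x (hl'D x hx)).2.2 (by simp [hl12, hx'])
  have hd₂ : ∀ x ∈ l', x ∉ l₂ := fun x hx hx' =>
    (hD x (hl'D x hx)).2.2 (by simp [hl12, hx'])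
  have hK₁' : ∀ x ∈ l₁, x ∈ K := fun x hx => Finset.mem_of_mem_erase (hK₁ x hx)
  have hK₂' : ∀ x ∈ l₂.reverse, x ∈ K := fun x hx =>
    Finset.mem_of_mem_erase (hK₂ x (List.mem_reverse.1 hx))
  have hK' : ∀ x ∈ l', x ∈ K := fun x hx => (hD x (hl'D x hx)).1
  -- Two of the three paths between `z` and `y` cannot both have at most one interior vertex.
  have no_short : ∀ m₁ m₂ : List V, G.Link z m₁ y → G.Link z m₂ y → (∀ x ∈ m₁, x ∈ K) →
      (∀ x ∈ m₂, x ∈ K) → (∀ x ∈ m₁, x ∉ m₂) → (m₁ ≠ [] ∨ m₂ ≠ []) →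
      m₁.length ≤ 1 → m₂.length ≤ 1 → False := by
    intro m₁ m₂ g₁ g₂ k₁ k₂ gd gne c₁ c₂
    rcases m₁ with _ | ⟨a, _ | ⟨a', m₁⟩⟩ <;> rcases m₂ with _ | ⟨b, _ | ⟨b', m₂⟩⟩
    · simp at gne
    · exact no_tri b y (k₂ b (by simp)) hyK g₂.1 g₂.2 g₁
    · simp at c₂
    · exact no_tri a y (k₁ a (by simp)) hyK g₁.1 g₁.2 g₂
    · exact hno a (k₁ a (by simp)) b (k₂ b (by simp)) y hyK (by simpa using gd) hzy g₁.1 g₂.1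
        g₁.2.symm g₂.2.symm
    · simp at c₂
    · simp at c₁
    · simp at c₁
    · simp at c₁
  have hl12ne : l₁ ≠ [] ∨ l₂.reverse ≠ [] := by
    by_contra! hboth
    have h2 : l₂ = [] := by simpa using hboth.2
    rw [hboth.1, h2] at hl12
    simp [hl_def] at hl12
  refine absurd h.choosable ?_
  by_cases c₁ : 2 ≤ l₁.length
  · by_cases c₂ : 2 ≤ l₂.reverse.length
    · refine not_choosableOn_of_theta hz hyK h₁ h₂ hl' hn₁ (List.nodup_reverse.2 hn₂) hK₁' hK₂' hK'
        (fun x hx => by simpa using hd₁₂' x hx) ?_ ?_ c₁ c₂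
      · intro w hw
        simp only [List.mem_cons] at hw
        rcases hw with rfl | rfl | hw
        exacts [hz₁, hyl₁, hd₁ w hw]
      · intro w hw
        simp only [List.mem_cons] at hw
        rw [List.mem_reverse]
        rcases hw with rfl | rfl | hw
        exacts [hz₂, hyl₂, hd₂ w hw]
    · have c' : 2 ≤ l'.length := by
        by_contra c'
        exact no_short l' l₂.reverse hl' h₂ hK' hK₂' (fun x hx => by simpa using hd₂ x hx)
          (Or.inl hl'0) (by omega) (by omega)
      refine not_choosableOn_of_theta hz hyK h₁ hl' h₂ hn₁ hl'n hK₁' hK' hK₂'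
        (fun x hx hx' => hd₁ x hx' hx) ?_ ?_ c₁ c'
      · intro w hw
        simp only [List.mem_cons, List.mem_reverse] at hw
        rcases hw with rfl | rfl | hw
        exacts [hz₁, hyl₁, fun hw' => hd₁₂' w hw' hw]
      · intro w hw
        simp only [List.mem_cons, List.mem_reverse] at hw
        rcases hw with rfl | rfl | hw
        exacts [hz', hy', fun hw' => hd₂ w hw' hw]
  · have c' : 2 ≤ l'.length := by
      by_contra c'
      exact no_short l' l₁ hl' h₁ hK' hK₁' hd₁ (Or.inl hl'0) (by omega) (by omega)
    have c₂ : 2 ≤ l₂.reverse.length := by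
      by_contra c₂
      exact no_short l₁ l₂.reverse h₁ h₂ hK₁' hK₂' (fun x hx => by simpa using hd₁₂' x hx)
        hl12ne (by omega) (by omega)
    refine not_choosableOn_of_theta hz hyK h₂ hl' h₁ (List.nodup_reverse.2 hn₂) hl'n hK₂' hK' hK₁'
      (fun x hx hx' => hd₂ x hx' (List.mem_reverse.1 hx)) ?_ ?_ c₂ c'
    · intro w hw
      simp only [List.mem_cons] at hw
      rw [List.mem_reverse]
      rcases hw with rfl | rfl | hw
      exacts [hz₂, hyl₂, hd₁₂' w hw]
    · intro w hw
      simp only [List.mem_cons] at hw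
      rcases hw with rfl | rfl | hw
      exacts [hz', hy', fun hw' => hd₁ w hw' hw]

end Necessity

/-! ### Branch vertices of 2-choosable graphs -/

section Structure

variable {V : Type*} [DecidableEq V] {G : SimpleGraph V} {K : Finset V}

/-- A branch vertex of a 2-choosable core has degree three and lies opposite another vertex `c` of
degree three on a four-cycle whose other two vertices have degree two; the rest `R` of the core is
connected and meets the neighbourhood of the branch vertex. -/
theorem ChoosableCore.exists_twin (h : G.ChoosableCore K) {z : V} (hz : z ∈ K)
    (h3 : 3 ≤ (G.nb K z).card) :
    ∃ p ∈ K, ∃ q ∈ K, ∃ c ∈ K, p ≠ q ∧ z ≠ c ∧ G.nb K p = {z, c} ∧ G.nb K q = {z, c} ∧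
      (G.nb K z).card = 3 ∧ (G.nb K c).card = 3 ∧ G.Conn (K \ {z, c, p, q}) ∧
      ∃ r ∈ K \ {z, c, p, q}, G.Adj z r := by
  obtain ⟨p, hp, q, hq, c, hc, hpq, hzc, hzp, hzq, hcp, hcq⟩ := h.exists_four_cycle hz h3
  refine ⟨p, hp, q, hq, c, hc, hpq, hzc, ?_⟩
  have hch := h.choosable
  have nzc : ¬ G.Adj z c := hch.no_triangle hz hp hc hzp hcp.symm
  have npq : ¬ G.Adj p q := hch.no_triangle hp hz hq hzp.symm hzq
  set R := K \ {z, c, p, q} with hR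
  have mem_R : ∀ x, x ∈ R ↔ x ∈ K ∧ x ≠ z ∧ x ≠ c ∧ x ≠ p ∧ x ≠ q := fun x => by
    simp [hR, not_or]
  have comp_out : ∀ r : V, ∀ x ∈ G.comp R r, x ∈ K ∧ x ≠ z ∧ x ≠ c ∧ x ≠ p ∧ x ≠ q :=
    fun r x hx => (mem_R x).1 (comp_subset hx)
  have comp_K : ∀ r : V, G.comp R r ⊆ K := fun r x hx => (comp_out r x hx).1
  have out₁ : ∀ r : V, ∀ x ∈ [z, p, c, q], x ∉ G.comp R r := by
    intro r x hx hx'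
    have := comp_out r x hx'
    simp only [List.mem_cons, List.not_mem_nil, or_false] at hx
    tauto
  have out₂ : ∀ r : V, ∀ x ∈ [z, q, c, p], x ∉ G.comp R r := by
    intro r x hx
    refine out₁ r x ?_
    simp only [List.mem_cons, List.not_mem_nil, or_false] at hx ⊢
    tauto
  have out₃ : ∀ r : V, ∀ x ∈ [c, p, z, q], x ∉ G.comp R r := by
    intro r x hx
    refine out₁ r x ?_
    simp only [List.mem_cons, List.not_mem_nil, or_false] at hx ⊢
    tauto
  have out₄ : ∀ r : V, ∀ x ∈ [c, q, z, p], x ∉ G.comp R r := by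
    intro r x hx
    refine out₁ r x ?_
    simp only [List.mem_cons, List.not_mem_nil, or_false] at hx ⊢
    tauto
  -- No component of `R` is attached to both ends of an edge of the four-cycle.
  have zp : ∀ r a b, a ∈ G.comp R r → b ∈ G.comp R r → G.Adj z a → G.Adj p b → False :=
    fun r a b ha hb hza hpb => hch.not_attached_to_edge hz hp hc hq hzp hcp.symm hcq hzq.symm hzc
      hpq conn_comp (comp_K r) (out₁ r) ha hb hza hpb
  have zq : ∀ r a b, a ∈ G.comp R r → b ∈ G.comp R r → G.Adj z a → G.Adj q b → False :=
    fun r a b ha hb hza hqb => hch.not_attached_to_edge hz hq hc hp hzq hcq.symm hcp hzp.symm hzc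
      hpq.symm conn_comp (comp_K r) (out₂ r) ha hb hza hqb
  have cp : ∀ r a b, a ∈ G.comp R r → b ∈ G.comp R r → G.Adj c a → G.Adj p b → False :=
    fun r a b ha hb hca hpb => hch.not_attached_to_edge hc hp hz hq hcp hzp.symm hzq hcq.symm
      hzc.symm hpq conn_comp (comp_K r) (out₃ r) ha hb hca hpb
  have cq : ∀ r a b, a ∈ G.comp R r → b ∈ G.comp R r → G.Adj c a → G.Adj q b → False :=
    fun r a b ha hb hca hqb => hch.not_attached_to_edge hc hq hz hp hcq hzq.symm hzp hcp.symm
      hzc.symm hpq.symm conn_comp (comp_K r) (out₄ r) ha hb hca hqb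
  have attach : ∀ r ∈ R, ∀ t ∈ K, t ∉ R → ∃ x ∈ G.comp R r, ∃ y,
      y ≠ t ∧ (y = z ∨ y = c ∨ y = p ∨ y = q) ∧ G.Adj y x := by
    intro r hr t ht htR
    have htD : t ∉ G.comp R r := fun ht' => htR (comp_subset ht')
    have hD : G.comp R r ⊆ K.erase t := fun x hx =>
      Finset.mem_erase.2 ⟨fun e => htD (e ▸ hx), comp_K r hx⟩
    obtain ⟨x, hx, y, hy, hyD, hxy⟩ := h.conn_erase ht _ hD ⟨r, self_mem_comp hr⟩ (by
      intro e
      have key : ∀ y ∈ K, y ∉ R → y = t := by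
        intro y hy hyR
        by_contra hyt
        have : y ∈ G.comp R r := e ▸ Finset.mem_erase.2 ⟨hyt, hy⟩
        exact hyR (comp_subset this)
      have h1 := key z hz (by simp [mem_R])
      have h2 := key c hc (by simp [mem_R])
      exact hzc (h1.trans h2.symm))
    refine ⟨x, hx, y, Finset.ne_of_mem_erase hy, ?_, hxy.symm⟩
    by_contra hcon
    simp only [not_or] at hcon
    refine hyD (comp_closed hx ((mem_R y).2 ⟨Finset.mem_of_mem_erase hy, hcon⟩) hxy)
  -- Hence every component of `R` is attached to `z` and `c`, or to `p` and `q`.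
  have attach_zc : ∀ r ∈ R, (∀ x ∈ G.comp R r, ¬ G.Adj p x) →
      (∃ x ∈ G.comp R r, G.Adj z x) ∧ ∃ x ∈ G.comp R r, G.Adj c x := by
    intro r hr hpx
    obtain ⟨x, hx, y, hyq, hy, hyx⟩ := attach r hr q hq (by simp [mem_R])
    rcases hy with rfl | rfl | rfl | rfl
    · obtain ⟨x', hx', y', hy'z, hy', hyx'⟩ := attach r hr y hz (by simp [mem_R])
      rcases hy' with rfl | rfl | rfl | rfl
      exacts [absurd rfl hy'z, ⟨⟨x, hx, hyx⟩, x', hx', hyx'⟩, (hpx x' hx' hyx').elim,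
        (zq r x x' hx hx' hyx hyx').elim]
    · obtain ⟨x', hx', y', hy'z, hy', hyx'⟩ := attach r hr y hc (by simp [mem_R])
      rcases hy' with rfl | rfl | rfl | rfl
      exacts [⟨⟨x', hx', hyx'⟩, x, hx, hyx⟩, absurd rfl hy'z, (hpx x' hx' hyx').elim,
        (cq r x x' hx hx' hyx hyx').elim]
    · exact (hpx x hx hyx).elim
    · exact absurd rfl hyq
  obtain ⟨r₀, hr₀, hzr₀⟩ : ∃ r ∈ R, G.Adj z r := by
    have : (((G.nb K z).erase p).erase q).Nonempty := by
      rw [← Finset.card_pos]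
      have h1 := Finset.pred_card_le_card_erase (s := G.nb K z) (a := p)
      have h2 := Finset.pred_card_le_card_erase (s := (G.nb K z).erase p) (a := q)
      omega
    obtain ⟨r, hr⟩ := this
    simp only [Finset.mem_erase, mem_nb] at hr
    exact ⟨r, (mem_R r).2 ⟨hr.2.2.1, hr.2.2.2.ne.symm, fun e => nzc (e ▸ hr.2.2.2), hr.2.1, hr.1⟩,
      hr.2.2.2⟩
  have hr₀D := self_mem_comp (G := G) hr₀
  obtain ⟨-, b₀, hb₀, hcb₀⟩ := attach_zc r₀ hr₀ fun x hx hpx => zp r₀ r₀ x hr₀D hx hzr₀ hpx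
  have disj : ∀ r, r ∉ G.comp R r₀ → ∀ x ∈ G.comp R r₀, x ∉ G.comp R r := by
    intro r hr x hx hx'
    by_cases hrR : r ∈ R
    · refine hr ?_
      rw [← comp_eq_of_mem hx, comp_eq_of_mem hx']
      exact self_mem_comp hrR
    · have h2 := mem_comp.1 hx'
      obtain ⟨w⟩ := h2.2
      cases w with
      | nil => exact hrR h2.1
      | cons h _ => exact hrR h.2.1
  -- A component attached to `p` and `q` would cross that of `r₀`.
  have p_out : ∀ r ∈ R, ¬ G.Adj p r := by
    intro r hr hpr
    have hrD := self_mem_comp (G := G) hr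
    have hr' : r ∉ G.comp R r₀ := fun hr' => zp r₀ r₀ r hr₀D hr' hzr₀ hpr
    obtain ⟨x, hx, y, hyp, hy, hyx⟩ := attach r hr p hp (by simp [mem_R])
    rcases hy with rfl | rfl | rfl | rfl
    · exact zp r x r hx hrD hyx hpr
    · exact cp r x r hx hrD hyx hpr
    · exact hyp rfl
    · exact hch.not_crossing hz hp hc hq hzp hcp hzq hzc hpq hcq.ne conn_comp conn_comp (comp_K r₀)
        (comp_K r) (out₁ r₀) (out₁ r) (disj r hr') hr₀D hb₀ hrD hx hzr₀ hcb₀ hpr hyx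
  have q_out : ∀ r ∈ R, ¬ G.Adj q r := by
    intro r hr hqr
    have hrD := self_mem_comp (G := G) hr
    obtain ⟨⟨x, hx, hzx⟩, -⟩ := attach_zc r hr fun x hx => p_out x (comp_subset hx)
    exact zq r x r hx hrD hzx hqr
  -- A second component attached to `z` and `c` would give four paths between them.
  have R_eq : G.comp R r₀ = R := by
    refine Finset.Subset.antisymm comp_subset fun r hr => ?_
    by_contra hr'
    obtain ⟨⟨a, ha, hza⟩, b, hb, hcb⟩ := attach_zc r hr fun x hx => p_out x (comp_subset hx)
    obtain ⟨l₁, hl₁0, hl₁, hl₁n, hl₁D⟩ := (conn_comp : G.Conn (G.comp R r₀)).exists_link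
      hr₀D hb₀ hzr₀ hcb₀
    obtain ⟨l₂, hl₂0, hl₂, hl₂n, hl₂D⟩ := (conn_comp : G.Conn (G.comp R r)).exists_link
      ha hb hza hcb
    have hsub : ∀ x ∈ [z, c, p, q], x ∈ [z, p, c, q] := by
      intro x hx
      simp only [List.mem_cons, List.not_mem_nil, or_false] at hx ⊢
      tauto
    exact not_choosableOn_of_four_links hz hc hp hq hzc hpq hzp hcp.symm hzq hcq.symm hl₁ hl₂ hl₁0
      hl₂0 hl₁n hl₂n (fun x hx => comp_K _ (hl₁D x hx)) (fun x hx => comp_K _ (hl₂D x hx))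
      (fun x hx hx' => disj r hr' x (hl₁D x hx) (hl₂D x hx'))
      (fun x hx hx' => out₁ r₀ x (hsub x hx) (hl₁D x hx'))
      (fun x hx hx' => out₁ r x (hsub x hx) (hl₂D x hx')) hch
  have R_conn : G.Conn R := R_eq ▸ conn_comp
  have R_K : R ⊆ K := Finset.sdiff_subset
  -- A second neighbour in `R` would give two cycles that meet only in `u`.
  have one_nb : ∀ u u', u ∈ K → u ∉ R → u' ∈ K → u' ∉ R → u ≠ u' → G.Adj u p → G.Adj u q →
      G.Adj u' p → G.Adj u' q → ∀ a ∈ R, ∀ b ∈ R, G.Adj u a → G.Adj u b → a = b := by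
    intro u u' hu huR hu' hu'R huu' hup huq hu'p hu'q a ha b hb hua hub
    by_contra hab
    obtain ⟨l, t, htD, rfl, hl, hn, hlT⟩ := R_conn.exists_link_first_hit (T := {b}) ha hab hb rfl
    have hn' : (a :: (l ++ [t])).Nodup := by
      rw [← List.cons_append]
      refine List.nodup_append.2 ⟨hn, by simp, ?_⟩
      intro v hv w hw
      rcases List.mem_singleton.1 hw with rfl
      rcases List.mem_cons.1 hv with rfl | hv
      · exact hab
      · exact (hlT v hv).2
    have hlR : ∀ x ∈ a :: (l ++ [t]), x ∈ R := by
      intro w hw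
      simp only [List.mem_cons, List.mem_append, List.not_mem_nil, or_false] at hw
      rcases hw with rfl | hw | rfl
      exacts [ha, (hlT w hw).1, htD]
    refine not_choosableOn_of_refuters
      (refuter_of_link (v := u) (l := a :: (l ++ [t])) ⟨hua, link_append.2 ⟨hl, hub.symm⟩⟩ hn'
        (by simp))
      (refuter_of_link (v := u) (l := [p, u', q]) ⟨hup, hu'p.symm, hu'q, huq.symm⟩
        (by simp [hpq, hu'p.ne.symm, hu'q.ne]) (by simp)) ?_ hu (fun x hx => R_K (hlR x hx)) ?_
      (fun hx => huR (hlR u hx)) (by simp [hup.ne, huq.ne, huu']) hch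
    · refine Set.disjoint_left.2 fun x hx hx' => ?_
      have hxR := hlR x hx
      simp only [Set.mem_ofPred_eq, List.mem_cons, List.not_mem_nil, or_false] at hx'
      rcases hx' with rfl | rfl | rfl
      · simp [mem_R] at hxR
      · exact hu'R hxR
      · simp [mem_R] at hxR
    · intro x hx
      simp only [Set.mem_ofPred_eq, List.mem_cons, List.not_mem_nil, or_false] at hx
      rcases hx with rfl | rfl | rfl
      exacts [hp, hu', hq]
  have deg_three : ∀ u u' r, u ∈ K → u ∉ R → u' ∈ K → u' ∉ R → u ≠ u' → ¬ G.Adj u u' →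
      (∀ x ∈ K, x = u ∨ x = u' ∨ x = p ∨ x = q ∨ x ∈ R) →
      G.Adj u p → G.Adj u q → G.Adj u' p → G.Adj u' q → r ∈ R → G.Adj u r →
      (G.nb K u).card = 3 := by
    intro u u' r hu huR hu' hu'R huu' nuu' hall hup huq hu'p hu'q hr hur
    have hrR := (mem_R r).1 hr
    rw [show G.nb K u = {p, q, r} from ?_]
    · rw [Finset.card_eq_three]
      exact ⟨p, q, r, hpq, hrR.2.2.2.1.symm, hrR.2.2.2.2.symm, rfl⟩
    · ext x
      simp only [mem_nb, Finset.mem_insert, Finset.mem_singleton]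
      constructor
      · rintro ⟨hx, hux⟩
        rcases hall x hx with rfl | rfl | rfl | rfl | hxR
        · exact (hux.ne rfl).elim
        · exact (nuu' hux).elim
        · simp
        · simp
        · exact Or.inr (Or.inr
            (one_nb u u' hu huR hu' hu'R huu' hup huq hu'p hu'q x hxR r hr hux hur))
      · rintro (rfl | rfl | rfl)
        exacts [⟨hp, hup⟩, ⟨hq, huq⟩, ⟨hrR.1, hur⟩]
  have cases_K : ∀ x ∈ K, x = z ∨ x = c ∨ x = p ∨ x = q ∨ x ∈ R := by
    intro x hx
    rw [mem_R]
    tauto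
  refine ⟨?_, ?_, ?_, ?_, R_conn, r₀, hr₀, hzr₀⟩
  · ext x
    simp only [mem_nb, Finset.mem_insert, Finset.mem_singleton]
    constructor
    · rintro ⟨hx, hpx⟩
      rcases cases_K x hx with rfl | rfl | rfl | rfl | hxR
      exacts [Or.inl rfl, Or.inr rfl, (hpx.ne rfl).elim, (npq hpx).elim, (p_out x hxR hpx).elim]
    · rintro (rfl | rfl)
      exacts [⟨hz, hzp.symm⟩, ⟨hc, hcp.symm⟩]
  · ext x
    simp only [mem_nb, Finset.mem_insert, Finset.mem_singleton]
    constructor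
    · rintro ⟨hx, hqx⟩
      rcases cases_K x hx with rfl | rfl | rfl | rfl | hxR
      exacts [Or.inl rfl, Or.inr rfl, (npq hqx.symm).elim, (hqx.ne rfl).elim,
        (q_out x hxR hqx).elim]
    · rintro (rfl | rfl)
      exacts [⟨hz, hzq.symm⟩, ⟨hc, hcq.symm⟩]
  · exact deg_three z c r₀ hz (by simp [mem_R]) hc (by simp [mem_R]) hzc nzc cases_K hzp hzq hcp hcq
      hr₀ hzr₀
  · exact deg_three c z b₀ hc (by simp [mem_R]) hz (by simp [mem_R]) hzc.symm
      (fun e => nzc e.symm) (fun x hx => by have := cases_K x hx; tauto) hcp hcq hzp hzq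
      (comp_subset hb₀) hcb₀

/-- `z` and `w` are distinct vertices of degree three in `K` with two common neighbours of degree
two. -/
def ThetaPair (G : SimpleGraph V) (K : Finset V) (z w : V) : Prop :=
  z ≠ w ∧ (G.nb K z).card = 3 ∧ (G.nb K w).card = 3 ∧
    ∃ p ∈ K, ∃ q ∈ K, p ≠ q ∧ (G.nb K p).card = 2 ∧ (G.nb K q).card = 2 ∧
      G.Adj z p ∧ G.Adj w p ∧ G.Adj z q ∧ G.Adj w q

/-- In a 2-choosable core every vertex other than `z` of degree different from two is the partner of
`z`: a third branch vertex would lie on a four-cycle disjoint from that of `z`. -/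
theorem ChoosableCore.exists_thetaPair (h : G.ChoosableCore K) {z : V} (hz : z ∈ K)
    (hz2 : (G.nb K z).card ≠ 2) :
    ∃ w ∈ K, G.ThetaPair K z w ∧ ∀ t ∈ K, (G.nb K t).card ≠ 2 → t = z ∨ t = w := by
  have h3 : ∀ t ∈ K, (G.nb K t).card ≠ 2 → 3 ≤ (G.nb K t).card := fun t ht ht2 => by
    have := h.two_le t ht
    omega
  obtain ⟨p, hp, q, hq, c, hc, hpq, hzc, hnp, hnq, hz3, hc3, hR, r, hr, hzr⟩ :=
    h.exists_twin hz (h3 z hz hz2)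
  have adj_of : ∀ {a b x y : V}, G.nb K a = {x, y} → (b = x ∨ b = y) → G.Adj a b := by
    intro a b x y e hb
    have : b ∈ G.nb K a := by rw [e]; simpa using hb
    exact (mem_nb.1 this).2
  have card_of : ∀ {a x y : V}, G.nb K a = {x, y} → x ≠ y → (G.nb K a).card = 2 := by
    intro a x y e hxy
    rw [e, Finset.card_pair hxy]
  have hzp := (adj_of hnp (b := z) (by simp)).symm
  have hzq := (adj_of hnq (b := z) (by simp)).symm
  have hcp := (adj_of hnp (b := c) (by simp)).symm
  have hcq := (adj_of hnq (b := c) (by simp)).symm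
  have hp2 := card_of hnp hzc
  have hq2 := card_of hnq hzc
  refine ⟨c, hc, ⟨hzc, hz3, hc3, p, hp, q, hq, hpq, hp2, hq2, hzp, hcp, hzq, hcq⟩,
    fun d hd hd2 => ?_⟩
  by_contra! hcon
  obtain ⟨p', hp', q', hq', c', hc', hpq', hdc', hnp', hnq', hd3, hc3', -, -⟩ :=
    h.exists_twin hd (h3 d hd hd2)
  have hdp' := (adj_of hnp' (b := d) (by simp)).symm
  have hdq' := (adj_of hnq' (b := d) (by simp)).symm
  have hcp' := (adj_of hnp' (b := c') (by simp)).symm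
  have hcq' := (adj_of hnq' (b := c') (by simp)).symm
  have hp2' := card_of hnp' hdc'
  have hq2' := card_of hnq' hdc'
  set R := K \ {z, c, p, q} with hRdef
  have mem_R : ∀ x, x ∈ R ↔ x ∈ K ∧ x ≠ z ∧ x ≠ c ∧ x ≠ p ∧ x ≠ q := fun x => by
    simp [hRdef, not_or]
  have npq : ∀ x ∈ K, G.Adj d x → x ≠ p ∧ x ≠ q := by
    intro x hx hdx
    constructor <;> rintro rfl
    · have : d ∈ G.nb K x := mem_nb.2 ⟨hd, hdx.symm⟩
      rw [hnp] at this
      simp [hcon.1, hcon.2] at this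
    · have : d ∈ G.nb K x := mem_nb.2 ⟨hd, hdx.symm⟩
      rw [hnq] at this
      simp [hcon.1, hcon.2] at this
  have deg_ne : ∀ {a b : V}, (G.nb K a).card = 2 → (G.nb K b).card = 3 → a ≠ b := by
    rintro a b h1 h2 rfl
    omega
  have hdR : d ∈ R := (mem_R d).2 ⟨hd, hcon.1, hcon.2, (deg_ne hp2 hd3).symm, (deg_ne hq2 hd3).symm⟩
  have hp'R : p' ∈ R := (mem_R p').2
    ⟨hp', deg_ne hp2' hz3, deg_ne hp2' hc3, npq p' hp' hdp'⟩
  have hq'R : q' ∈ R := (mem_R q').2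
    ⟨hq', deg_ne hq2' hz3, deg_ne hq2' hc3, npq q' hq' hdq'⟩
  -- If `c'` were `z` or `c`, then that vertex would have the four neighbours `p`, `q`, `p'`, `q'`.
  have four : ∀ u, G.Adj u p → G.Adj u q → G.Adj u p' → G.Adj u q' → (G.nb K u).card ≠ 3 := by
    intro u h1 h2 h3 h4 h5
    have hsub : ({p, q, p', q'} : Finset V) ⊆ G.nb K u := by
      intro x hx
      simp only [Finset.mem_insert, Finset.mem_singleton] at hx
      rcases hx with rfl | rfl | rfl | rfl
      exacts [mem_nb.2 ⟨hp, h1⟩, mem_nb.2 ⟨hq, h2⟩, mem_nb.2 ⟨hp', h3⟩, mem_nb.2 ⟨hq', h4⟩]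
    have a1 := (mem_R p').1 hp'R
    have a2 := (mem_R q').1 hq'R
    have hcard := Finset.card_le_card hsub
    rw [Finset.card_insert_of_notMem (by simp [hpq, a1.2.2.2.1.symm, a2.2.2.2.1.symm]),
      Finset.card_insert_of_notMem (by simp [a1.2.2.2.2.symm, a2.2.2.2.2.symm]),
      Finset.card_pair hpq'] at hcard
    omega
  have hc'R : c' ∈ R := by
    refine (mem_R c').2 ⟨hc', ?_, ?_, (deg_ne hp2 hc3').symm, (deg_ne hq2 hc3').symm⟩
    · rintro rfl
      exact four c' hzp hzq hcp' hcq' hc3'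
    · rintro rfl
      exact four c' hcp hcq hcp' hcq' hc3'
  -- The four-cycle `d p' c' q'` refutes each of its vertices.
  have refute : ∀ x ∈ ({d, p', c', q'} : Set V),
      G.Refuter (({d, p', c', q'} : Set V) \ {x}) x := by
    have key : ∀ x₁ x₂ x₃ x₄, G.Adj x₁ x₂ → G.Adj x₂ x₃ → G.Adj x₃ x₄ → G.Adj x₄ x₁ → x₂ ≠ x₄ →
        x₁ ≠ x₃ → ({x₂, x₃, x₄} : Set V) ⊆ ({d, p', c', q'} : Set V) →
        G.Refuter (({d, p', c', q'} : Set V) \ {x₁}) x₁ := by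
      intro x₁ x₂ x₃ x₄ g₁ g₂ g₃ g₄ n₂ n₁ hsub
      refine (refuter_of_link (v := x₁) (l := [x₂, x₃, x₄]) ⟨g₁, g₂, g₃, g₄⟩
        (by simp [g₂.ne, g₃.ne, n₂]) (by simp)).mono ?_
      intro y hy
      have hy' : y = x₂ ∨ y = x₃ ∨ y = x₄ := by simpa using hy
      refine ⟨hsub (by simpa using hy'), ?_⟩
      rintro rfl
      rcases hy' with e | e | e
      exacts [g₁.ne e, n₁ e, g₄.ne e.symm]
    intro x hx
    simp only [Set.mem_insert_iff, Set.mem_singleton_iff] at hx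
    rcases hx with rfl | rfl | rfl | rfl
    · exact key x p' c' q' hdp' hcp'.symm hcq' hdq'.symm hpq' hdc' (by
        intro y hy; simp only [Set.mem_insert_iff, Set.mem_singleton_iff] at hy ⊢; tauto)
    · exact key x c' q' d hcp'.symm hcq' hdq'.symm hdp' hdc'.symm hpq' (by
        intro y hy; simp only [Set.mem_insert_iff, Set.mem_singleton_iff] at hy ⊢; tauto)
    · exact key x q' d p' hcq' hdq'.symm hdp' hcp'.symm hpq'.symm hdc'.symm (by
        intro y hy; simp only [Set.mem_insert_iff, Set.mem_singleton_iff] at hy ⊢; tauto)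
    · exact key x d p' c' hdq'.symm hdp' hcp'.symm hcq' hdc' hpq'.symm (by
        intro y hy; simp only [Set.mem_insert_iff, Set.mem_singleton_iff] at hy ⊢; tauto)
  have hCR : ({d, p', c', q'} : Set V) ⊆ R := by
    intro y hy
    simp only [Set.mem_insert_iff, Set.mem_singleton_iff] at hy
    rcases hy with rfl | rfl | rfl | rfl
    exacts [hdR, hp'R, hc'R, hq'R]
  have hzR : z ∉ R := by simp [mem_R]
  have hRK : R ⊆ K := Finset.sdiff_subset
  -- A path in `R` from `z` to this cycle carries the refutation to `z`; the cycle `z p c q` is a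
  -- second refuter, disjoint from `R`.
  have hRz : G.Refuter (R : Set V) z := by
    by_cases hrC : r ∈ ({d, p', c', q'} : Set V)
    · refine ((refute r hrC).extend hzr (by simp)).mono ?_
      intro y hy
      rcases hy with rfl | hy
      exacts [hr, hCR hy.1]
    · obtain ⟨l, t, htR, htC, hl, hn, hlT⟩ :=
        hR.exists_link_first_hit hr hrC hdR (Set.mem_insert d _)
      have hl' : G.Link z (r :: l) t := ⟨hzr, hl⟩
      have htn : t ∉ r :: l := fun ht => by
        rcases List.mem_cons.1 ht with rfl | ht
        exacts [hrC htC, (hlT t ht).2 htC]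
      have hlR : ∀ y ∈ r :: l, y ∈ R ∧ y ∉ ({d, p', c', q'} : Set V) := by
        intro y hy
        rcases List.mem_cons.1 hy with rfl | hy
        exacts [⟨hr, hrC⟩, hlT y hy]
      refine ((refute t htC).extend_link hl'.reverse
        (List.nodup_cons.2 ⟨by rwa [List.mem_reverse], List.nodup_reverse.2 hn⟩) ?_).mono ?_
      · intro y hy hy'
        rcases List.mem_cons.1 hy with rfl | hy
        · simp at hy'
        · exact (hlR y (List.mem_reverse.1 hy)).2 hy'.1
      · intro y hy
        rcases hy with hy | hy
        · exact hCR hy.1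
        · rcases List.mem_cons.1 hy with rfl | hy
          exacts [htR, (hlR y (List.mem_reverse.1 hy)).1]
  refine not_choosableOn_of_refuters hRz
    (refuter_of_link (v := z) (l := [p, c, q]) ⟨hzp, hcp.symm, hcq, hzq.symm⟩
      (by simp [hpq, hcp.ne.symm, hcq.ne]) (by simp)) ?_ hz (by exact_mod_cast hRK) ?_
    (by exact_mod_cast hzR) (by simp [hzp.ne, hzq.ne, hzc]) h.choosable
  · refine Set.disjoint_left.2 fun x hx hx' => ?_
    have hxR := (mem_R x).1 hx
    have hx'' : x = p ∨ x = c ∨ x = q := by simpa using hx'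
    tauto
  · intro x hx
    have hx'' : x = p ∨ x = c ∨ x = q := by simpa using hx
    rcases hx'' with rfl | rfl | rfl
    exacts [hp, hc, hq]

end Structure

/-! ### Even cycles and theta graphs with two paths of length two are 2-choosable -/

section Sufficiency

variable {V : Type*} {G : SimpleGraph V}

/-- The list is an induced path of `G` that ends in `z`. -/
inductive IndPath (G : SimpleGraph V) (z : V) : List V → Prop
  | single : IndPath G z [z]
  | cons {a b : V} {l : List V} : IndPath G z (b :: l) → a ∉ b :: l → G.Adj a b →
      (∀ x ∈ l, ¬ G.Adj a x) → IndPath G z (a :: b :: l)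

theorem IndPath.mem_end {z : V} {l : List V} (h : G.IndPath z l) : z ∈ l := by
  induction h with
  | single => simp
  | cons _ _ _ _ ih => exact List.mem_cons_of_mem _ ih

/-- The colour `γ` of the end `z` of a path and the colour `c` of its vertex `b` extend to a proper
colouring of the path from the lists `L`. -/
def Extends (G : SimpleGraph V) (L : V → Finset ℕ) (l : List V) (z b : V) (γ c : ℕ) : Prop :=
  ∃ f : V → ℕ, (∀ x ∈ l, f x ∈ L x) ∧ G.ProperOn {x | x ∈ l} f ∧ f z = γ ∧ f b = c

theorem exists_ne_of_card_eq_two {s : Finset ℕ} (h : s.card = 2) (a : ℕ) : ∃ b ∈ s, b ≠ a :=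
  exists_ne_of_two_le_card h.ge a

/-- Along a path with 2-element lists, every colour of one end extends to the other end. Moreover,
either some colour of the first end is compatible with both colours of the other end, or the lists
of the two ends agree and the colours extend as they do when all lists agree. -/
theorem IndPath.extends_cases {z : V} {m : List V} (hm : G.IndPath z m) {L : V → Finset ℕ}
    (hL : ∀ x, (L x).card = 2) {χ : V → ℕ} (hχ : ∀ x ∈ m, χ x = 0 ∨ χ x = 1)
    (hp : G.ProperOn {x | x ∈ m} χ) {b : V} {l : List V} (hbl : m = b :: l) :
    (∀ γ ∈ L z, ∃ c ∈ L b, G.Extends L m z b γ c) ∧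
    ((∃ γ ∈ L z, ∀ c ∈ L b, G.Extends L m z b γ c) ∨
      L b = L z ∧ (χ b = χ z → ∀ γ ∈ L z, G.Extends L m z b γ γ) ∧
        (χ b ≠ χ z → ∀ γ ∈ L z, ∀ c ∈ L z, c ≠ γ → G.Extends L m z b γ c)) := by
  classical
  induction hm generalizing b l with
  | single =>
    obtain ⟨rfl, rfl⟩ : z = b ∧ [] = l := by simpa using hbl
    have key : ∀ γ ∈ L z, G.Extends L [z] z z γ γ := fun γ hγ =>
      ⟨fun _ => γ, by simpa using hγ, by
        intro x hx y hy hxy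
        rcases List.mem_singleton.1 hx with rfl
        rcases List.mem_singleton.1 hy with rfl
        exact (hxy.ne rfl).elim, rfl, rfl⟩
    exact ⟨fun γ hγ => ⟨γ, hγ, key γ hγ⟩, Or.inr ⟨rfl, fun _ => key, fun h => (h rfl).elim⟩⟩
  | @cons a d l' hpath ha had hal ih =>
    obtain ⟨rfl, rfl⟩ : a = b ∧ d :: l' = l := by simpa using hbl
    have step : ∀ γ e c, G.Extends L (d :: l') z d γ e → c ∈ L a → c ≠ e →
        G.Extends L (a :: d :: l') z a γ c := by
      rintro γ e c ⟨f, hf, hfp, hfz, hfd⟩ hc hce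
      have hza : z ≠ a := fun h => ha (h ▸ hpath.mem_end)
      have hne : ∀ x ∈ d :: l', x ≠ a := fun x hx h => ha (h ▸ hx)
      have hca : ∀ x ∈ d :: l', G.Adj a x → c ≠ f x := by
        intro x hx hax
        rcases List.mem_cons.1 hx with rfl | hx
        · rwa [hfd]
        · exact (hal x hx hax).elim
      refine ⟨Function.update f a c, ?_, ?_, by simp [hza, hfz], by simp⟩
      · intro x hx
        rcases List.mem_cons.1 hx with rfl | hx
        · simpa using hc
        · simpa [hne x hx] using hf x hx
      · intro x hx y hy hxy
        rcases List.mem_cons.1 hx with rfl | hx' <;> rcases List.mem_cons.1 hy with rfl | hy'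
        · exact (hxy.ne rfl).elim
        · simpa [hne y hy'] using hca y hy' hxy
        · simpa [hne x hx'] using (hca x hx' hxy.symm).symm
        · simpa [hne x hx', hne y hy'] using hfp x hx' y hy' hxy
    obtain ⟨ih₁, ih₂⟩ := ih (fun x hx => hχ x (List.mem_cons_of_mem _ hx))
      (hp.mono fun x hx => List.mem_cons_of_mem _ hx) rfl
    have hχad := hp a (by simp) d (by simp) had
    have hχa := hχ a (by simp)
    have hχd := hχ d (by simp)
    have hχz := hχ z (List.mem_cons_of_mem _ hpath.mem_end)
    constructor
    · intro γ hγ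
      obtain ⟨e, -, he⟩ := ih₁ γ hγ
      obtain ⟨c, hc, hce⟩ := exists_ne_of_card_eq_two (hL a) e
      exact ⟨c, hc, step γ e c he hc hce⟩
    · rcases ih₂ with ⟨γ, hγ, hall⟩ | ⟨hLd, heq, hne⟩
      · refine Or.inl ⟨γ, hγ, fun c hc => ?_⟩
        obtain ⟨e, he, hec⟩ := exists_ne_of_card_eq_two (hL d) c
        exact step γ e c (hall e he) hc hec.symm
      · by_cases hLa : L a = L z
        · refine Or.inr ⟨hLa, fun h γ hγ => ?_, fun h γ hγ c hc hcγ => ?_⟩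
          · obtain ⟨e, he, hec⟩ := exists_ne_of_card_eq_two (hL z) γ
            exact step γ e γ (hne (by omega) γ hγ e he hec) (hLa ▸ hγ) hec.symm
          · exact step γ γ c (heq (by omega) γ hγ) (hLa ▸ hc) hcγ
        · -- A colour that is missing from the list of `a` may be forced on `d`.
          obtain ⟨e, he, hea⟩ : ∃ e ∈ L z, e ∉ L a := by
            by_contra! hcon
            exact hLa (Finset.eq_of_subset_of_card_le hcon (by rw [hL, hL])).symm
          have hce : ∀ c ∈ L a, c ≠ e := fun c hc h => hea (h ▸ hc)
          left
          by_cases h : χ d = χ z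
          · exact ⟨e, he, fun c hc => step e e c (heq h e he) hc (hce c hc)⟩
          · obtain ⟨γ, hγ, hγe⟩ := exists_ne_of_card_eq_two (hL z) e
            exact ⟨γ, hγ, fun c hc => step γ e c (hne h γ hγ e he hγe.symm) hc (hce c hc)⟩

/-- An induced path of even length together with one or two further vertices, each joined to both
ends of the path only, is 2-choosable. -/
theorem IndPath.choosableOn_add {z w p q : V} {l : List V} (hm : G.IndPath z (w :: l))
    {χ : V → ℕ} (hχ : ∀ x ∈ w :: l, χ x = 0 ∨ χ x = 1) (hχp : G.ProperOn {x | x ∈ w :: l} χ)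
    (hχzw : χ w = χ z) {S : Finset V} (hS : ∀ x ∈ S, x ∈ w :: l ∨ x = p ∨ x = q)
    (hp : p ∉ w :: l) (hq : q ∉ w :: l) (hnp : ∀ x ∈ S, G.Adj p x → x = z ∨ x = w)
    (hnq : ∀ x ∈ S, G.Adj q x → x = z ∨ x = w) : G.ChoosableOn S := by
  classical
  intro L hL
  obtain ⟨h₁, h₂⟩ := hm.extends_cases hL hχ hχp rfl
  have hwm : w ∈ w :: l := by simp
  have hzm : z ∈ w :: l := hm.mem_end
  -- The vertices `p` and `q` can be coloured last unless the colours of `z` and `w` make up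
  -- their lists.
  suffices h : ∃ γ c, G.Extends L (w :: l) z w γ c ∧ L p ≠ {γ, c} ∧ L q ≠ {γ, c} by
    obtain ⟨γ, c, ⟨f, hf, hfp, hfz, hfw⟩, hLp, hLq⟩ := h
    have free : ∀ r, L r ≠ {γ, c} → ∃ e ∈ L r, e ≠ γ ∧ e ≠ c := by
      intro r hr
      by_contra! hcon
      refine hr (Finset.eq_of_subset_of_card_le (fun e he => ?_) ?_)
      · rw [Finset.mem_insert, Finset.mem_singleton]
        by_cases heγ : e = γ
        exacts [Or.inl heγ, Or.inr (hcon e he heγ)]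
      · rw [hL]; exact Finset.card_le_two
    obtain ⟨cp, hcp, hcpγ, hcpc⟩ := free p hLp
    obtain ⟨cq, hcq, hcqγ, hcqc⟩ := free q hLq
    have fp : ∀ x, x ∈ w :: l → x ≠ p := fun x hx e => hp (e ▸ hx)
    have fq : ∀ x, x ∈ w :: l → x ≠ q := fun x hx e => hq (e ▸ hx)
    let g : V → ℕ := fun x => if x = p then cp else if x = q then cq else f x
    have gl : ∀ x ∈ w :: l, g x = f x := fun x hx => by simp [g, fp x hx, fq x hx]
    have gout : ∀ x y, (x = p ∨ x = q) → y ∈ S → G.Adj x y → g x ≠ g y := by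
      intro x y hx hy hxy
      have hgx : g x ≠ γ ∧ g x ≠ c := by
        by_cases hxp : x = p
        · simp [g, hxp, hcpγ, hcpc]
        · have hxq := hx.resolve_left hxp
          subst hxq
          simp [g, hxp, hcqγ, hcqc]
      have hyzw : y = z ∨ y = w := by
        rcases hx with rfl | rfl
        exacts [hnp y hy hxy, hnq y hy hxy]
      rcases hyzw with rfl | rfl
      · rw [gl _ hzm, hfz]; exact hgx.1
      · rw [gl _ hwm, hfw]; exact hgx.2
    refine ⟨g, fun x hx => ?_, fun x hx y hy hxy => ?_⟩
    · by_cases hxp : x = p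
      · simpa [g, hxp] using hcp
      · by_cases hxq : x = q
        · subst hxq; simpa [g, hxp] using hcq
        · have hxl := (hS x hx).resolve_right (by tauto)
          rw [gl x hxl]
          exact hf x hxl
    · by_cases hxo : x = p ∨ x = q
      · exact gout x y hxo hy hxy
      by_cases hyo : y = p ∨ y = q
      · exact (gout y x hyo hx hxy.symm).symm
      have hxl := (hS x hx).resolve_right hxo
      have hyl := (hS y hy).resolve_right hyo
      rw [gl x hxl, gl y hyl]
      exact hfp x hxl y hyl hxy
  have pair_ne : ∀ r γ, L r ≠ {γ, γ} := by
    intro r γ h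
    have := hL r
    simp [h] at this
  rcases h₂ with ⟨γ, hγ, hall⟩ | ⟨hLw, heq, -⟩
  · by_cases hγw : γ ∈ L w
    · exact ⟨γ, γ, hall γ hγw, pair_ne p γ, pair_ne q γ⟩
    -- Three pairs of colours extend, and `p` and `q` each rule out at most one of them.
    obtain ⟨γ', hγ', hne⟩ := exists_ne_of_card_eq_two (hL z) γ
    obtain ⟨β, hβ, hβE⟩ := h₁ γ' hγ'
    obtain ⟨β₁, β₂, hβ12, hLw⟩ := Finset.card_eq_two.1 (hL w)
    have hβ₁ : β₁ ∈ L w := by simp [hLw]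
    have hβ₂ : β₂ ∈ L w := by simp [hLw]
    have n₁ : β₁ ≠ γ := fun e => hγw (e ▸ hβ₁)
    have n₂ : β₂ ≠ γ := fun e => hγw (e ▸ hβ₂)
    have n₃ : β ≠ γ := fun e => hγw (e ▸ hβ)
    have d₁ : ∀ r, L r = {γ, β₁} → L r = {γ, β₂} → False := by
      intro r e₁ e₂
      have : β₁ ∈ ({γ, β₂} : Finset ℕ) := by rw [← e₂, e₁]; simp
      simp [n₁, hβ12] at this
    have d₂ : ∀ r β₀, L r = {γ, β₀} → L r = {γ', β} → False := by
      intro r β₀ e₁ e₂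
      have : γ ∈ ({γ', β} : Finset ℕ) := by rw [← e₂, e₁]; simp
      simp [hne.symm, n₃.symm] at this
    by_contra! hcon
    have c₁ := hcon γ β₁ (hall β₁ hβ₁)
    have c₂ := hcon γ β₂ (hall β₂ hβ₂)
    have c₃ := hcon γ' β hβE
    by_cases k₁ : L p = {γ, β₁}
    · exact d₂ q β₂ (c₂ fun k => d₁ p k₁ k) (c₃ fun k => d₂ p β₁ k₁ k)
    · have k₁' := c₁ k₁
      have k₂ : L p = {γ, β₂} := by
        by_contra k₂
        exact d₁ q k₁' (c₂ k₂)
      exact d₂ q β₁ k₁' (c₃ fun k => d₂ p β₂ k₂ k)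
  · obtain ⟨γ, hγ⟩ : (L z).Nonempty := Finset.card_pos.1 (by rw [hL]; omega)
    exact ⟨γ, γ, heq hχzw γ hγ, pair_ne p γ, pair_ne q γ⟩

theorem Link.exists_last {u v : V} {l : List V} (h : G.Link u l v) (hl : l ≠ []) :
    ∃ y ∈ l, G.Adj y v := by
  induction l generalizing u with
  | nil => exact (hl rfl).elim
  | cons w l ih =>
    rcases l with _ | ⟨w', l'⟩
    · exact ⟨w, by simp, h.2⟩
    · obtain ⟨y, hy, hyv⟩ := ih h.2 (by simp)
      exact ⟨y, List.mem_cons_of_mem _ hy, hyv⟩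

theorem no_three_nb [DecidableEq V] {X : Finset V} {x a b c : V} (h : (G.nb X x).card ≤ 2)
    (ha : a ∈ X) (hb : b ∈ X) (hc : c ∈ X) (hxa : G.Adj x a) (hxb : G.Adj x b) (hxc : G.Adj x c)
    (hab : a ≠ b) (hac : a ≠ c) (hbc : b ≠ c) : False := by
  have hsub : ({a, b, c} : Finset V) ⊆ G.nb X x := by
    intro y hy
    simp only [Finset.mem_insert, Finset.mem_singleton] at hy
    rcases hy with rfl | rfl | rfl
    exacts [mem_nb.2 ⟨ha, hxa⟩, mem_nb.2 ⟨hb, hxb⟩, mem_nb.2 ⟨hc, hxc⟩]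
  have := Finset.card_le_card hsub
  rw [Finset.card_eq_three.2 ⟨a, b, c, hab, hac, hbc, rfl⟩] at this
  omega

theorem eq_of_card_nb_eq_one {X : Finset V} {x a b : V} (h : (G.nb X x).card = 1) (ha : a ∈ X)
    (hb : b ∈ X) (hxa : G.Adj x a) (hxb : G.Adj x b) : a = b :=
  Finset.card_le_one.1 h.le a (mem_nb.2 ⟨ha, hxa⟩) b (mem_nb.2 ⟨hb, hxb⟩)

/-- In a part `X` of maximum degree two, a path from `h` to `z` whose ends have no neighbours
besides those on the path is induced, and no edge of `X` leaves it. -/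
theorem Link.indPath [DecidableEq V] {X : Finset V} {z : V} (hz : z ∈ X)
    (hz1 : (G.nb X z).card = 1) (hX : ∀ x ∈ X, (G.nb X x).card ≤ 2) {h : V} {l : List V}
    (hl : G.Link h l z) (hn : (h :: (l ++ [z])).Nodup) (hlX : ∀ x ∈ h :: l, x ∈ X)
    (hh : ∀ x ∈ X, x ∈ l ++ [z] → G.Adj h x → (l ++ [z]).head? = some x) :
    G.IndPath z (h :: (l ++ [z])) ∧
      ∀ y ∈ l ++ [z], ∀ x ∈ X, G.Adj y x → x ∈ h :: (l ++ [z]) := by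
  induction l generalizing h with
  | nil =>
    have hhz : h ≠ z := hl.ne
    refine ⟨.cons .single (by simpa using hhz) hl (by simp), ?_⟩
    intro y hy x hx hyx
    rcases List.mem_singleton.1 hy with rfl
    rw [eq_of_card_nb_eq_one hz1 hx (hlX h (by simp)) hyx hl.symm]
    simp
  | cons b l ih =>
    have hn' := List.nodup_cons.1 hn
    have hbX : b ∈ X := hlX b (by simp)
    have hhX : h ∈ X := hlX h (by simp)
    obtain ⟨c, t, hct⟩ : ∃ c t, l ++ [z] = c :: t := by
      rcases l with _ | ⟨c, t⟩
      exacts [⟨z, [], rfl⟩, ⟨c, t ++ [z], rfl⟩]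
    have hmemX : ∀ x ∈ l ++ [z], x ∈ X := by
      intro x hx
      rcases List.mem_append.1 hx with hx | hx
      · exact hlX x (by simp [hx])
      · rcases List.mem_singleton.1 hx with rfl
        exact hz
    have hbc : G.Adj b c := by
      rcases l with _ | ⟨c', t'⟩
      · obtain ⟨rfl, -⟩ : z = c ∧ [] = t := by simpa using hct
        exact hl.2
      · obtain ⟨rfl, -⟩ : c' = c ∧ t' ++ [z] = t := by simpa using hct
        exact hl.2.1
    have hcX : c ∈ X := hmemX c (by simp [hct])
    have hhc : h ≠ c := fun e => hn'.1 (by rw [List.cons_append, hct, e]; simp)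
    have hbnb : ∀ x ∈ X, G.Adj b x → x = h ∨ x = c := by
      intro x hx hbx
      by_contra! hcon
      exact no_three_nb (hX b hbX) hhX hcX hx hl.1.symm hbc hbx hhc hcon.1.symm hcon.2.symm
    obtain ⟨h₁, h₂⟩ := ih hl.2 hn'.2 (fun x hx => hlX x (List.mem_cons_of_mem _ hx)) (by
      intro x hx hxl hbx
      rcases hbnb x hx hbx with rfl | rfl
      · exact (hn'.1 (List.mem_cons_of_mem _ hxl)).elim
      · rw [hct]; rfl)
    refine ⟨.cons h₁ hn'.1 hl.1 ?_, ?_⟩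
    · intro x hx hhx
      have := hh x (hmemX x hx) (List.mem_cons_of_mem _ hx) hhx
      obtain rfl : b = x := by simpa using this
      exact (List.nodup_cons.1 hn'.2).1 hx
    · intro y hy x hx hyx
      rcases List.mem_cons.1 hy with rfl | hy
      · rcases hbnb x hx hyx with rfl | rfl
        · simp
        · simp only [List.cons_append, hct]; simp
      · exact List.mem_cons_of_mem _ (h₂ y hy x hx hyx)

/-- Connected graphs in which all degrees are two apart from the effect of one or two vertices `p`,
`q` with the neighbours `z` and `w`: without these vertices, the graph is a path from `z` to `w`. -/
theorem Conn.choosableOn_of_degrees [DecidableEq V] {K : Finset V} (hK : G.Conn K) {χ : V → ℕ}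
    (hχ : ∀ x ∈ K, χ x = 0 ∨ χ x = 1) (hχp : G.ProperOn K χ) {z w p q : V} (hz : z ∈ K)
    (hw : w ∈ K) (hp : p ∈ K) (hzw : z ≠ w) (hnp : G.nb K p = {z, w}) (hnq : G.nb K q = {z, w})
    (hz1 : (G.nb (K \ {p, q}) z).card = 1) (hw1 : (G.nb (K \ {p, q}) w).card = 1)
    (h2 : ∀ x ∈ K, x ≠ p → x ≠ q → x ≠ z → x ≠ w → (G.nb K x).card = 2) : G.ChoosableOn K := by
  have mem_p : ∀ x, (x ∈ K ∧ G.Adj p x) ↔ x = z ∨ x = w := fun x => by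
    rw [← mem_nb, hnp]; simp
  have mem_q : ∀ x, (x ∈ K ∧ G.Adj q x) ↔ x = z ∨ x = w := fun x => by
    rw [← mem_nb, hnq]; simp
  have hpz := ((mem_p z).2 (by simp)).2
  have hpw := ((mem_p w).2 (by simp)).2
  have hqz := ((mem_q z).2 (by simp)).2
  have hqw := ((mem_q w).2 (by simp)).2
  set X := K \ {p, q} with hX
  have mem_X : ∀ x, x ∈ X ↔ x ∈ K ∧ x ≠ p ∧ x ≠ q := fun x => by simp [hX]
  have hzX : z ∈ X := (mem_X z).2 ⟨hz, hpz.ne.symm, hqz.ne.symm⟩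
  have hwX : w ∈ X := (mem_X w).2 ⟨hw, hpw.ne.symm, hqw.ne.symm⟩
  have hXK : X ⊆ K := Finset.sdiff_subset
  have deg2 : ∀ x ∈ X, x ≠ z → x ≠ w → (G.nb X x).card = 2 := by
    intro x hx hxz hxw
    obtain ⟨hxK, hxp, hxq⟩ := (mem_X x).1 hx
    rw [← h2 x hxK hxp hxq hxz hxw]
    congr 1
    ext y
    simp only [mem_nb, mem_X]
    constructor
    · exact fun h => ⟨h.1.1, h.2⟩
    · refine fun h => ⟨⟨h.1, ?_, ?_⟩, h.2⟩
      · rintro rfl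
        exact ((mem_p x).1 ⟨hxK, h.2.symm⟩).elim hxz hxw
      · rintro rfl
        exact ((mem_q x).1 ⟨hxK, h.2.symm⟩).elim hxz hxw
  have degle : ∀ x ∈ X, (G.nb X x).card ≤ 2 := by
    intro x hx
    by_cases hxz : x = z
    · rw [hxz, hz1]; omega
    by_cases hxw : x = w
    · rw [hxw, hw1]; omega
    exact (deg2 x hx hxz hxw).le
  -- A maximal path that ends in `z` begins in `w`, the only other vertex of degree one.
  obtain ⟨w₀, hw₀⟩ := Finset.card_pos.1 (show 0 < (G.nb X z).card by omega)
  obtain ⟨hw₀X, hzw₀⟩ := mem_nb.1 hw₀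
  obtain ⟨h, l, hh, hl, hn, hlD, hmax⟩ := exists_maximal_link (D := X.erase z)
    (Finset.mem_erase.2 ⟨hzw₀.ne.symm, hw₀X⟩) hzw₀.symm
  obtain ⟨hhz, hhX⟩ := Finset.mem_erase.1 hh
  have hlX : ∀ y ∈ l, y ∈ X := fun y hy => Finset.mem_of_mem_erase (hlD y hy)
  have hlz : ∀ y ∈ l, y ≠ z := fun y hy => Finset.ne_of_mem_erase (hlD y hy)
  have hn' := List.nodup_cons.1 hn
  have hhw : h = w := by
    by_contra hhw
    have hd := deg2 h hhX hhz hhw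
    rcases l with _ | ⟨g, l'⟩
    · obtain ⟨x, hx, hxz⟩ := exists_ne_of_two_le_card hd.ge z
      obtain ⟨hx, hhx⟩ := mem_nb.1 hx
      simpa using hmax x (Finset.mem_erase.2 ⟨hxz, hx⟩) hhx
    · obtain ⟨x, hx, hxg⟩ := exists_ne_of_two_le_card hd.ge g
      obtain ⟨hx, hhx⟩ := mem_nb.1 hx
      by_cases hxz : x = z
      · subst hxz
        obtain ⟨y, hy, hyx⟩ := hl.exists_last (l := g :: l') (by simp)
        have := eq_of_card_nb_eq_one hz1 (hlX y hy) hhX hyx.symm hhx.symm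
        exact hn'.1 (this ▸ hy)
      · have hxl := (List.mem_cons.1 (hmax x (Finset.mem_erase.2 ⟨hxz, hx⟩) hhx)).resolve_left hxg
        obtain ⟨l₁, l₂, rfl⟩ := List.append_of_mem hxl
        rw [← List.cons_append, link_append] at hl
        obtain ⟨hl₁, hl₂⟩ := hl
        obtain ⟨y, hy, hyx⟩ := hl₁.exists_last (by simp)
        have hn₂ := hn'.2
        rw [← List.cons_append, List.nodup_append] at hn₂
        have hyX : y ∈ X := hlX y (by rw [← List.cons_append]; exact List.mem_append_left _ hy)
        have hhy : h ≠ y := by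
          rintro rfl
          exact hn'.1 (by rw [← List.cons_append]; exact List.mem_append_left _ hy)
        rcases l₂ with _ | ⟨s, l₂⟩
        · refine no_three_nb (degle x hx) hhX hyX hzX hhx.symm hyx.symm hl₂ hhy hhz ?_
          exact hlz y (by rw [← List.cons_append]; exact List.mem_append_left _ hy)
        · refine no_three_nb (degle x hx) hhX hyX (hlX s (by simp)) hhx.symm hyx.symm hl₂.1 hhy
            ?_ ?_
          · rintro rfl
            exact hn'.1 (by simp)
          · exact hn₂.2.2 y hy s (by simp)
  subst hhw
  obtain ⟨hpath, hclosed⟩ := hl.indPath hzX hz1 degle (by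
      rw [← List.cons_append]
      refine List.nodup_append.2 ⟨hn, by simp, ?_⟩
      intro u hu v hv
      rcases List.mem_singleton.1 hv with rfl
      rcases List.mem_cons.1 hu with rfl | hu
      exacts [hhz, hlz u hu]) (by
      intro x hx
      rcases List.mem_cons.1 hx with rfl | hx
      exacts [hhX, hlX x hx]) (by
      intro x hx _ hhx
      rcases l with _ | ⟨g, l'⟩
      · rw [eq_of_card_nb_eq_one hw1 hx hzX hhx hl]; rfl
      · rw [eq_of_card_nb_eq_one hw1 hx (hlX g (by simp)) hhx hl.1]; rfl)
  have hmX : ∀ x ∈ h :: (l ++ [z]), x ∈ X := by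
    intro x hx
    simp only [List.mem_cons, List.mem_append, List.not_mem_nil, or_false] at hx
    rcases hx with rfl | hx | rfl
    exacts [hhX, hlX x hx, hzX]
  have hclosed' : ∀ y ∈ h :: (l ++ [z]), ∀ x ∈ X, G.Adj y x → x ∈ h :: (l ++ [z]) := by
    intro y hy x hx hyx
    rcases List.mem_cons.1 hy with rfl | hy
    · rcases l with _ | ⟨g, l'⟩
      · rw [eq_of_card_nb_eq_one hw1 hx hzX hyx hl]; simp
      · rw [eq_of_card_nb_eq_one hw1 hx (hlX g (by simp)) hyx hl.1]; simp
    · exact hclosed y hy x hx hyx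
  -- No edge leaves the path and `p`, `q`, so they are all of `K`.
  have hall : ∀ x ∈ K, x ∈ h :: (l ++ [z]) ∨ x = p ∨ x = q := by
    by_contra! hcon
    obtain ⟨a, ha, hal, hap, haq⟩ := hcon
    obtain ⟨x, hx, y, hy, hyY, hxy⟩ := hK
      (K.filter fun x => x ∈ h :: (l ++ [z]) ∨ x = p ∨ x = q) (Finset.filter_subset _ _)
      ⟨p, by simp [hp]⟩ (fun e => by
        have : a ∈ K.filter fun x => x ∈ h :: (l ++ [z]) ∨ x = p ∨ x = q := by rw [e]; exact ha
        exact (Finset.mem_filter.1 this).2.elim hal fun h => h.elim hap haq)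
    have hy' : ¬ (y ∈ h :: (l ++ [z]) ∨ y = p ∨ y = q) := fun h =>
      hyY (Finset.mem_filter.2 ⟨hy, h⟩)
    obtain ⟨hxK, hx⟩ := Finset.mem_filter.1 hx
    have hzwm : ∀ y, y = z ∨ y = h → y ∈ h :: (l ++ [z]) := by
      rintro y (rfl | rfl) <;> simp
    rcases hx with hx | rfl | rfl
    · exact hy' (Or.inl (hclosed' x hx y ((mem_X y).2 ⟨hy, by tauto, by tauto⟩) hxy))
    · exact hy' (Or.inl (hzwm y ((mem_p y).1 ⟨hy, hxy⟩)))
    · exact hy' (Or.inl (hzwm y ((mem_q y).1 ⟨hy, hxy⟩)))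
  refine hpath.choosableOn_add (p := p) (q := q) (fun x hx => hχ x (hXK (hmX x hx)))
    (hχp.mono fun x hx => hXK (hmX x hx)) ?_ hall (fun hx => ((mem_X p).1 (hmX p hx)).2.1 rfl)
    (fun hx => ((mem_X q).1 (hmX q hx)).2.2 rfl) (fun x hx hpx => (mem_p x).1 ⟨hx, hpx⟩)
    (fun x hx hqx => (mem_q x).1 ⟨hx, hqx⟩)
  have a₁ := hχp p hp z hz hpz
  have a₂ := hχp p hp h hw hpw
  have a₃ := hχ p hp
  have a₄ := hχ z hz
  have a₅ := hχ h hw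
  omega

/-- A connected bipartite graph is 2-choosable if its vertices of degree other than two form a theta
pair, or if there are none. -/
theorem Conn.choosableOn_of_thetaPair [DecidableEq V] {K : Finset V} (hK : G.Conn K) {χ : V → ℕ}
    (hχ : ∀ x ∈ K, χ x = 0 ∨ χ x = 1) (hχp : G.ProperOn K χ)
    (hd : ∀ z ∈ K, (G.nb K z).card ≠ 2 →
      ∃ w ∈ K, G.ThetaPair K z w ∧ ∀ t ∈ K, (G.nb K t).card ≠ 2 → t = z ∨ t = w) :
    G.ChoosableOn K := by
  have nb_sdiff : ∀ (P : Finset V) x, G.nb (K \ P) x = G.nb K x \ P := by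
    intro P x
    ext y
    simp only [mem_nb, Finset.mem_sdiff]
    tauto
  have deg : ∀ p q z n, p ∈ K → q ∈ K → G.Adj z p → G.Adj z q →
      (G.nb K z).card = n + ({p, q} : Finset V).card → (G.nb (K \ {p, q}) z).card = n := by
    intro p q z n hp hq hzp hzq hc
    rw [nb_sdiff, Finset.card_sdiff_of_subset, hc, Nat.add_sub_cancel]
    intro x hx
    simp only [Finset.mem_insert, Finset.mem_singleton] at hx
    rcases hx with rfl | rfl
    exacts [mem_nb.2 ⟨hp, hzp⟩, mem_nb.2 ⟨hq, hzq⟩]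
  by_cases h : ∃ z ∈ K, (G.nb K z).card ≠ 2
  · obtain ⟨z, hz, hz2⟩ := h
    obtain ⟨w, hw, ⟨hzw, hz3, hw3, p, hp, q, hq, hpq, hp2, hq2, hzp, hwp, hzq, hwq⟩, hother⟩ :=
      hd z hz hz2
    have hnb : ∀ p, (G.nb K p).card = 2 → G.Adj z p → G.Adj w p → G.nb K p = {z, w} := by
      intro p hp2 hzp hwp
      symm
      refine Finset.eq_of_subset_of_card_le (fun x hx => ?_) (by rw [hp2, Finset.card_pair hzw])
      simp only [Finset.mem_insert, Finset.mem_singleton] at hx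
      rcases hx with rfl | rfl
      exacts [mem_nb.2 ⟨hz, hzp.symm⟩, mem_nb.2 ⟨hw, hwp.symm⟩]
    refine hK.choosableOn_of_degrees hχ hχp hz hw hp hzw (hnb p hp2 hzp hwp) (hnb q hq2 hzq hwq)
      (deg p q z 1 hp hq hzp hzq ?_) (deg p q w 1 hp hq hwp hwq ?_) ?_
    · rw [hz3, Finset.card_pair hpq]
    · rw [hw3, Finset.card_pair hpq]
    · intro x hx _ _ hxz hxw
      by_contra hx2
      exact (hother x hx hx2).elim hxz hxw
  · push Not at h
    rcases K.eq_empty_or_nonempty with rfl | ⟨p, hp⟩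
    · exact fun L _ => ⟨fun _ => 0, by simp, fun x hx => by simp at hx⟩
    obtain ⟨z, w, hzw, hnp⟩ := Finset.card_eq_two.1 (h p hp)
    have hz : z ∈ G.nb K p := by rw [hnp]; simp
    have hw : w ∈ G.nb K p := by rw [hnp]; simp
    obtain ⟨hz, hpz⟩ := mem_nb.1 hz
    obtain ⟨hw, hpw⟩ := mem_nb.1 hw
    refine hK.choosableOn_of_degrees hχ hχp hz hw hp hzw hnp hnp
      (deg p p z 1 hp hp hpz.symm hpz.symm ?_) (deg p p w 1 hp hp hpw.symm hpw.symm ?_)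
      fun x hx _ _ _ _ => h x hx
    · rw [h z hz]; simp
    · rw [h w hw]; simp

end Sufficiency

/-! ### Degree sums -/

section Degrees

variable {V : Type*} {G : SimpleGraph V}

theorem sum_card_nb_comm (S T : Finset V) :
    ∑ x ∈ S, (G.nb T x).card = ∑ y ∈ T, (G.nb S y).card := by
  classical
  simp only [nb, Finset.card_filter]
  rw [Finset.sum_comm]
  simp only [G.adj_comm]

theorem choosableOn_of_comp {S : Finset V} (h : ∀ v ∈ S, G.ChoosableOn (G.comp S v)) :
    G.ChoosableOn S := by
  intro L hL
  have key : ∀ C : Finset V, ∃ f : V → ℕ, G.ChoosableOn C →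
      (∀ v ∈ C, f v ∈ L v) ∧ G.ProperOn C f := by
    intro C
    by_cases hC : G.ChoosableOn C
    · obtain ⟨f, hf⟩ := hC L hL
      exact ⟨f, fun _ => hf⟩
    · exact ⟨fun _ => 0, fun h => (hC h).elim⟩
  choose F hF using key
  refine ⟨fun v => F (G.comp S v) v, fun v hv => (hF _ (h v hv)).1 v (self_mem_comp hv), ?_⟩
  intro v hv w hw hvw
  have hw' : w ∈ G.comp S v := comp_closed (self_mem_comp hv) hw hvw
  simp only [comp_eq_of_mem hw']
  exact (hF _ (h v hv)).2 v (self_mem_comp hv) w hw' hvw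

variable [DecidableEq V]

theorem card_nb_union {S T : Finset V} (h : Disjoint S T) (x : V) :
    (G.nb (S ∪ T) x).card = (G.nb S x).card + (G.nb T x).card := by
  classical
  rw [nb, Finset.filter_union, Finset.card_union_of_disjoint (Finset.disjoint_filter_filter h)]
  rfl

theorem sum_card_nb_union {S T : Finset V} (h : Disjoint S T) :
    ∑ x ∈ S ∪ T, (G.nb (S ∪ T) x).card = (∑ x ∈ S, (G.nb S x).card) +
      (∑ x ∈ S, (G.nb T x).card) + ∑ x ∈ T, (G.nb (S ∪ T) x).card := by
  rw [Finset.sum_union h, ← Finset.sum_add_distrib]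
  simp only [card_nb_union h]

theorem Conn.erase {K : Finset V} (h : G.Conn K) {v : V} (hv : v ∈ K)
    (h1 : (G.nb K v).card ≤ 1) : G.Conn (K.erase v) := by
  intro Y hY ⟨a, ha⟩ hne
  have hYK : Y ⊆ K := hY.trans (Finset.erase_subset _ _)
  have hvY : v ∉ Y := fun h => by simpa using hY h
  obtain ⟨b, hb, hbY⟩ : ∃ b ∈ K.erase v, b ∉ Y := by
    by_contra! hcon
    exact hne (Finset.Subset.antisymm hY hcon)
  by_cases hu : ∃ u ∈ Y, G.Adj v u
  · obtain ⟨u, hu, hvu⟩ := hu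
    obtain ⟨x, hx, y, hy, hyY, hxy⟩ := h (insert v Y) (Finset.insert_subset hv hYK)
      ⟨v, by simp⟩ (fun e => by
        have : b ∈ insert v Y := by rw [e]; exact Finset.mem_of_mem_erase hb
        rcases Finset.mem_insert.1 this with rfl | h'
        exacts [by simp at hb, hbY h'])
    rw [Finset.mem_insert, not_or] at hyY
    rcases Finset.mem_insert.1 hx with rfl | hx
    · have : u = y := Finset.card_le_one.1 h1 u (mem_nb.2 ⟨hYK hu, hvu⟩) y (mem_nb.2 ⟨hy, hxy⟩)
      exact (hyY.2 (this ▸ hu)).elim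
    · exact ⟨x, hx, y, Finset.mem_erase.2 ⟨hyY.1, hy⟩, hyY.2, hxy⟩
  · obtain ⟨x, hx, y, hy, hyY, hxy⟩ := h Y hYK ⟨a, ha⟩ (fun e => hvY (e ▸ hv))
    refine ⟨x, hx, y, Finset.mem_erase.2 ⟨?_, hy⟩, hyY, hxy⟩
    rintro rfl
    exact hu ⟨x, hx, hxy.symm⟩

/-- A connected 2-choosable graph has at most one edge more than vertices. -/
theorem Conn.sum_card_nb_le {K : Finset V} (hK : G.Conn K) (hch : G.ChoosableOn K) :
    ∑ x ∈ K, (G.nb K x).card ≤ 2 * K.card + 2 := by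
  induction hn : K.card generalizing K with
  | zero => simp [Finset.card_eq_zero.1 hn]
  | succ n ih =>
    by_cases hlow : ∃ v ∈ K, (G.nb K v).card ≤ 1
    · obtain ⟨v, hv, h1⟩ := hlow
      have hc : (K.erase v).card = n := by rw [Finset.card_erase_of_mem hv, hn]; omega
      have := ih (hK.erase hv h1) (hch.mono (Finset.erase_subset _ _)) hc
      have hd : Disjoint (K.erase v) {v} := by simp
      have e : K.erase v ∪ {v} = K := by
        rw [Finset.union_comm, ← Finset.insert_eq, Finset.insert_erase hv]
      have hs := sum_card_nb_union (G := G) hd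
      rw [sum_card_nb_comm (K.erase v) {v}, Finset.sum_singleton, Finset.sum_singleton, e] at hs
      have := Finset.card_le_card (nb_mono (G := G) (Finset.erase_subset v K) v)
      omega
    · push Not at hlow
      have hcore : G.ChoosableCore K := ⟨hK, hch, fun v hv => hlow v hv⟩
      by_cases hz : ∃ z ∈ K, (G.nb K z).card ≠ 2
      · obtain ⟨z, hz, hz2⟩ := hz
        obtain ⟨w, hw, ⟨-, hz3, hw3, -⟩, hother⟩ := hcore.exists_thetaPair hz hz2
        have : ∀ x ∈ K, (G.nb K x).card ≤
            2 + ((if x = z then 1 else 0) + if x = w then 1 else 0) := by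
          intro x hx
          by_cases hx2 : (G.nb K x).card = 2
          · omega
          · rcases hother x hx hx2 with rfl | rfl
            · rw [if_pos rfl, hz3]; omega
            · rw [if_pos rfl, hw3]; omega
        refine (Finset.sum_le_sum this).trans ?_
        simp only [Finset.sum_add_distrib, Finset.sum_const, Finset.sum_ite_eq', hz, hw, if_true,
          smul_eq_mul, hn]
        omega
      · push Not at hz
        rw [Finset.sum_congr rfl hz, Finset.sum_const, smul_eq_mul, hn]
        omega

/-- Vertices of degree at most one do not affect 2-choosability: they can be coloured last. -/
theorem ChoosableOn.of_sdiff_low {T U : Finset V} (h : G.ChoosableOn T) (hTU : T ⊆ U)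
    (hlow : ∀ v ∈ U, v ∉ T → (G.nb U v).card ≤ 1) : G.ChoosableOn U := by
  have step : ∀ (T : Finset V) (v : V), G.ChoosableOn T → (G.nb T v).card ≤ 1 →
      G.ChoosableOn (insert v T) := by
    intro T v hT hv L hL
    by_cases hvT : v ∈ T
    · rw [Finset.insert_eq_of_mem hvT]
      exact hT L hL
    obtain ⟨f, hf, hp⟩ := hT L hL
    obtain ⟨c, hc, hcn⟩ : ∃ c ∈ L v, ∀ u ∈ G.nb T v, f u ≠ c := by
      rcases (G.nb T v).eq_empty_or_nonempty with he | ⟨u, hu⟩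
      · obtain ⟨c, hc, -⟩ := exists_ne_of_card_eq_two (hL v) 0
        exact ⟨c, hc, by simp [he]⟩
      · obtain ⟨c, hc, hcu⟩ := exists_ne_of_card_eq_two (hL v) (f u)
        refine ⟨c, hc, fun u' hu' => ?_⟩
        rw [Finset.card_le_one.1 hv u' hu' u hu]
        exact hcu.symm
    have hne : ∀ x ∈ T, x ≠ v := fun x hx e => hvT (e ▸ hx)
    refine ⟨Function.update f v c, fun x hx => ?_, fun x hx y hy hxy => ?_⟩
    · rcases Finset.mem_insert.1 hx with rfl | hx
      · simpa using hc
      · simpa [hne x hx] using hf x hx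
    · rcases Finset.mem_insert.1 hx with rfl | hx' <;> rcases Finset.mem_insert.1 hy with rfl | hy'
      · exact (hxy.ne rfl).elim
      · simpa [hne y hy'] using (hcn y (mem_nb.2 ⟨hy', hxy⟩)).symm
      · simpa [hne x hx'] using hcn x (mem_nb.2 ⟨hx', hxy.symm⟩)
      · simpa [hne x hx', hne y hy'] using hp x hx' y hy' hxy
  have main : ∀ W : Finset V, W ⊆ U \ T → G.ChoosableOn (W ∪ T) := by
    intro W
    induction W using Finset.induction_on with
    | empty => intro _; simpa using h
    | insert v W hv ih =>
      intro hW
      have hvU := Finset.mem_sdiff.1 (hW (Finset.mem_insert_self v W))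
      have hW' : W ⊆ U \ T := (Finset.subset_insert v W).trans hW
      rw [Finset.insert_union]
      refine step _ v (ih hW') ((Finset.card_le_card (nb_mono ?_ v)).trans (hlow v hvU.1 hvU.2))
      exact Finset.union_subset (hW'.trans Finset.sdiff_subset) hTU
  have := main (U \ T) subset_rfl
  rwa [Finset.sdiff_union_of_subset hTU] at this

/-! ### The excess of a graph and the greedy choice -/

/-- The sum of `degree - 2` over the vertices of `H`. -/
noncomputable def excess (G : SimpleGraph V) (H : Finset V) : ℕ :=
  ∑ x ∈ H, ((G.nb H x).card - 2)

theorem excess_add_le {H H' : Finset V} {v : V} (hv : v ∈ H) (h : H' ⊆ H.erase v) :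
    G.excess H' + ((G.nb H v).card - 2) ≤ G.excess H := by
  have hH : H' ⊆ H := h.trans (Finset.erase_subset _ _)
  rw [excess, excess, ← Finset.sum_erase_add _ _ hv]
  refine Nat.add_le_add_right ?_ _
  refine (Finset.sum_le_sum fun x _ => ?_).trans (Finset.sum_le_sum_of_subset h)
  exact Nat.sub_le_sub_right (Finset.card_le_card (nb_mono hH x)) 2

/-- Minimum degree at least two, and no component is 2-choosable. -/
structure AllBad (G : SimpleGraph V) (H : Finset V) : Prop where
  two_le : ∀ v ∈ H, 2 ≤ (G.nb H v).card
  bad : ∀ v ∈ H, ¬ G.ChoosableOn (G.comp H v)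

/-- The excess is at most linear in the degrees of a deletion set `B`: the degree sum of
a component of what remains exceeds twice its order by at most two, and some edge joins it to
`B`. -/
theorem AllBad.excess_le {H B : Finset V} (h : G.AllBad H) (hB : G.ChoosableOn (H \ B)) {d : ℕ}
    (hd : ∀ v ∈ H, (G.nb H v).card ≤ d) :
    G.excess H + 2 * (B ∩ H).card ≤ 4 * d * (B ∩ H).card := by
  set K := H \ B with hK
  set B' := B ∩ H with hB'
  have hdisj : Disjoint K B' := Finset.disjoint_left.2 fun x hx hx' =>
    (Finset.mem_sdiff.1 hx).2 (Finset.mem_inter.1 hx').1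
  have hunion : K ∪ B' = H := by
    ext x
    simp only [hK, hB', Finset.mem_union, Finset.mem_sdiff, Finset.mem_inter]
    tauto
  have hKH : K ⊆ H := Finset.sdiff_subset
  have hB'H : B' ⊆ H := Finset.inter_subset_right
  have fiber : ∀ v ∈ K, K.filter (fun x => G.comp K x = G.comp K v) = G.comp K v := by
    intro v hv
    ext x
    rw [Finset.mem_filter]
    exact ⟨fun hx => hx.2 ▸ self_mem_comp hx.1, fun hx => ⟨comp_subset hx, comp_eq_of_mem hx⟩⟩
  -- A component of `K` has at most one edge more than it has vertices. Some edge joins it to `B'`,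
  -- as it would otherwise be a 2-choosable component of `H`.
  have hcomp : ∀ v ∈ K, ∑ x ∈ G.comp K v, (G.nb K x).card ≤
      ∑ x ∈ G.comp K v, (2 + 2 * (G.nb B' x).card) := by
    intro v hv
    have h1 := (conn_comp : G.Conn (G.comp K v)).sum_card_nb_le (hB.mono comp_subset)
    rw [Finset.sum_congr rfl fun x hx => by rw [nb_comp hx]] at h1
    rw [Finset.sum_add_distrib, Finset.sum_const, smul_eq_mul, ← Finset.mul_sum]
    have h2 : 0 < ∑ x ∈ G.comp K v, (G.nb B' x).card := by
      by_contra hzero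
      have hzero' : ∀ x ∈ G.comp K v, (G.nb B' x).card = 0 :=
        Finset.sum_eq_zero_iff.1 (by omega)
      have hch : G.ChoosableOn (G.comp K v) := hB.mono comp_subset
      refine h.bad v (hKH hv) (hch.mono
        (comp_subset_of_closed (self_mem_comp hv) fun x hx y hy hxy => ?_))
      by_cases hyB : y ∈ B'
      · have : y ∈ G.nb B' x := mem_nb.2 ⟨hyB, hxy⟩
        rw [Finset.card_eq_zero.1 (hzero' x hx)] at this
        simp at this
      · refine comp_closed hx ?_ hxy
        rw [← hunion] at hy
        exact (Finset.mem_union.1 hy).resolve_right hyB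
    omega
  have hsum : ∑ x ∈ K, (G.nb K x).card ≤ ∑ x ∈ K, (2 + 2 * (G.nb B' x).card) := by
    have hmaps : ∀ x ∈ K, G.comp K x ∈ K.image (G.comp K) := fun x hx =>
      Finset.mem_image_of_mem _ hx
    rw [← Finset.sum_fiberwise_of_maps_to hmaps, ← Finset.sum_fiberwise_of_maps_to hmaps]
    refine Finset.sum_le_sum fun c hc => ?_
    obtain ⟨v, hv, rfl⟩ := Finset.mem_image.1 hc
    rw [fiber v hv]
    exact hcomp v hv
  rw [Finset.sum_add_distrib, Finset.sum_const, smul_eq_mul, ← Finset.mul_sum] at hsum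
  have htotal := sum_card_nb_union (G := G) hdisj
  rw [hunion] at htotal
  have he : ∑ x ∈ K, (G.nb B' x).card ≤ ∑ x ∈ B', (G.nb H x).card := by
    rw [sum_card_nb_comm]
    exact Finset.sum_le_sum fun x _ => Finset.card_le_card (nb_mono hKH x)
  have hdB : ∑ x ∈ B', (G.nb H x).card ≤ B'.card * d := by
    rw [← smul_eq_mul]
    exact Finset.sum_le_card_nsmul _ _ _ fun x hx => hd x (hB'H hx)
  have hex : G.excess H + 2 * H.card = ∑ x ∈ H, (G.nb H x).card := by
    rw [excess, mul_comm, ← smul_eq_mul, ← Finset.sum_const, ← Finset.sum_add_distrib]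
    exact Finset.sum_congr rfl fun x hx => Nat.sub_add_cancel (h.two_le x hx)
  have hcard : H.card = K.card + B'.card := by
    rw [← hunion, Finset.card_union_of_disjoint hdisj]
  have : 4 * d * B'.card = 4 * (B'.card * d) := by ring
  omega

theorem AllBad.exists_mem_comp {H B : Finset V} (h : G.AllBad H) (hB : G.ChoosableOn (H \ B))
    {v : V} (hv : v ∈ H) : ∃ b ∈ B, b ∈ G.comp H v := by
  by_contra! hcon
  exact h.bad v hv (hB.mono fun x hx =>
    Finset.mem_sdiff.2 ⟨comp_subset hx, fun hxB => hcon x hxB hx⟩)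

/-- If all degrees are two, then deleting `v` and pruning removes the whole component of `v`, which
contains a vertex of every deletion set. -/
theorem AllBad.card_inter_lt {H H' B : Finset V} (h : G.AllBad H) (hB : G.ChoosableOn (H \ B))
    {v : V} (hv : v ∈ H) (hd : ∀ x ∈ H, (G.nb H x).card ≤ 2) (hH' : H' ⊆ H.erase v)
    (h2 : ∀ x ∈ H', 2 ≤ (G.nb H' x).card) : (B ∩ H').card < (B ∩ H).card := by
  have hsub : H' ⊆ H := hH'.trans (Finset.erase_subset _ _)
  obtain ⟨b, hbB, hb⟩ := h.exists_mem_comp hB hv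
  refine Finset.card_lt_card ((Finset.ssubset_iff_of_subset
    (Finset.inter_subset_inter_left hsub)).2 ⟨b, ?_, fun hb' => ?_⟩)
  · exact Finset.mem_inter.2 ⟨hbB, comp_subset hb⟩
  · have hbH' := (Finset.mem_inter.1 hb').2
    have hv' : v ∈ G.comp H b := by
      rw [comp_eq_of_mem hb]
      exact self_mem_comp hv
    have hcl : G.comp H b ⊆ H' := by
      refine comp_subset_of_closed hbH' fun x hx y hy hxy => ?_
      have : G.nb H' x = G.nb H x := Finset.eq_of_subset_of_card_le (nb_mono hsub x)
        ((hd x (hsub hx)).trans (h2 x hx))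
      have hy' : y ∈ G.nb H' x := by
        rw [this]
        exact mem_nb.2 ⟨hy, hxy⟩
      exact (mem_nb.1 hy').1
    simpa using hH' (hcl hv')

/-- The potential that bounds the number of vertices the greedy algorithm still deletes, in terms of
a deletion set `B`. The first summand pays for the rounds in which the excess drops by a fraction of
at least `1 / (10 * B.card)`, the second for those in which all degrees are two. -/
noncomputable def potential (G : SimpleGraph V) (B H : Finset V) : ℝ :=
  (if G.excess H = 0 then 0 else 10 * B.card * (1 + Real.log (G.excess H))) + (B ∩ H).card

theorem potential_nonneg (B H : Finset V) : 0 ≤ G.potential B H := by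
  unfold potential
  split_ifs with h
  · positivity
  · have : 0 ≤ Real.log (G.excess H) := Real.log_natCast_nonneg _
    positivity

/-- Deleting a vertex of maximum degree decreases the potential by at least one: a vertex of degree
at least three carries at least the fraction `1 / (10 * B.card)` of the excess. -/
theorem AllBad.potential_add_one_le {H H' B : Finset V} (h : G.AllBad H)
    (hB : G.ChoosableOn (H \ B)) {v : V} (hv : v ∈ H)
    (hmax : ∀ x ∈ H, (G.nb H x).card ≤ (G.nb H v).card) (hH' : H' ⊆ H.erase v)
    (h2 : ∀ x ∈ H', 2 ≤ (G.nb H' x).card) : G.potential B H' + 1 ≤ G.potential B H := by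
  have hsub : H' ⊆ H := hH'.trans (Finset.erase_subset _ _)
  have hex := excess_add_le (G := G) hv hH'
  have hcard : (B ∩ H').card ≤ (B ∩ H).card :=
    Finset.card_le_card (Finset.inter_subset_inter_left hsub)
  by_cases hd : (G.nb H v).card ≤ 2
  · have hzero : ∀ x ∈ H, (G.nb H x).card - 2 = 0 := fun x hx => by
      have := hmax x hx
      omega
    have e0 : G.excess H = 0 := Finset.sum_eq_zero hzero
    have e0' : G.excess H' = 0 := by omega
    have := h.card_inter_lt hB hv (fun x hx => (hmax x hx).trans hd) hH' h2
    simp only [potential, e0, e0', if_true, zero_add]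
    exact_mod_cast this
  · push Not at hd
    have hle := h.excess_le hB hmax
    set k := B.card with hk
    set d := (G.nb H v).card with hdd
    have hBk : (B ∩ H).card ≤ k := Finset.card_le_card Finset.inter_subset_left
    have hle' : G.excess H ≤ 10 * k * (d - 2) := by
      obtain ⟨e, he⟩ : ∃ e, d = e + 3 := ⟨d - 3, by omega⟩
      rw [he] at hle
      rw [show d - 2 = e + 1 by omega]
      have h1 : 4 * (e + 3) * (B ∩ H).card = 4 * e * (B ∩ H).card + 12 * (B ∩ H).card := by ring
      have h2 : e * (B ∩ H).card ≤ e * k := Nat.mul_le_mul_left e hBk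
      have h3 : 10 * k * (e + 1) = 10 * (e * k) + 10 * k := by ring
      have h4 : 4 * e * (B ∩ H).card = 4 * (e * (B ∩ H).card) := by ring
      omega
    have hpos : 0 < G.excess H := by omega
    have hkpos : 0 < k := by
      rcases Nat.eq_zero_or_pos k with h0 | h0
      · rw [h0] at hle'; omega
      · exact h0
    have hk1 : (1 : ℝ) ≤ k := by exact_mod_cast hkpos
    have hlog : 0 ≤ Real.log (G.excess H) := Real.log_natCast_nonneg _
    have hcard' : ((B ∩ H').card : ℝ) ≤ (B ∩ H).card := by exact_mod_cast hcard
    unfold potential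
    rw [if_neg hpos.ne']
    split_ifs with h0
    · have : (1 : ℝ) ≤ 10 * k * (1 + Real.log (G.excess H)) := by nlinarith
      rw [← hk]
      linarith
    · have hΨ : (0 : ℝ) < G.excess H := by exact_mod_cast hpos
      have hΨ' : (0 : ℝ) < G.excess H' := by exact_mod_cast Nat.pos_of_ne_zero h0
      have e1 : (G.excess H' : ℝ) + (d - 2 : ℕ) ≤ G.excess H := by exact_mod_cast hex
      have e2 : (G.excess H : ℝ) ≤ 10 * k * (d - 2 : ℕ) := by exact_mod_cast hle'
      -- By `log x ≤ x - 1`, the logarithm decreases at least by the fraction lost.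
      have e3 : Real.log (G.excess H') - Real.log (G.excess H) ≤
          G.excess H' / G.excess H - 1 := by
        rw [← Real.log_div hΨ'.ne' hΨ.ne']
        exact Real.log_le_sub_one_of_pos (div_pos hΨ' hΨ)
      have e4 : 10 * (k : ℝ) * (G.excess H' / G.excess H - 1) ≤ -1 := by
        rw [div_sub_one hΨ.ne', mul_div_assoc', div_le_iff₀ hΨ]
        nlinarith
      have e5 : 10 * (k : ℝ) * (Real.log (G.excess H') - Real.log (G.excess H)) ≤ -1 :=
        (mul_le_mul_of_nonneg_left e3 (by positivity)).trans e4
      rw [← hk]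
      linarith

/-- The constant `36` exceeds `20 + 11 / log 2`, so that `10 * (1 + 2 * log n) + 1 ≤ 36 * log n`. -/
theorem potential_le {H B : Finset V} {n : ℕ} (hn : 2 ≤ n) (hH : H.card ≤ n) :
    G.potential B H ≤ 36 * Real.log n * B.card := by
  have hBH : ((B ∩ H).card : ℝ) ≤ B.card := by
    exact_mod_cast Finset.card_le_card (Finset.inter_subset_left (s₁ := B) (s₂ := H))
  have hn0 : (2 : ℝ) ≤ n := by exact_mod_cast hn
  have hlog2 : 0.69 ≤ Real.log n :=
    (by linarith [Real.log_two_gt_d9] : (0.69 : ℝ) ≤ Real.log 2).trans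
      (Real.log_le_log (by norm_num) hn0)
  have hB0 : (0 : ℝ) ≤ B.card := by positivity
  have hex : G.excess H ≤ n * n := by
    refine (Finset.sum_le_card_nsmul _ _ n fun x _ => ?_).trans (Nat.mul_le_mul_right n hH)
    exact (Nat.sub_le _ _).trans ((Finset.card_le_card fun y hy => (mem_nb.1 hy).1).trans hH)
  unfold potential
  split_ifs with h0
  · nlinarith
  · have h1 : Real.log (G.excess H) ≤ 2 * Real.log n := by
      calc Real.log (G.excess H) ≤ Real.log (n * n : ℝ) :=
            Real.log_le_log (by exact_mod_cast Nat.pos_of_ne_zero h0) (by exact_mod_cast hex)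
        _ = 2 * Real.log n := by
            rw [Real.log_mul (by linarith) (by linarith)]; ring
    nlinarith [mul_le_mul_of_nonneg_left h1 hB0, mul_le_mul_of_nonneg_left hlog2 hB0]

end Degrees

/-! ### The greedy algorithm -/

section Greedy

variable {V : Type*} {G : SimpleGraph V}

open Classical in
/-- The vertices of `P` in components of `P` that are not 2-choosable. -/
noncomputable def badPart (G : SimpleGraph V) (P : Finset V) : Finset V :=
  P.filter fun v => ¬ G.ChoosableOn (G.comp P v)

theorem mem_badPart {P : Finset V} {v : V} :
    v ∈ G.badPart P ↔ v ∈ P ∧ ¬ G.ChoosableOn (G.comp P v) := by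
  simp [badPart]

theorem badPart_subset {P : Finset V} : G.badPart P ⊆ P := fun _ h => (mem_badPart.1 h).1

theorem badPart_closed {P : Finset V} {x y : V} (hx : x ∈ G.badPart P) (hy : y ∈ P)
    (hxy : G.Adj x y) : y ∈ G.badPart P := by
  have := mem_badPart.1 hx
  refine mem_badPart.2 ⟨hy, ?_⟩
  rw [comp_eq_of_mem (comp_closed (self_mem_comp this.1) hy hxy)]
  exact this.2

theorem nb_badPart {P : Finset V} {x : V} (hx : x ∈ G.badPart P) :
    G.nb (G.badPart P) x = G.nb P x := by
  ext w
  simp only [mem_nb]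
  exact ⟨fun h => ⟨badPart_subset h.1, h.2⟩, fun h => ⟨badPart_closed hx h.1 h.2, h.2⟩⟩

theorem allBad_badPart {P : Finset V} (h : ∀ v ∈ P, 2 ≤ (G.nb P v).card) :
    G.AllBad (G.badPart P) where
  two_le v hv := by
    rw [nb_badPart hv]
    exact h v (badPart_subset hv)
  bad v hv hch := by
    refine (mem_badPart.1 hv).2 (hch.mono ?_)
    refine comp_subset_of_closed (self_mem_comp hv) fun x hx y hy hxy => ?_
    exact comp_closed hx (badPart_closed (comp_subset hx) hy hxy) hxy

variable [DecidableEq V]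

/-- What pruning achieves: `P` is a part of `S` of minimum degree at least two, and the
2-choosability of a part of `S` can be tested on the vertices it has in `P`. -/
structure PrunesTo (G : SimpleGraph V) (S P : Finset V) : Prop where
  subset : P ⊆ S
  two_le : ∀ v ∈ P, 2 ≤ (G.nb P v).card
  lift : ∀ W, G.ChoosableOn (P ∩ W) → G.ChoosableOn (S ∩ W)

/-- One round of the greedy algorithm: the set `S` of remaining vertices is pruned to `P`, and a
vertex of maximum degree in the bad components, if there are any, is moved to the solution `A`. -/
def GreedyStep (G : SimpleGraph V) (S A P S' A' : Finset V) : Prop :=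
  G.PrunesTo S P ∧ ((G.badPart P = ∅ ∧ S' = P ∧ A' = A) ∨
    ∃ v ∈ G.badPart P, (∀ w ∈ G.badPart P, (G.nb P w).card ≤ (G.nb P v).card) ∧
      S' = P.erase v ∧ A' = insert v A)

theorem GreedyStep.badPart_subset_erase {S A P S' A' P' : Finset V}
    (h : G.GreedyStep S A P S' A') (hP' : P' ⊆ S') :
    (G.badPart P = ∅ ∧ A' = A ∧ G.badPart P' = ∅) ∨
    ∃ v ∈ G.badPart P, (∀ w ∈ G.badPart P, (G.nb P w).card ≤ (G.nb P v).card) ∧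
      A' = insert v A ∧ G.badPart P' ⊆ (G.badPart P).erase v := by
  have sub : P' ⊆ P → G.badPart P' ⊆ G.badPart P := fun hPP x hx => by
    rw [mem_badPart] at hx ⊢
    exact ⟨hPP hx.1, fun hch => hx.2 (hch.mono (comp_mono hPP x))⟩
  rcases h.2 with ⟨h0, rfl, rfl⟩ | ⟨v, hv, hmax, rfl, rfl⟩
  · exact Or.inl ⟨h0, rfl, Finset.subset_empty.1 (h0 ▸ sub hP')⟩
  · refine Or.inr ⟨v, hv, hmax, rfl, fun x hx => Finset.mem_erase.2 ⟨?_, sub ?_ hx⟩⟩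
    · exact Finset.ne_of_mem_erase (hP' (badPart_subset hx))
    · exact hP'.trans (Finset.erase_subset _ _)

/-- After as many rounds as there are vertices, the greedy algorithm has found a deletion set, whose
size is bounded by the initial potential. -/
theorem greedy_correct [Fintype V] {S A P : ℕ → Finset V} (hS : S 0 = Finset.univ) (hA : A 0 = ∅)
    (h : ∀ i, G.GreedyStep (S i) (A i) (P i) (S (i + 1)) (A (i + 1))) :
    G.ChoosableOn (Finset.univ \ A (Fintype.card V)) ∧
      ∀ B, G.ChoosableOn (Finset.univ \ B) →
        ((A (Fintype.card V)).card : ℝ) ≤ G.potential B (G.badPart (P 0)) := by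
  have hcard : ∀ i, (G.badPart (P i)).card ≤ Fintype.card V - i := by
    intro i
    induction i with
    | zero => exact Finset.card_le_univ _
    | succ i ih =>
      rcases (h i).badPart_subset_erase (h (i + 1)).1.subset with ⟨-, -, h0⟩ | ⟨v, hv, -, -, hsub⟩
      · simp [h0]
      · have := Finset.card_le_card hsub
        rw [Finset.card_erase_of_mem hv] at this
        omega
  have hlift : ∀ i, ∀ W, Disjoint W (A i) → G.ChoosableOn (S i ∩ W) → G.ChoosableOn W := by
    intro i
    induction i with
    | zero => intro W _ hW; simpa [hS] using hW
    | succ i ih =>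
      intro W hWA hW
      rcases (h i).2 with ⟨-, e₁, e₂⟩ | ⟨v, -, -, e₁, e₂⟩
      · rw [e₂] at hWA
        rw [e₁] at hW
        exact ih W hWA ((h i).1.lift W hW)
      · rw [e₂, Finset.disjoint_insert_right] at hWA
        rw [e₁] at hW
        refine ih W hWA.2 ((h i).1.lift W (hW.mono fun x hx => ?_))
        obtain ⟨hxP, hxW⟩ := Finset.mem_inter.1 hx
        exact Finset.mem_inter.2 ⟨Finset.mem_erase.2 ⟨fun e => hWA.1 (e ▸ hxW), hxP⟩, hxW⟩
  constructor
  · refine hlift _ _ Finset.sdiff_disjoint ((h _).1.lift _ ?_)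
    have h0 : G.badPart (P (Fintype.card V)) = ∅ := by
      have := hcard (Fintype.card V)
      rw [Nat.sub_self] at this
      exact Finset.card_eq_zero.1 (Nat.le_zero.1 this)
    refine (choosableOn_of_comp fun v hv => ?_).mono Finset.inter_subset_left
    by_contra hbad
    have : v ∈ G.badPart (P (Fintype.card V)) := mem_badPart.2 ⟨hv, hbad⟩
    simp [h0] at this
  · intro B hB
    have hpot : ∀ i, ((A i).card : ℝ) + G.potential B (G.badPart (P i)) ≤
        G.potential B (G.badPart (P 0)) := by
      intro i
      induction i with
      | zero => simp [hA]
      | succ i ih =>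
        rcases (h i).badPart_subset_erase (h (i + 1)).1.subset with
          ⟨h0, e, h0'⟩ | ⟨v, hv, hmax, e, hsub⟩
        · rw [h0', e]
          rwa [h0] at ih
        · have hbad := allBad_badPart (h i).1.two_le
          have := hbad.potential_add_one_le (B := B)
            (hB.mono (Finset.sdiff_subset_sdiff (Finset.subset_univ _) subset_rfl)) hv
            (fun x hx => by rw [nb_badPart hx, nb_badPart hv]; exact hmax x hx) hsub
            (allBad_badPart (h (i + 1)).1.two_le).two_le
          have hle : ((A (i + 1)).card : ℝ) ≤ (A i).card + 1 := by
            rw [e]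
            exact_mod_cast Finset.card_insert_le _ _
          linarith
    have := hpot (Fintype.card V)
    have := potential_nonneg (G := G) B (G.badPart (P (Fintype.card V)))
    linarith

end Greedy
end SimpleGraph

namespace RAM

/-! ### Total correctness of machine programs -/

@[simp] theorem Store.setVar_var (s : Store) (x c r : ℕ) :
    (s.setVar x c).var r = if r = x then c else s.var r := by
  simp [Store.setVar, Function.update_apply]

@[simp] theorem Store.setVar_arr (s : Store) (x c : ℕ) : (s.setVar x c).arr = s.arr := rfl

@[simp] theorem Store.setArr_var (s : Store) (a i c : ℕ) : (s.setArr a i c).var = s.var := rfl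

@[simp] theorem Store.setArr_arr (s : Store) (a i c b j : ℕ) :
    (s.setArr a i c).arr b j = if b = a ∧ j = i then c else s.arr b j := by
  by_cases hb : b = a
  · subst hb; simp [Store.setArr, Function.update_apply]
  · simp [Store.setArr, hb]

/-- Started in `s`, the program `p` halts within `T` steps in a store that satisfies `Q`. -/
def Runs (p : Prog) (s : Store) (T : ℕ) (Q : Store → Prop) : Prop :=
  ∃ t s', Exec p s t s' ∧ t ≤ T ∧ Q s'

section Rules

variable {p q : Prog} {s : Store} {T U : ℕ} {Q Q' : Store → Prop}

theorem Runs.mono (h : Runs p s T Q) (hT : T ≤ U) (hQ : ∀ s, Q s → Q' s) : Runs p s U Q' := by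
  obtain ⟨t, s', he, ht, hs⟩ := h
  exact ⟨t, s', he, ht.trans hT, hQ s' hs⟩

theorem Runs.const {x c : ℕ} (h : Q (s.setVar x c)) : Runs (.const x c) s 1 Q :=
  ⟨1, _, .const x c s, le_rfl, h⟩

theorem Runs.add {x y z : ℕ} (h : Q (s.setVar x (s.var y + s.var z))) : Runs (.add x y z) s 1 Q :=
  ⟨1, _, .add x y z s, le_rfl, h⟩

theorem Runs.sub {x y z : ℕ} (h : Q (s.setVar x (s.var y - s.var z))) : Runs (.sub x y z) s 1 Q :=
  ⟨1, _, .sub x y z s, le_rfl, h⟩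

theorem Runs.load {x a y : ℕ} (h : Q (s.setVar x (s.arr a (s.var y)))) :
    Runs (.load x a y) s 1 Q :=
  ⟨1, _, .load x a y s, le_rfl, h⟩

theorem Runs.store {a y x : ℕ} (h : Q (s.setArr a (s.var y) (s.var x))) :
    Runs (.store a y x) s 1 Q :=
  ⟨1, _, .store a y x s, le_rfl, h⟩

theorem Runs.seq (h : Runs p s T fun s' => Runs q s' U Q) : Runs (.seq p q) s (T + U) Q := by
  obtain ⟨t, s', he, ht, u, s'', he', hu, hs⟩ := h
  exact ⟨t + u, s'', .seq he he', Nat.add_le_add ht hu, hs⟩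

theorem Runs.cond {x : ℕ} (h₁ : s.var x ≠ 0 → Runs p s T Q) (h₂ : s.var x = 0 → Runs q s T Q) :
    Runs (.cond x p q) s (T + 1) Q := by
  by_cases hx : s.var x = 0
  · obtain ⟨t, s', he, ht, hs⟩ := h₂ hx
    exact ⟨t + 1, s', .cond_false hx he, Nat.add_le_add_right ht 1, hs⟩
  · obtain ⟨t, s', he, ht, hs⟩ := h₁ hx
    exact ⟨t + 1, s', .cond_true hx he, Nat.add_le_add_right ht 1, hs⟩

/-- A loop whose variable counts down from `m` to `0`, with an invariant `I`. -/
theorem Runs.loop {x m : ℕ} (I : ℕ → Store → Prop) (hx : ∀ i s, I i s → s.var x = i)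
    (hb : ∀ i s, i < m → I (i + 1) s → Runs p s T (I i)) (h : I m s) :
    Runs (.loop x p) s (m * (T + 1) + 1) (I 0) := by
  induction m generalizing s with
  | zero => exact ⟨1, s, .loop_done (hx 0 s h), by omega, h⟩
  | succ m ih =>
    obtain ⟨t, s', he, ht, hs⟩ := hb m s (by omega) h
    obtain ⟨u, s'', he', hu, hs'⟩ := ih (fun i s hi => hb i s (by omega)) hs
    refine ⟨t + u + 1, s'', .loop_step (by rw [hx _ _ h]; omega) he he', ?_, hs'⟩
    rw [Nat.add_mul]
    omega

end Rules

/-! ### Terms and their evaluation by the machine -/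

/-- Numerical terms over variables that range over the vertices `0, …, n - 1` and over arrays that
are read as `n × n` matrices. -/
inductive Term : Type
  | num (c : ℕ) : Term
  | var (x : ℕ) : Term
  /-- The entry of the matrix `a` in the row of the variable `x` and the column of `y`. -/
  | get (a x y : ℕ) : Term
  | sub (t u : Term) : Term
  /-- The value of `u` if `t ≠ 0`, and that of `v` otherwise. -/
  | ite (t u v : Term) : Term
  /-- The sum of the values of `t` for `x = 0, …, n - 1`. -/
  | sum (x : ℕ) (t : Term) : Term

/-- The value of a term, for matrices `σ` and values `ρ` of the variables. -/
def Term.eval (n : ℕ) (σ : ℕ → ℕ → ℕ → ℕ) (ρ : ℕ → ℕ) : Term → ℕ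
  | num c => c
  | var x => ρ x
  | get a x y => σ a (ρ x) (ρ y)
  | sub t u => t.eval n σ ρ - u.eval n σ ρ
  | ite t u v => if t.eval n σ ρ = 0 then v.eval n σ ρ else u.eval n σ ρ
  | sum x t => ∑ i ∈ Finset.range n, t.eval n σ (Function.update ρ x i)

/-- The term does not read the matrix `a`. -/
def Term.Avoids (a : ℕ) : Term → Prop
  | num _ => True
  | var _ => True
  | get b _ _ => b ≠ a
  | sub t u => t.Avoids a ∧ u.Avoids a
  | ite t u v => t.Avoids a ∧ u.Avoids a ∧ v.Avoids a
  | sum _ t => t.Avoids a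

theorem Term.Avoids.eval_congr {n a : ℕ} {σ σ' : ℕ → ℕ → ℕ → ℕ} {t : Term} (h : t.Avoids a)
    (hσ : ∀ b, b ≠ a → σ b = σ' b) (ρ : ℕ → ℕ) : t.eval n σ ρ = t.eval n σ' ρ := by
  induction t generalizing ρ with
  | num | var => rfl
  | get b x y => simp only [eval, hσ b h]
  | sub t u iht ihu => simp only [eval, iht h.1, ihu h.2]
  | ite t u v iht ihu ihv => simp only [eval, iht h.1, ihu h.2.1, ihv h.2.2]
  | sum x t iht => simp only [eval, iht h]

/-- The machine variable for the variable `x` of terms. Machine variable `0` holds `n`. -/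
def vr (x : ℕ) : ℕ := 2 * x + 2

/-- The `k`-th machine variable for intermediate results. -/
def tr (k : ℕ) : ℕ := 2 * k + 1

@[simp] theorem vr_inj {x y : ℕ} : vr x = vr y ↔ x = y := by simp [vr]
@[simp] theorem tr_inj {x y : ℕ} : tr x = tr y ↔ x = y := by simp [tr]
@[simp] theorem vr_ne_tr {x k : ℕ} : vr x ≠ tr k := by unfold vr tr; omega
@[simp] theorem tr_ne_vr {x k : ℕ} : tr k ≠ vr x := by unfold vr tr; omega
@[simp] theorem zero_ne_vr {x : ℕ} : 0 ≠ vr x := by unfold vr; omega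
@[simp] theorem zero_ne_tr {x : ℕ} : 0 ≠ tr x := by unfold tr; omega
@[simp] theorem vr_ne_zero {x : ℕ} : vr x ≠ 0 := by unfold vr; omega

/-- The position `x * n + y` of a matrix entry, computed by repeated addition. -/
def indexProg (x y k : ℕ) : Prog :=
  .seq (.const (tr k) 0) <|
  .seq (.const (tr (k + 2)) 1) <|
  .seq (.add (tr (k + 1)) (vr x) (tr k)) <|
  .seq (.loop (tr (k + 1)) <|
    .seq (.add (tr k) (tr k) 0) (.sub (tr (k + 1)) (tr (k + 1)) (tr (k + 2)))) <|
  .add (tr k) (tr k) (vr y)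

/-- The program that computes a term into the machine variable `tr k`, using only `tr j` for `j ≥ k`
for intermediate results. -/
def Term.compile : Term → ℕ → Prog
  | num c, k => .const (tr k) c
  | var x, k => .seq (.const (tr k) 0) (.add (tr k) (vr x) (tr k))
  | get a x y, k => .seq (indexProg x y k) (.load (tr k) a (tr k))
  | sub t u, k => .seq (t.compile k) (.seq (u.compile (k + 1)) (.sub (tr k) (tr k) (tr (k + 1))))
  | ite t u v, k => .seq (t.compile k) (.cond (tr k) (u.compile k) (v.compile k))
  | sum x t, k =>
    .seq (.const (tr k) 0) <|
    .seq (.const (tr (k + 2)) 1) <|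
    .seq (.add (tr (k + 1)) (vr x) (tr k)) <|
    .seq (.add (vr x) 0 (tr k)) <|
    .seq (.loop (vr x) <|
      .seq (.sub (vr x) (vr x) (tr (k + 2))) <|
      .seq (t.compile (k + 3)) (.add (tr k) (tr k) (tr (k + 3)))) <|
    .add (vr x) (tr (k + 1)) (vr x)

open Polynomial in
/-- A bound on the number of steps that the computation of a term takes. -/
noncomputable def Term.cost : Term → ℕ[X]
  | num _ => 1
  | var _ => 2
  | get _ _ _ => 3 * X + 6
  | sub t u => t.cost + u.cost + 1
  | ite t u v => t.cost + (u.cost + v.cost + 1)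
  | sum _ t => X * (t.cost + 3) + 6

/-- The store holds `n`, the values `ρ` of the variables and the matrices `σ`. -/
structure Models (n : ℕ) (σ : ℕ → ℕ → ℕ → ℕ) (ρ : ℕ → ℕ) (s : Store) : Prop where
  size : s.var 0 = n
  vars : ∀ x, s.var (vr x) = ρ x
  arrs : ∀ a i j, i < n → j < n → s.arr a (i * n + j) = σ a i j

/-- Between `s` and `s'` only the machine variables `tr j` with `j ≥ k` have changed. -/
structure Keeps (k : ℕ) (s s' : Store) : Prop where
  arr : s'.arr = s.arr
  var : ∀ r, (∀ j, k ≤ j → r ≠ tr j) → s'.var r = s.var r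

theorem Keeps.trans {k l : ℕ} {s s' s'' : Store} (h : Keeps k s s') (h' : Keeps l s' s'')
    (hkl : k ≤ l) : Keeps k s s'' where
  arr := h'.arr.trans h.arr
  var r hr := (h'.var r fun j hj => hr j (hkl.trans hj)).trans (h.var r hr)

theorem Keeps.setVar {k l : ℕ} {s s' : Store} (h : Keeps k s s') (hkl : k ≤ l) (c : ℕ) :
    Keeps k s (s'.setVar (tr l) c) where
  arr := h.arr
  var r hr := by simpa [hr l hkl] using h.var r hr

theorem Keeps.refl (k : ℕ) (s : Store) : Keeps k s s := ⟨rfl, fun _ _ => rfl⟩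

theorem Keeps.tr_lt {k j : ℕ} {s s' : Store} (h : Keeps k s s') (hj : j < k) :
    s'.var (tr j) = s.var (tr j) :=
  h.var _ fun i hi => by simp; omega

theorem Keeps.vr {k : ℕ} {s s' : Store} (h : Keeps k s s') (x : ℕ) :
    s'.var (vr x) = s.var (RAM.vr x) :=
  h.var _ fun _ _ => vr_ne_tr

theorem Keeps.zero {k : ℕ} {s s' : Store} (h : Keeps k s s') : s'.var 0 = s.var 0 :=
  h.var _ fun _ _ => zero_ne_tr

theorem Models.keeps {n k : ℕ} {σ : ℕ → ℕ → ℕ → ℕ} {ρ : ℕ → ℕ} {s s' : Store}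
    (h : Models n σ ρ s) (hk : Keeps k s s') : Models n σ ρ s' where
  size := hk.zero.trans h.size
  vars x := (hk.vr x).trans (h.vars x)
  arrs a i j hi hj := by rw [hk.arr]; exact h.arrs a i j hi hj

theorem runs_indexProg {n x y k : ℕ} {s : Store} (hn : s.var 0 = n) (hx : s.var (vr x) < n) :
    Runs (indexProg x y k) s (3 * n + 5)
      fun s' => Keeps k s s' ∧ s'.var (tr k) = s.var (vr x) * n + s.var (vr y) := by
  set m := s.var (vr x) with hm
  refine Runs.mono (T := 1 + (1 + (1 + ((m * (1 + 1 + 1) + 1) + 1)))) ?_ (by omega) fun _ h => h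
  refine .seq (.const (.seq (.const (.seq (.add (.seq (.mono (.loop (m := m) (fun i s' =>
    Keeps k s s' ∧ s'.var (tr (k + 1)) = i ∧ s'.var (tr (k + 2)) = 1 ∧
      s'.var (tr k) + i * n = m * n) ?_ ?_ ?_) le_rfl ?_)))))))
  · exact fun i s' h => h.2.1
  · rintro i s' - ⟨hk, h1, h2, h3⟩
    refine .seq (.add (.sub ⟨?_, ?_, ?_, ?_⟩))
    · exact (hk.setVar le_rfl _).setVar (by omega) _
    · simp [h1, h2]
    · simp [h2]
    · simp only [Store.setVar_var, tr_inj]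
      rw [if_neg (by omega), if_pos trivial, hk.zero, hn, ← h3]
      ring
  · refine ⟨(((Keeps.refl k s).setVar le_rfl _).setVar (by omega) _).setVar (by omega) _,
      ?_, ?_, ?_⟩
    · simp [hm]
    · simp
    · simp
  · rintro s' ⟨hk, h1, h2, h3⟩
    refine .add ⟨hk.setVar le_rfl _, ?_⟩
    rw [zero_mul, add_zero] at h3
    simp [h3, hk.vr]

theorem Term.runs_compile {n : ℕ} {σ : ℕ → ℕ → ℕ → ℕ} (t : Term) {ρ : ℕ → ℕ} {s : Store}
    (k : ℕ) (h : Models n σ ρ s) (hρ : ∀ x, ρ x < n) :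
    Runs (t.compile k) s (t.cost.eval n)
      fun s' => Keeps k s s' ∧ s'.var (tr k) = t.eval n σ ρ := by
  induction t generalizing ρ s k with
  | num c =>
    refine (Runs.const ⟨(Keeps.refl k s).setVar le_rfl _, ?_⟩).mono (by simp [cost]) fun _ h => h
    simp [eval]
  | var x =>
    refine (Runs.seq (.const (.add ⟨((Keeps.refl k s).setVar le_rfl _).setVar le_rfl _, ?_⟩))).mono
      (by simp [cost]) fun _ h => h
    simp [eval, h.vars]
  | get a x y =>
    refine (Runs.seq ((runs_indexProg h.size (by rw [h.vars]; exact hρ x)).mono le_rfl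
      fun s' ⟨hk, hv⟩ => .load ⟨hk.setVar le_rfl _, ?_⟩)).mono (by simp [cost]) fun _ h => h
    simp [eval, hv, hk.arr, h.vars, h.arrs a _ _ (hρ x) (hρ y)]
  | sub t u iht ihu =>
    refine (Runs.seq ((iht k h hρ).mono le_rfl fun s' ⟨hk, hv⟩ =>
      .seq ((ihu (k + 1) (h.keeps hk) hρ).mono le_rfl fun s'' ⟨hk', hv'⟩ => .sub
        ⟨(hk.trans hk' (by omega)).setVar le_rfl _, ?_⟩))).mono
      (by simp [cost, add_assoc]) fun _ h => h
    simp [eval, hv', hk'.tr_lt (Nat.lt_succ_self k), hv]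
  | ite t u v iht ihu ihv =>
    refine (Runs.seq ((iht k h hρ).mono le_rfl fun s' ⟨hk, hv⟩ =>
      .cond (T := u.cost.eval n + v.cost.eval n) (fun hne => ?_) (fun heq => ?_))).mono
      (by simp [cost]) fun _ h => h
    · refine (ihu k (h.keeps hk) hρ).mono (by omega) fun s'' ⟨hk', hv'⟩ =>
        ⟨hk.trans hk' le_rfl, ?_⟩
      rw [hv']
      simp only [eval]
      rw [if_neg (hv ▸ hne)]
    · refine (ihv k (h.keeps hk) hρ).mono (by omega) fun s'' ⟨hk', hv'⟩ =>
        ⟨hk.trans hk' le_rfl, ?_⟩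
      rw [hv']
      simp only [eval]
      rw [if_pos (hv ▸ heq)]
  | sum x t iht =>
    refine Runs.mono (T := 1 + (1 + (1 + (1 + ((n * ((1 + (t.cost.eval n + 1)) + 1) + 1) + 1)))))
      ?_ (by simp [cost]; ring_nf; rfl) fun _ h => h
    refine .seq (.const (.seq (.const (.seq (.add (.seq (.add (.seq (.mono
      (.loop (m := n) (fun i s' => s'.var (vr x) = i ∧ s'.var (tr (k + 1)) = ρ x ∧
        s'.var (tr (k + 2)) = 1 ∧ s'.var (tr k) =
          ∑ j ∈ Finset.Ico i n, t.eval n σ (Function.update ρ x j) ∧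
        s'.arr = s.arr ∧ ∀ r, r ≠ vr x → (∀ j, k ≤ j → r ≠ tr j) → s'.var r = s.var r)
        ?_ ?_ ?_) le_rfl ?_)))))))))
    · exact fun i s' h => h.1
    · rintro i s' hi ⟨h1, h2, h3, h4, h5, h6⟩
      have hm : Models n σ (Function.update ρ x i)
          (s'.setVar (vr x) (s'.var (vr x) - s'.var (tr (k + 2)))) := by
        refine ⟨?_, fun y => ?_, fun a i j hi hj => ?_⟩
        · rw [Store.setVar_var, if_neg zero_ne_vr, h6 0 (by simp) (by simp), h.size]
        · by_cases hyx : y = x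
          · subst hyx; simp [h1, h3]
          · simp only [Store.setVar_var, vr_inj, hyx, if_false, Function.update_apply]
            rw [h6 _ (by simpa using hyx) (by simp), h.vars]
        · rw [Store.setVar_arr, h5, h.arrs a i j hi hj]
      refine .seq (.sub (.seq ((iht (k + 3) hm fun y => ?_).mono le_rfl
        fun s'' ⟨hk, hv⟩ => .add ⟨?_, ?_, ?_, ?_, ?_, ?_⟩)))
      · rw [Function.update_apply]
        split_ifs
        exacts [hi, hρ y]
      · simp [hk.vr, h1, h3]
      · simp [hk.tr_lt (show k + 1 < k + 3 by omega), h2]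
      · simp [hk.tr_lt (show k + 2 < k + 3 by omega), h3]
      · rw [Finset.sum_eq_sum_Ico_succ_bot hi]
        simp [hk.tr_lt (show k < k + 3 by omega), h4, hv, add_comm]
      · simp [hk.arr, h5]
      · intro r hr hrj
        simp only [Store.setVar_var, hrj k le_rfl, if_false]
        rw [hk.var r fun j hj => hrj j (by omega)]
        simp only [Store.setVar_var, hr, if_false]
        exact h6 r hr hrj
    · refine ⟨?_, ?_, ?_, ?_, ?_, fun r hr hrj => ?_⟩
      · simp [h.size]
      · simp [h.vars]
      · simp
      · simp
      · simp
      · simp [hr, hrj k le_rfl, hrj (k + 1) (by omega), hrj (k + 2) (by omega)]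
    · rintro s' ⟨h1, h2, h3, h4, h5, h6⟩
      refine .add ⟨⟨by simpa using h5, fun r hr => ?_⟩, ?_⟩
      · by_cases hrx : r = vr x
        · subst hrx; simp [h1, h2, h.vars]
        · simp only [Store.setVar_var, hrx, if_false]
          exact h6 r hrx hr
      · simp only [Store.setVar_var, tr_ne_vr, if_false, h4, eval, Finset.range_eq_Ico]

/-! ### Commands -/

/-- A small language for computing with `n × n` matrices of natural numbers. -/
inductive Cmd : Type
  /-- Every entry of the matrix `a` is set to the value of `t`, in which the variables `0` and `1`
  stand for its row and its column. -/
  | fill (a : ℕ) (t : Term) : Cmd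
  | seq (c d : Cmd) : Cmd
  /-- The command `c` is executed `n` times. -/
  | iter (c : Cmd) : Cmd

/-- The values of the variables while the entry in row `i` and column `j` is computed. -/
def entryEnv (i j : ℕ) : ℕ → ℕ := fun x => if x = 0 then i else if x = 1 then j else 0

/-- The effect of a command on the matrices. -/
def Cmd.run (n : ℕ) : Cmd → (ℕ → ℕ → ℕ → ℕ) → ℕ → ℕ → ℕ → ℕ
  | fill a t, σ => Function.update σ a fun i j => t.eval n σ (entryEnv i j)
  | seq c d, σ => d.run n (c.run n σ)
  | iter c, σ => (c.run n)^[n] σ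

/-- No matrix is read while it is filled. -/
def Cmd.Ok : Cmd → Prop
  | fill a t => t.Avoids a
  | seq c d => c.Ok ∧ d.Ok
  | iter c => c.Ok

/-- The machine program for a command, which uses only `tr j` for `j ≥ k` for intermediate
results. -/
def Cmd.compile : Cmd → ℕ → Prog
  | fill a t, k =>
    .seq (.const (tr k) 0) <|
    .seq (.const (tr (k + 1)) 1) <|
    .seq (.add (vr 0) 0 (tr k)) <|
    .loop (vr 0) <|
      .seq (.sub (vr 0) (vr 0) (tr (k + 1))) <|
      .seq (.add (vr 1) 0 (tr k)) <|
      .loop (vr 1) <|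
        .seq (.sub (vr 1) (vr 1) (tr (k + 1))) <|
        .seq (t.compile (k + 2)) <|
        .seq (indexProg 0 1 (k + 3)) <|
        .store a (tr (k + 3)) (tr (k + 2))
  | seq c d, k => .seq (c.compile k) (d.compile k)
  | iter c, k =>
    .seq (.const (tr k) 0) <|
    .seq (.add (tr k) 0 (tr k)) <|
    .loop (tr k) <|
      .seq (c.compile (k + 2)) <|
      .seq (.const (tr (k + 1)) 1) (.sub (tr k) (tr k) (tr (k + 1)))

open Polynomial in
/-- A bound on the number of steps that a command takes. -/
noncomputable def Cmd.cost : Cmd → ℕ[X]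
  | fill _ t => X * (X * (t.cost + 3 * X + 8) + 4) + 4
  | seq c d => c.cost + d.cost
  | iter c => X * (c.cost + 3) + 3

theorem cell_inj {n i j i' j' : ℕ} (hj : j < n) (hj' : j' < n) (h : i * n + j = i' * n + j') :
    i = i' ∧ j = j' := by
  have hn : 0 < n := by omega
  have h1 : (i * n + j) / n = (i' * n + j') / n := by rw [h]
  have h2 : (i * n + j) % n = (i' * n + j') % n := by rw [h]
  rw [mul_comm i, mul_comm i', Nat.mul_add_div hn, Nat.mul_add_div hn, Nat.div_eq_of_lt hj,
    Nat.div_eq_of_lt hj'] at h1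
  rw [mul_comm i, mul_comm i', Nat.mul_add_mod, Nat.mul_add_mod, Nat.mod_eq_of_lt hj,
    Nat.mod_eq_of_lt hj'] at h2
  omega

/-- The state of the loops of a `fill` command when the entries after row `i` and those of row `i`
from column `j` on have been written. -/
structure FillInv (n a k : ℕ) (t : Term) (σ : ℕ → ℕ → ℕ → ℕ) (s₀ : Store) (i j : ℕ) (s : Store) :
    Prop where
  size : s.var 0 = n
  vars : ∀ x, s.var (vr x) = entryEnv i j x
  zero : s.var (tr k) = 0
  one : s.var (tr (k + 1)) = 1
  temps : ∀ l < k, s.var (tr l) = s₀.var (tr l)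
  others : ∀ b i j, b ≠ a → i < n → j < n → s.arr b (i * n + j) = σ b i j
  done : ∀ i' j', i' < n → j' < n → (i < i' ∨ i = i' ∧ j ≤ j') →
    s.arr a (i' * n + j') = t.eval n σ (entryEnv i' j')

theorem runs_fill_entry {n a k i j : ℕ} {t : Term} {σ : ℕ → ℕ → ℕ → ℕ} {s₀ s : Store}
    (ht : t.Avoids a) (hi : i < n) (hj : j < n) (h : FillInv n a k t σ s₀ i (j + 1) s) :
    Runs (.seq (.sub (vr 1) (vr 1) (tr (k + 1))) <|
        .seq (t.compile (k + 2)) <|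
        .seq (indexProg 0 1 (k + 3)) <|
        .store a (tr (k + 3)) (tr (k + 2))) s (1 + (t.cost.eval n + (3 * n + 5 + 1)))
      (FillInv n a k t σ s₀ i j) := by
  have hn : 0 < n := by omega
  set s₁ := s.setVar (vr 1) (s.var (vr 1) - s.var (tr (k + 1))) with hs₁
  have hv : ∀ x, s₁.var (vr x) = entryEnv i j x := by
    intro x
    simp only [hs₁, Store.setVar_var, vr_inj, h.vars, h.one]
    by_cases hx : x = 1
    · simp [hx, entryEnv]
    · by_cases hx0 : x = 0 <;> simp [hx, hx0, entryEnv]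
  -- The matrices at this moment: the matrix `a` is partly overwritten, the others are those of `σ`.
  set σ' : ℕ → ℕ → ℕ → ℕ := fun b i j => if b = a then s.arr a (i * n + j) else σ b i j with hσ'
  have hm : Models n σ' (entryEnv i j) s₁ := by
    refine ⟨by simp [hs₁, h.size], hv, fun b i' j' hi' hj' => ?_⟩
    by_cases hb : b = a
    · simp [hs₁, hσ', hb]
    · simp [hs₁, hσ', hb, h.others b i' j' hb hi' hj']
  have hev : t.eval n σ' (entryEnv i j) = t.eval n σ (entryEnv i j) :=
    ht.eval_congr (fun b hb => by funext i j; simp [hσ', hb]) _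
  have hlt : ∀ x, entryEnv i j x < n := by
    intro x
    unfold entryEnv
    split_ifs <;> assumption
  refine .seq (.sub (.seq ((t.runs_compile (k + 2) hm hlt).mono le_rfl fun s₂ ⟨hk₂, hv₂⟩ =>
    .seq ((runs_indexProg ((hm.keeps hk₂).size) ?_).mono le_rfl fun s₃ ⟨hk₃, hv₃⟩ => .store ?_))))
  · rw [hk₂.vr, hv]
    exact hlt 0
  · have hk := hk₂.trans hk₃ (by omega)
    have hval : s₃.var (tr (k + 2)) = t.eval n σ (entryEnv i j) := by
      rw [hk₃.tr_lt (by omega), hv₂, hev]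
    have hidx : s₃.var (tr (k + 3)) = i * n + j := by
      rw [hv₃, hk₂.vr, hk₂.vr, hv, hv]
      simp [entryEnv]
    have harr : s₃.arr = s.arr := by rw [hk.arr]; rfl
    refine ⟨?_, fun x => ?_, ?_, ?_, fun l hl => ?_, fun b i' j' hb hi' hj' => ?_,
      fun i' j' hi' hj' hd => ?_⟩
    · simp [hk.zero, hs₁, h.size]
    · simp [hk.vr, hv]
    · simp [hk.tr_lt (show k < k + 2 by omega), hs₁, h.zero]
    · simp [hk.tr_lt (show k + 1 < k + 2 by omega), hs₁, h.one]
    · simp [hk.tr_lt (show l < k + 2 by omega), hs₁, h.temps l hl]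
    · simp [hb, harr, h.others b i' j' hb hi' hj']
    · rw [Store.setArr_arr, hidx, hval, harr]
      by_cases he : i' = i ∧ j' = j
      · rw [if_pos ⟨rfl, by rw [he.1, he.2]⟩, he.1, he.2]
      · rw [if_neg fun hc => he (cell_inj hj' hj hc.2)]
        exact h.done i' j' hi' hj' (by omega)

theorem Cmd.runs_compile {n : ℕ} (c : Cmd) {σ : ℕ → ℕ → ℕ → ℕ} {s : Store} (k : ℕ) (hc : c.Ok)
    (h : Models n σ (fun _ => 0) s) :
    Runs (c.compile k) s (c.cost.eval n) fun s' =>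
      Models n (c.run n σ) (fun _ => 0) s' ∧ ∀ l < k, s'.var (tr l) = s.var (tr l) := by
  induction c generalizing σ s k with
  | fill a t =>
    refine Runs.mono (T := 1 + (1 + (1 + (n * ((1 + (1 +
      (n * ((1 + (t.cost.eval n + (3 * n + 5 + 1))) + 1) + 1))) + 1) + 1))))
      (Q := FillInv n a k t σ s 0 0) ?_ ?_ ?_
    · refine .seq (.const (.seq (.const (.seq (.add
        (.loop (m := n) (fun i => FillInv n a k t σ s i 0) ?_ ?_ ?_))))))
      · intro i s' h
        rw [h.vars]
        rfl
      · intro i s' hi h'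
        refine .seq (.sub (.seq (.add
          (.loop (m := n) (fun j => FillInv n a k t σ s i j) ?_ ?_ ?_))))
        · intro j s' h
          rw [h.vars]
          rfl
        · exact fun j s' hj h => runs_fill_entry hc hi hj h
        · refine ⟨?_, fun x => ?_, ?_, ?_, fun l hl => ?_, fun b i j hb hi hj => ?_,
            fun i' j' hi' hj' hd => ?_⟩
          · simp [h'.size]
          · by_cases hx : x = 1
            · simp [hx, h'.size, h'.zero, entryEnv]
            · by_cases hx0 : x = 0
              · simp [hx0, h'.vars, h'.one, entryEnv]
              · simp [hx, hx0, h'.vars, entryEnv]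
          · simp [h'.zero]
          · simp [h'.one]
          · simp [h'.temps l hl]
          · simp [h'.others b i j hb hi hj]
          · simpa using h'.done i' j' hi' hj' (by omega)
      · refine ⟨?_, fun x => ?_, ?_, ?_, fun l hl => ?_, fun b i j hb hi hj => ?_,
          fun i' j' hi' hj' hd => by omega⟩
        · simp [h.size]
        · by_cases hx : x = 0
          · simp [hx, h.size, entryEnv]
          · simp [hx, h.vars, entryEnv]
        · simp
        · simp
        · simp [hl.ne, (show l ≠ k + 1 by omega)]
        · simp [h.arrs b i j hi hj]
    · simp only [cost, Polynomial.eval_add, Polynomial.eval_mul, Polynomial.eval_X,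
        Polynomial.eval_ofNat]
      apply le_of_eq
      ring
    · intro s' h'
      refine ⟨⟨h'.size, fun x => ?_, fun b i j hi hj => ?_⟩, h'.temps⟩
      · rw [h'.vars]
        simp [entryEnv]
      · by_cases hb : b = a
        · subst hb
          rw [h'.done i j hi hj (by omega)]
          simp [run]
        · rw [h'.others b i j hb hi hj]
          simp [run, hb]
  | seq c d ihc ihd =>
    refine (Runs.seq ((ihc k hc.1 h).mono le_rfl fun s' ⟨hm, hk⟩ =>
      (ihd k hc.2 hm).mono le_rfl fun s'' ⟨hm', hk'⟩ => ⟨hm', fun l hl => ?_⟩)).mono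
      (by simp [cost]) fun _ h => h
    rw [hk' l hl, hk l hl]
  | iter c ih =>
    refine Runs.mono (T := 1 + (1 + (n * ((c.cost.eval n + (1 + 1)) + 1) + 1)))
      (Q := fun s' => Models n ((c.run n)^[n - 0] σ) (fun _ => 0) s' ∧ s'.var (tr k) = 0 ∧
        ∀ l < k, s'.var (tr l) = s.var (tr l)) ?_ ?_ ?_
    · refine .seq (.const (.seq (.add (.loop (m := n) (fun i s' =>
        Models n ((c.run n)^[n - i] σ) (fun _ => 0) s' ∧ s'.var (tr k) = i ∧
        ∀ l < k, s'.var (tr l) = s.var (tr l)) (fun i s' h => h.2.1) ?_ ?_))))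
      · rintro i s' hi ⟨hm, hi', hk⟩
        refine .seq ((ih (k + 2) hc hm).mono le_rfl fun s'' ⟨hm', hk'⟩ =>
          .seq (.const (.sub ⟨?_, ?_, fun l hl => ?_⟩)))
        · have : n - i = (n - (i + 1)) + 1 := by omega
          rw [this, Function.iterate_succ_apply']
          exact ⟨by simp [hm'.size], fun x => by simp [hm'.vars], fun b i j hi hj => by
            simp [hm'.arrs b i j hi hj]⟩
        · simp [hk' k (by omega), hi']
        · simp [hl.ne, (show l ≠ k + 1 by omega), hk' l (by omega), hk l hl]
      · refine ⟨⟨by simp [h.size], fun x => by simp [h.vars], fun b i j hi hj => by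
          simp [h.arrs b i j hi hj]⟩, by simp [h.size], fun l hl => by simp [hl.ne]⟩
    · simp only [cost, Polynomial.eval_add, Polynomial.eval_mul, Polynomial.eval_X,
        Polynomial.eval_ofNat]
      apply le_of_eq
      ring
    · exact fun s' h => ⟨h.1, h.2.2⟩

end RAM

namespace SimpleGraph

/-! ### The rounds of the algorithm as operations on vertex sets -/

/-- If `m` decreases in every step that changes anything, then a fixed point is reached after as
many steps as the initial value of `m`. -/
theorem iterate_fixed {α : Type*} {f : α → α} (m : α → ℕ) (hm : ∀ a, f a ≠ a → m (f a) < m a)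
    {N : ℕ} {a : α} (ha : m a ≤ N) : f (f^[N] a) = f^[N] a := by
  have key : ∀ i, f (f^[i] a) = f^[i] a ∨ m (f^[i] a) + i ≤ m a := by
    intro i
    induction i with
    | zero => right; simp
    | succ i ih =>
      rw [Function.iterate_succ_apply']
      by_cases hfix : f (f^[i] a) = f^[i] a
      · left; rw [hfix, hfix]
      · have := ih.resolve_left hfix
        have := hm _ hfix
        right; omega
  by_contra hne
  have h1 := (key N).resolve_left hne
  have h2 := hm _ hne
  omega

section Rounds

variable {V : Type*} {G : SimpleGraph V}

/-- Some walk of odd length in `S` leads from `x` to `y`. -/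
def OddWalk (G : SimpleGraph V) (S : Finset V) (x y : V) : Prop :=
  ∃ p : (G.within S).Walk x y, Odd p.length

theorem OddWalk.mem_left {S : Finset V} {x y : V} (h : G.OddWalk S x y) : x ∈ S := by
  obtain ⟨p, hp⟩ := h
  cases p with
  | nil => simp at hp
  | cons h p => exact h.2.1

theorem OddWalk.symm {S : Finset V} {x y : V} (h : G.OddWalk S x y) : G.OddWalk S y x := by
  obtain ⟨p, hp⟩ := h
  exact ⟨p.reverse, by simpa using hp⟩

theorem OddWalk.of_adj {S : Finset V} {x y : V} (hx : x ∈ S) (hy : y ∈ S) (h : G.Adj x y) :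
    G.OddWalk S x y := by
  have h' : (G.within S).Adj x y := ⟨h, hx, hy⟩
  exact ⟨.cons h' .nil, by rw [Walk.length_cons, Walk.length_nil]; exact odd_one⟩

theorem exists_bipartition_of_not_oddWalk {S : Finset V} {y : V} (h : ¬ G.OddWalk S y y) :
    ∃ χ : V → ℕ, (∀ x ∈ G.comp S y, χ x = 0 ∨ χ x = 1) ∧ G.ProperOn (G.comp S y) χ := by
  classical
  refine ⟨fun x => if G.OddWalk S y x then 1 else 0, fun x _ => ?_, fun u hu v hv huv => ?_⟩
  · dsimp only
    split_ifs <;> simp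
  · obtain ⟨huS, hru⟩ := mem_comp.1 hu
    have hvS := (mem_comp.1 hv).1
    have hadj : (G.within S).Adj u v := ⟨huv, huS, hvS⟩
    have nboth : ¬ (G.OddWalk S y u ∧ G.OddWalk S y v) := by
      rintro ⟨⟨p, hp⟩, ⟨q, hq⟩⟩
      refine h ⟨p.append (.cons hadj q.reverse), ?_⟩
      rw [Walk.length_append, Walk.length_cons, Walk.length_reverse]
      exact hp.add_even hq.add_one
    have nneither : ¬ (¬ G.OddWalk S y u ∧ ¬ G.OddWalk S y v) := by
      rintro ⟨hnu, hnv⟩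
      obtain ⟨p⟩ := hru
      rcases Nat.even_or_odd p.length with he | ho
      · refine hnv ⟨p.append (.cons hadj .nil), ?_⟩
        rw [Walk.length_append, Walk.length_cons, Walk.length_nil, zero_add]
        exact he.add_one
      · exact hnu ⟨p, ho⟩
    dsimp only
    split_ifs <;> simp <;> tauto

/-- A vertex of positive degree reaches the vertices of its component by an odd walk, or by an odd
walk and one more edge. -/
theorem mem_comp_iff_oddWalk {S : Finset V} {y t : V} (hy : y ∈ S) (hd : 2 ≤ (G.nb S y).card) :
    t ∈ G.comp S y ↔ G.OddWalk S y t ∨ ∃ k, G.OddWalk S y k ∧ G.Adj k t ∧ t ∈ S := by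
  constructor
  · intro ht
    obtain ⟨p⟩ := (mem_comp.1 ht).2
    rcases Nat.even_or_odd p.length with he | ho
    · right
      obtain ⟨r, hr⟩ : ∃ r : (G.within S).Walk t y, Even r.length := ⟨p.reverse, by simpa using he⟩
      cases r with
      | nil =>
        obtain ⟨u, hu⟩ := Finset.card_pos.1 (show 0 < (G.nb S y).card by omega)
        obtain ⟨huS, hyu⟩ := mem_nb.1 hu
        exact ⟨u, .of_adj hy huS hyu, hyu.symm, hy⟩
      | @cons _ w _ h r =>
        rw [Walk.length_cons, Nat.even_add_one, Nat.not_even_iff_odd] at hr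
        exact ⟨w, OddWalk.symm ⟨r, hr⟩, h.1.symm, h.2.1⟩
    · exact Or.inl ⟨p, ho⟩
  · rintro (h | ⟨k, h, hkt, ht⟩)
    · exact mem_comp.2 ⟨h.symm.mem_left, h.choose.reachable⟩
    · exact comp_closed (mem_comp.2 ⟨h.symm.mem_left, h.choose.reachable⟩) ht hkt

/-- An odd closed walk prevents 2-choosability, since it prevents a proper 2-colouring. -/
theorem OddWalk.not_choosableOn {S : Finset V} {y : V} (h : G.OddWalk S y y) :
    ¬ G.ChoosableOn (G.comp S y) := by
  intro hch
  obtain ⟨χ, hχ, hp⟩ := hch.exists_bipartition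
  -- Along a walk, the two colours alternate.
  have key : ∀ (u v : V) (p : (G.within S).Walk u v), u ∈ G.comp S y →
      (Odd p.length ↔ χ u ≠ χ v) := by
    intro u v p
    induction p with
    | nil => simp
    | @cons a b c h p ih =>
      intro ha
      have hb := comp_closed ha h.2.2 h.1
      have hc : c ∈ G.comp S y := by
        have hb' := mem_comp.1 hb
        cases p with
        | nil => exact hb
        | cons h' p' =>
          have hcS : c ∈ S := by
            obtain ⟨q, hq⟩ : ∃ q : (G.within S).Walk c b, q.length = (Walk.cons h' p').length :=
              ⟨(Walk.cons h' p').reverse, by simp⟩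
            cases q with
            | nil => simp at hq
            | cons h'' _ => exact h''.2.1
          exact mem_comp.2 ⟨hcS, hb'.2.trans (Walk.cons h' p').reachable⟩
      have h1 := hp a ha b hb h.1
      have h2 := ih hb
      have a1 := hχ a ha
      have a2 := hχ b hb
      have a3 := hχ c hc
      rw [Walk.length_cons, Nat.odd_add_one, h2]
      omega
  obtain ⟨p, hodd⟩ := h
  exact (key y y p (self_mem_comp (OddWalk.mem_left ⟨p, hodd⟩))).1 hodd rfl

/-- Simultaneous removal of all vertices of degree at most one. -/
noncomputable def pruneStep (G : SimpleGraph V) (S : Finset V) : Finset V :=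
  S.filter fun v => 2 ≤ (G.nb S v).card

theorem pruneStep_subset {S : Finset V} : G.pruneStep S ⊆ S := Finset.filter_subset _ _

variable [DecidableEq V]

/-- The test by which the algorithm recognizes the components that are not 2-choosable. -/
theorem not_choosableOn_comp_iff {P : Finset V} (hP : ∀ v ∈ P, 2 ≤ (G.nb P v).card) {y : V} :
    ¬ G.ChoosableOn (G.comp P y) ↔ G.OddWalk P y y ∨
      ∃ z ∈ G.comp P y, (G.nb P z).card ≠ 2 ∧
        ¬ ∃ w ∈ P, G.ThetaPair P z w ∧ ∀ t ∈ G.comp P y, (G.nb P t).card ≠ 2 → t = z ∨ t = w := by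
  have hconn : G.Conn (G.comp P y) := conn_comp
  have hdeg : ∀ x ∈ G.comp P y, (G.nb (G.comp P y) x).card = (G.nb P x).card := fun x hx => by
    rw [nb_comp hx]
  have hpair : ∀ z ∈ G.comp P y, ∀ w,
      (w ∈ G.comp P y ∧ G.ThetaPair (G.comp P y) z w) ↔ (w ∈ P ∧ G.ThetaPair P z w) := by
    intro z hz w
    constructor
    · rintro ⟨hw, hzw, hz3, hw3, p, hp, q, hq, hpq, hp2, hq2, h⟩
      rw [hdeg _ (by assumption)] at hz3 hw3 hp2 hq2
      exact ⟨comp_subset hw, hzw, hz3, hw3, p, comp_subset hp, q, comp_subset hq, hpq, hp2, hq2, h⟩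
    · rintro ⟨hw, hzw, hz3, hw3, p, hp, q, hq, hpq, hp2, hq2, hzp, hwp, hzq, hwq⟩
      have hp' := comp_closed hz hp hzp
      have hq' := comp_closed hz hq hzq
      have hw' := comp_closed hp' hw hwp.symm
      rw [← hdeg _ (by assumption)] at hz3 hw3 hp2 hq2
      exact ⟨hw', hzw, hz3, hw3, p, hp', q, hq', hpq, hp2, hq2, hzp, hwp, hzq, hwq⟩
  constructor
  · intro hbad
    by_contra! hcon
    obtain ⟨hodd, hall⟩ := hcon
    obtain ⟨χ, hχ, hp⟩ := exists_bipartition_of_not_oddWalk hodd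
    refine hbad (hconn.choosableOn_of_thetaPair hχ hp fun z hz hz2 => ?_)
    rw [hdeg z hz] at hz2
    obtain ⟨w, hw, hzw, ht⟩ := hall z hz hz2
    obtain ⟨hw', hzw'⟩ := (hpair z hz w).2 ⟨hw, hzw⟩
    exact ⟨w, hw', hzw', fun t htK ht2 => ht t htK (by rwa [← hdeg t htK])⟩
  · rintro (h | ⟨z, hz, hz2, hno⟩) hch
    · exact h.not_choosableOn hch
    · have hcore : G.ChoosableCore (G.comp P y) :=
        ⟨hconn, hch, fun v hv => by rw [hdeg v hv]; exact hP v (comp_subset hv)⟩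
      obtain ⟨w, hw, hzw, ht⟩ := hcore.exists_thetaPair hz (by rwa [hdeg z hz])
      obtain ⟨hw', hzw'⟩ := (hpair z hz w).1 ⟨hw, hzw⟩
      exact hno ⟨w, hw', hzw', fun t htK ht2 => ht t htK (by rwa [hdeg t htK])⟩

variable [Fintype V]

theorem prunesTo_iterate (S : Finset V) :
    G.PrunesTo S (G.pruneStep^[Fintype.card V] S) := by
  have hsub : ∀ i, G.pruneStep^[i] S ⊆ S := by
    intro i
    induction i with
    | zero => exact subset_rfl
    | succ i ih => rw [Function.iterate_succ_apply']; exact pruneStep_subset.trans ih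
  have hlift : ∀ i W, G.ChoosableOn (G.pruneStep^[i] S ∩ W) → G.ChoosableOn (S ∩ W) := by
    intro i
    induction i with
    | zero => exact fun W h => h
    | succ i ih =>
      intro W h
      rw [Function.iterate_succ_apply'] at h
      refine ih W (h.of_sdiff_low (Finset.inter_subset_inter_right pruneStep_subset) ?_)
      intro v hv hv'
      obtain ⟨hvS, hvW⟩ := Finset.mem_inter.1 hv
      by_contra hcon
      refine hv' (Finset.mem_inter.2 ⟨Finset.mem_filter.2 ⟨hvS, ?_⟩, hvW⟩)
      have := Finset.card_le_card
        (nb_mono (G := G) (Finset.inter_subset_left (s₁ := G.pruneStep^[i] S) (s₂ := W)) v)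
      omega
  refine ⟨hsub _, fun v hv => ?_, hlift _⟩
  have hfix : G.pruneStep (G.pruneStep^[Fintype.card V] S) = G.pruneStep^[Fintype.card V] S :=
    iterate_fixed Finset.card (fun T hT => Finset.card_lt_card
      (pruneStep_subset.ssubset_of_ne hT)) (Finset.card_le_univ S)
  rw [← hfix] at hv
  exact (Finset.mem_filter.1 hv).2

open Classical in
/-- The edges of `S`, as ordered pairs. -/
noncomputable def oddBase (G : SimpleGraph V) (S : Finset V) : Finset (V × V) :=
  Finset.univ.filter fun e => e.1 ∈ S ∧ e.2 ∈ S ∧ G.Adj e.1 e.2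

open Classical in
/-- Prolongation of walks by two edges of `S`. -/
noncomputable def oddStep (G : SimpleGraph V) (S : Finset V) (R : Finset (V × V)) :
    Finset (V × V) :=
  Finset.univ.filter fun e => e ∈ R ∨
    ∃ k l, e.1 ∈ S ∧ k ∈ S ∧ G.Adj e.1 k ∧ G.Adj k l ∧ (l, e.2) ∈ R

theorem mem_oddStep {S : Finset V} {R : Finset (V × V)} {x y : V} :
    (x, y) ∈ G.oddStep S R ↔ (x, y) ∈ R ∨
      ∃ k l, x ∈ S ∧ k ∈ S ∧ G.Adj x k ∧ G.Adj k l ∧ (l, y) ∈ R := by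
  simp [oddStep]

theorem mem_oddBase {S : Finset V} {x y : V} :
    (x, y) ∈ G.oddBase S ↔ x ∈ S ∧ y ∈ S ∧ G.Adj x y := by
  simp [oddBase]

theorem mem_iterate_oddStep (S : Finset V) {N : ℕ} (hN : Fintype.card (V × V) ≤ N) (x y : V) :
    (x, y) ∈ (G.oddStep S)^[N] (G.oddBase S) ↔ G.OddWalk S x y := by
  constructor
  · have key : ∀ i x y, (x, y) ∈ (G.oddStep S)^[i] (G.oddBase S) → G.OddWalk S x y := by
      intro i
      induction i with
      | zero =>
        intro x y h
        obtain ⟨hx, hy, hxy⟩ := mem_oddBase.1 h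
        exact .of_adj hx hy hxy
      | succ i ih =>
        intro x y h
        rw [Function.iterate_succ_apply', mem_oddStep] at h
        rcases h with h | ⟨k, l, hx, hk, hxk, hkl, h⟩
        · exact ih x y h
        · have hw := ih l y h
          have h₁ : (G.within S).Adj x k := ⟨hxk, hx, hk⟩
          have h₂ : (G.within S).Adj k l := ⟨hkl, hk, hw.mem_left⟩
          obtain ⟨p, hp⟩ := hw
          refine ⟨.cons h₁ (.cons h₂ p), ?_⟩
          rw [Walk.length_cons, Walk.length_cons]
          exact hp.add_even even_two
    exact key N x y
  · have hle : ∀ R : Finset (V × V), R ⊆ G.oddStep S R := fun R e he =>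
      mem_oddStep.2 (Or.inl he)
    have hfix : G.oddStep S ((G.oddStep S)^[N] (G.oddBase S)) =
        (G.oddStep S)^[N] (G.oddBase S) := by
      refine iterate_fixed (fun R => Fintype.card (V × V) - R.card) (fun R hR => ?_)
        ((Nat.sub_le _ _).trans hN)
      have h1 := Finset.card_lt_card ((hle R).ssubset_of_ne hR.symm)
      have h2 := Finset.card_le_univ (G.oddStep S R)
      omega
    have hbase : ∀ i, G.oddBase S ⊆ (G.oddStep S)^[i] (G.oddBase S) := by
      intro i
      induction i with
      | zero => exact subset_rfl
      | succ i ih => rw [Function.iterate_succ_apply']; exact ih.trans (hle _)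
    have key : ∀ m x y (p : (G.within S).Walk x y), p.length = 2 * m + 1 →
        (x, y) ∈ (G.oddStep S)^[N] (G.oddBase S) := by
      intro m
      induction m with
      | zero =>
        intro x y p hp
        have := p.adj_of_length_eq_one (by omega)
        exact hbase N (mem_oddBase.2 ⟨this.2.1, this.2.2, this.1⟩)
      | succ m ih =>
        intro x y p hp
        match p, hp with
        | .cons h (.cons h' q), hp =>
          rw [Walk.length_cons, Walk.length_cons] at hp
          rw [← hfix]
          exact mem_oddStep.2 (Or.inr ⟨_, _, h.2.1, h.2.2, h.1, h'.1, ih _ _ q (by omega)⟩)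
    rintro ⟨p, m, hp⟩
    exact key m x y p hp

variable [LinearOrder V]

open Classical in
/-- The first vertex of maximum degree in the bad components, as a set with at most one element. -/
noncomputable def selected (G : SimpleGraph V) (P : Finset V) : Finset V :=
  (G.badPart P).filter fun v => ∀ w ∈ G.badPart P,
    (G.nb P w).card ≤ (G.nb P v).card ∧ ((G.nb P v).card ≤ (G.nb P w).card → v ≤ w)

theorem mem_selected {P : Finset V} {v : V} : v ∈ G.selected P ↔ v ∈ G.badPart P ∧
    ∀ w ∈ G.badPart P,
      (G.nb P w).card ≤ (G.nb P v).card ∧ ((G.nb P v).card ≤ (G.nb P w).card → v ≤ w) := by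
  simp only [selected, Finset.mem_filter]

theorem selected_eq (P : Finset V) : (G.badPart P = ∅ ∧ G.selected P = ∅) ∨
    ∃ v ∈ G.badPart P, (∀ w ∈ G.badPart P, (G.nb P w).card ≤ (G.nb P v).card) ∧
      G.selected P = {v} := by
  rcases (G.badPart P).eq_empty_or_nonempty with h0 | hne
  · exact Or.inl ⟨h0, by simp [selected, h0]⟩
  · right
    obtain ⟨u, hu, hmax⟩ := Finset.exists_max_image _ (fun v => (G.nb P v).card) hne
    obtain ⟨v, hv, hmin⟩ := Finset.exists_min_image
      ((G.badPart P).filter fun v => (G.nb P u).card ≤ (G.nb P v).card) id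
      ⟨u, Finset.mem_filter.2 ⟨hu, le_rfl⟩⟩
    obtain ⟨hvb, huv⟩ := Finset.mem_filter.1 hv
    have hvmax : ∀ w ∈ G.badPart P, (G.nb P w).card ≤ (G.nb P v).card := fun w hw =>
      (hmax w hw).trans huv
    refine ⟨v, hvb, hvmax, ?_⟩
    ext w
    rw [mem_selected, Finset.mem_singleton]
    constructor
    · rintro ⟨hw, hwall⟩
      obtain ⟨h1, h2⟩ := hwall v hvb
      exact le_antisymm (h2 (hvmax w hw)) (hmin w (Finset.mem_filter.2 ⟨hw, huv.trans h1⟩))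
    · rintro rfl
      exact ⟨hvb, fun x hx => ⟨hvmax x hx, fun hle =>
        hmin x (Finset.mem_filter.2 ⟨hx, huv.trans hle⟩)⟩⟩

/-- One round of the algorithm: the remaining vertices are pruned, and the selected vertex is moved
to the solution. -/
noncomputable def round (G : SimpleGraph V) (x : Finset V × Finset V) : Finset V × Finset V :=
  let P := G.pruneStep^[Fintype.card V] x.1
  (P \ G.selected P, x.2 ∪ G.selected P)

theorem greedyStep_round (x : Finset V × Finset V) :
    G.GreedyStep x.1 x.2 (G.pruneStep^[Fintype.card V] x.1) (G.round x).1 (G.round x).2 := by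
  refine ⟨prunesTo_iterate _, ?_⟩
  rcases selected_eq (G := G) (G.pruneStep^[Fintype.card V] x.1) with ⟨h0, hs⟩ | ⟨v, hv, hmax, hs⟩
  · exact Or.inl ⟨h0, by simp [round, hs], by simp [round, hs]⟩
  · refine Or.inr ⟨v, hv, hmax, ?_, ?_⟩
    · simp only [round, hs, Finset.sdiff_singleton_eq_erase]
    · simp only [round, hs, Finset.insert_eq, Finset.union_comm]

end Rounds
end SimpleGraph

namespace RAM

/-! ### The algorithm -/

namespace Term

/-- The term has a value other than `0`; this is how terms express conditions. -/
def Holds (n : ℕ) (σ : ℕ → ℕ → ℕ → ℕ) (ρ : ℕ → ℕ) (t : Term) : Prop := t.eval n σ ρ ≠ 0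

/-- The negation of a condition, with the value `0` or `1`. -/
def not (t : Term) : Term := .ite t (.num 0) (.num 1)
/-- The conjunction of two conditions; its value is that of `u` where `t` holds. -/
def and (t u : Term) : Term := .ite t u (.num 0)
/-- The disjunction of two conditions. -/
def or (t u : Term) : Term := .ite t (.num 1) u
/-- Comparison of two numbers, by truncated subtraction. -/
def le (t u : Term) : Term := .ite (.sub t u) (.num 0) (.num 1)
/-- Equality of two numbers. -/
def eq (t u : Term) : Term := and (le t u) (le u t)
/-- Some value of the variable `x` fulfils the condition. -/
def ex (x : ℕ) (t : Term) : Term := .sum x t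
/-- All values of the variable `x` fulfil the condition. -/
def all (x : ℕ) (t : Term) : Term := not (ex x (not t))
/-- The number of values of the variable `x` that fulfil the condition. -/
def count (x : ℕ) (t : Term) : Term := .sum x (.ite t (.num 1) (.num 0))

variable {n : ℕ} {σ : ℕ → ℕ → ℕ → ℕ} {ρ : ℕ → ℕ} {t u : Term}

@[simp] theorem holds_num {c : ℕ} : (num c).Holds n σ ρ ↔ c ≠ 0 := Iff.rfl

@[simp] theorem holds_not : t.not.Holds n σ ρ ↔ ¬ t.Holds n σ ρ := by
  simp [Holds, not, eval]

@[simp] theorem holds_and : (and t u).Holds n σ ρ ↔ t.Holds n σ ρ ∧ u.Holds n σ ρ := by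
  by_cases h : t.eval n σ ρ = 0 <;> simp [Holds, and, eval, h]

@[simp] theorem holds_or : (or t u).Holds n σ ρ ↔ t.Holds n σ ρ ∨ u.Holds n σ ρ := by
  by_cases h : t.eval n σ ρ = 0 <;> simp [Holds, or, eval, h]

@[simp] theorem holds_le : (le t u).Holds n σ ρ ↔ t.eval n σ ρ ≤ u.eval n σ ρ := by
  simp [Holds, le, eval, Nat.sub_eq_zero_iff_le]

@[simp] theorem holds_eq : (eq t u).Holds n σ ρ ↔ t.eval n σ ρ = u.eval n σ ρ := by
  simp [eq, le_antisymm_iff]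

@[simp] theorem holds_ex {x : ℕ} :
    (ex x t).Holds n σ ρ ↔ ∃ i : Fin n, t.Holds n σ (Function.update ρ x i) := by
  simp only [Holds, ex, eval, ne_eq, Finset.sum_eq_zero_iff, not_forall, Finset.mem_range]
  exact ⟨fun ⟨i, hi, h⟩ => ⟨⟨i, hi⟩, h⟩, fun ⟨i, h⟩ => ⟨i, i.2, h⟩⟩

@[simp] theorem holds_all {x : ℕ} :
    (all x t).Holds n σ ρ ↔ ∀ i : Fin n, t.Holds n σ (Function.update ρ x i) := by
  simp [all]

open Classical in
theorem eval_count {x : ℕ} : (count x t).eval n σ ρ =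
    (Finset.univ.filter fun i : Fin n => t.Holds n σ (Function.update ρ x i)).card := by
  rw [Finset.card_filter, count, eval, Finset.sum_range]
  refine Finset.sum_congr rfl fun i _ => ?_
  by_cases h : t.eval n σ (Function.update ρ x i) = 0 <;> simp [Holds, eval, h]

end Term

/-- The entry of the matrix `a` in row `i` and column `j` is not `0`. -/
def Entry (σ : ℕ → ℕ → ℕ → ℕ) (a i j : ℕ) : Prop := σ a i j ≠ 0

@[simp] theorem Term.holds_get {n : ℕ} {σ : ℕ → ℕ → ℕ → ℕ} {ρ : ℕ → ℕ} {a x y : ℕ} :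
    (get a x y).Holds n σ ρ ↔ Entry σ a (ρ x) (ρ y) := Iff.rfl

theorem entry_fill_self {n a i j : ℕ} {t : Term} {σ : ℕ → ℕ → ℕ → ℕ} :
    Entry ((Cmd.fill a t).run n σ) a i j ↔ t.Holds n σ (entryEnv i j) := by
  simp [Entry, Cmd.run, Term.Holds]

theorem run_fill_of_ne {n a b : ℕ} {t : Term} {σ : ℕ → ℕ → ℕ → ℕ} (h : b ≠ a) :
    (Cmd.fill a t).run n σ b = σ b := by
  simp [Cmd.run, h]

@[simp] theorem entryEnv_zero {i j : ℕ} : entryEnv i j 0 = i := rfl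
@[simp] theorem entryEnv_one {i j : ℕ} : entryEnv i j 1 = j := rfl

/-- The matrix `a` represents the set `S`: each of its rows is the indicator of `S`. -/
def IsSet {n : ℕ} (σ : ℕ → ℕ → ℕ → ℕ) (a : ℕ) (S : Finset (Fin n)) : Prop :=
  ∀ i j : Fin n, Entry σ a i j ↔ j ∈ S

/-- The matrix `a` represents the relation `R`. -/
def IsRel {n : ℕ} (σ : ℕ → ℕ → ℕ → ℕ) (a : ℕ) (R : Fin n → Fin n → Prop) : Prop :=
  ∀ i j : Fin n, Entry σ a i j ↔ R i j

theorem IsSet.congr {n : ℕ} {σ σ' : ℕ → ℕ → ℕ → ℕ} {a b : ℕ} {S : Finset (Fin n)}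
    (h : IsSet σ a S) (e : σ' b = σ a) : IsSet σ' b S := fun i j => by
  rw [← h i j, Entry, Entry, e]

theorem IsRel.congr {n : ℕ} {σ σ' : ℕ → ℕ → ℕ → ℕ} {a b : ℕ} {R : Fin n → Fin n → Prop}
    (h : IsRel σ a R) (e : σ' b = σ a) : IsRel σ' b R := fun i j => by
  rw [← h i j, Entry, Entry, e]

/-- The matrix `a` is set to the value of `t`, which may read `a`. The matrix `3` holds the new
value meanwhile. -/
def Cmd.assign (a : ℕ) (t : Term) : Cmd := .seq (.fill 3 t) (.fill a (.get 3 0 1))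

theorem run_assign_self {n a : ℕ} {t : Term} {σ : ℕ → ℕ → ℕ → ℕ} :
    (Cmd.assign a t).run n σ a = (Cmd.fill 3 t).run n σ 3 := by
  simp [Cmd.assign, Cmd.run, Term.eval]

theorem run_assign_of_ne {n a b : ℕ} {t : Term} {σ : ℕ → ℕ → ℕ → ℕ} (h : b ≠ a) (h3 : b ≠ 3) :
    (Cmd.assign a t).run n σ b = σ b := by
  simp [Cmd.assign, Cmd.run, h, h3]

theorem entry_assign_self {n a i j : ℕ} {t : Term} {σ : ℕ → ℕ → ℕ → ℕ} :
    Entry ((Cmd.assign a t).run n σ) a i j ↔ t.Holds n σ (entryEnv i j) := by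
  rw [Entry, run_assign_self]
  exact entry_fill_self

/-! The matrices of the algorithm are: `0` the adjacency matrix, `1` the solution, `2` the remaining
vertices, `3` intermediate results, `4` the pairs of vertices joined by odd walks, `6` the degrees,
`7` the bad vertices and `8` the selected vertex. The matrices that represent sets of vertices, and
that of the degrees, have equal rows, and the entry of a vertex is read on the diagonal. -/

/-- The vertex `x` remains. -/
def inS (x : ℕ) : Term := .get 2 x x

/-- The degree of `x` among the remaining vertices, computed with the variable `9`. -/
def degTerm (x : ℕ) : Term := .count 9 (.and (inS 9) (.get 0 x 9))

/-- The stored degree of `x`. -/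
def deg (x : ℕ) : Term := .get 6 x x

/-- `x` and `y` are in the same component; the variable `9` is used. -/
def sameComp (x y : ℕ) : Term :=
  .or (.get 4 x y) (.ex 9 (.and (.get 4 x 9) (.and (.get 0 9 y) (inS y))))

/-- `x` and `y` form a theta pair; the variables `8` and `9` are used. -/
def thetaTerm (x y : ℕ) : Term :=
  .and (.not (.eq (.var x) (.var y))) <| .and (.eq (deg x) (.num 3)) <|
  .and (.eq (deg y) (.num 3)) <| .ex 8 <| .and (inS 8) <| .ex 9 <| .and (inS 9) <|
  .and (.not (.eq (.var 8) (.var 9))) <| .and (.eq (deg 8) (.num 2)) <|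
  .and (.eq (deg 9) (.num 2)) <| .and (.get 0 x 8) <| .and (.get 0 y 8) <|
  .and (.get 0 x 9) (.get 0 y 9)

/-- The variable `1` is in a component that is not 2-choosable. -/
def badTerm : Term :=
  .and (inS 1) <| .or (.get 4 1 1) <| .ex 2 <| .and (sameComp 1 2) <|
  .and (.not (.eq (deg 2) (.num 2))) <| .not <| .ex 3 <| .and (inS 3) <| .and (thetaTerm 2 3) <|
  .all 4 <| .or (.not (sameComp 1 4)) <| .or (.eq (deg 4) (.num 2)) <|
  .or (.eq (.var 4) (.var 2)) (.eq (.var 4) (.var 3))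

/-- The variable `1` is the first bad vertex of maximum degree. -/
def selTerm : Term :=
  .and (.get 7 1 1) <| .all 2 <| .or (.not (.get 7 2 2)) <| .and (.le (deg 2) (deg 1)) <|
  .or (.not (.le (deg 1) (deg 2))) (.le (.var 1) (.var 2))

/-- The remaining vertices of degree at most one are removed. -/
def pruneCmd : Cmd := .assign 2 (.and (inS 1) (.le (.num 2) (degTerm 1)))

/-- The matrix `4` becomes the set of edges between remaining vertices. -/
def oddBaseCmd : Cmd := .fill 4 (.and (inS 0) (.and (inS 1) (.get 0 0 1)))

/-- The odd walks recorded in the matrix `4` are prolonged by two edges. -/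
def oddStepCmd : Cmd := .assign 4 <| .or (.get 4 0 1) <| .ex 2 <| .ex 3 <| .and (inS 0) <|
  .and (inS 2) <| .and (.get 0 0 2) <| .and (.get 0 2 3) (.get 4 3 1)

/-- One round. The odd walks are prolonged `n * n` times, once for each pair of vertices. -/
def roundCmd : Cmd :=
  .seq (.iter pruneCmd) <| .seq oddBaseCmd <| .seq (.iter (.iter oddStepCmd)) <|
  .seq (.fill 6 (degTerm 1)) <| .seq (.fill 7 badTerm) <| .seq (.fill 8 selTerm) <|
  .seq (.assign 2 (.and (inS 1) (.not (.get 8 1 1)))) (.assign 1 (.or (.get 1 1 1) (.get 8 1 1)))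

/-- The greedy algorithm: all vertices remain at first, and `n` rounds follow. The matrix of the
solution is `0` initially. -/
def mainCmd : Cmd := .seq (.fill 2 (.num 1)) (.iter roundCmd)

theorem mainCmd_ok : mainCmd.Ok := by
  simp [mainCmd, roundCmd, pruneCmd, oddBaseCmd, oddStepCmd, badTerm, selTerm, thetaTerm, sameComp,
    deg, degTerm, inS, Cmd.Ok, Cmd.assign, Term.Avoids, Term.and, Term.or, Term.not, Term.eq,
    Term.le, Term.ex, Term.all, Term.count]

section Correctness

variable {n : ℕ} {G : SimpleGraph (Fin n)} {σ : ℕ → ℕ → ℕ → ℕ}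

/-- The matrices represent the graph, the remaining vertices `S` and the solution `A`. -/
structure State (G : SimpleGraph (Fin n)) (x : Finset (Fin n) × Finset (Fin n))
    (σ : ℕ → ℕ → ℕ → ℕ) : Prop where
  adj : IsRel σ 0 G.Adj
  rest : IsSet σ 2 x.1
  sol : IsSet σ 1 x.2

theorem State.congr {x : Finset (Fin n) × Finset (Fin n)} {σ' : ℕ → ℕ → ℕ → ℕ} (h : State G x σ)
    (h0 : σ' 0 = σ 0) (h1 : σ' 1 = σ 1) (h2 : σ' 2 = σ 2) : State G x σ' :=
  ⟨h.adj.congr h0, h.rest.congr h2, h.sol.congr h1⟩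

theorem State.fill {x : Finset (Fin n) × Finset (Fin n)} (h : State G x σ) {a : ℕ} {t : Term}
    (ha : 3 ≤ a) : State G x ((Cmd.fill a t).run n σ) :=
  h.congr (run_fill_of_ne (by omega)) (run_fill_of_ne (by omega)) (run_fill_of_ne (by omega))

theorem State.assign {x : Finset (Fin n) × Finset (Fin n)} (h : State G x σ) {a : ℕ} {t : Term}
    (ha : 3 ≤ a) : State G x ((Cmd.assign a t).run n σ) :=
  h.congr (run_assign_of_ne (by omega) (by omega)) (run_assign_of_ne (by omega) (by omega))
    (run_assign_of_ne (by omega) (by omega))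

/-- A relation that is respected by two operations is respected by their iterates. -/
theorem iterate_rel {α β : Type*} {f : α → α} {g : β → β} {r : α → β → Prop}
    (h : ∀ a b, r a b → r (f a) (g b)) (m : ℕ) {a : α} {b : β} (hab : r a b) :
    r (f^[m] a) (g^[m] b) := by
  induction m with
  | zero => exact hab
  | succ m ih =>
    rw [Function.iterate_succ_apply', Function.iterate_succ_apply']
    exact h _ _ ih

theorem State.holds_inS {x : Finset (Fin n) × Finset (Fin n)} (h : State G x σ) {ρ : ℕ → ℕ}
    {y : ℕ} {v : Fin n} (hv : ρ y = v) : (inS y).Holds n σ ρ ↔ v ∈ x.1 := by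
  rw [inS, Term.holds_get, hv, h.rest]

theorem State.eval_degTerm {x : Finset (Fin n) × Finset (Fin n)} (h : State G x σ) {ρ : ℕ → ℕ}
    {y : ℕ} {v : Fin n} (hy : y ≠ 9) (hv : ρ y = v) :
    (degTerm y).eval n σ ρ = (G.nb x.1 v).card := by
  classical
  rw [degTerm, Term.eval_count]
  congr 1
  ext w
  simp [inS, hy, hv, h.rest w w, h.adj v w]

theorem State.prune {x : Finset (Fin n) × Finset (Fin n)} (h : State G x σ) :
    State G (G.pruneStep x.1, x.2) (pruneCmd.run n σ) where
  adj := h.adj.congr (run_assign_of_ne (by omega) (by omega))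
  sol := h.sol.congr (run_assign_of_ne (by omega) (by omega))
  rest i j := by
    rw [pruneCmd, entry_assign_self, Term.holds_and, h.holds_inS (v := j) rfl, Term.holds_le,
      h.eval_degTerm (v := j) (by omega) rfl]
    simp [SimpleGraph.pruneStep, Term.eval]

/-- The matrices represent the graph, the sets `x`, and the set of pairs `R` in the matrix `4`. -/
def StateRel (G : SimpleGraph (Fin n)) (x : Finset (Fin n) × Finset (Fin n))
    (σ : ℕ → ℕ → ℕ → ℕ) (R : Finset (Fin n × Fin n)) : Prop :=
  State G x σ ∧ IsRel σ 4 fun i j => (i, j) ∈ R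

theorem State.oddBase {x : Finset (Fin n) × Finset (Fin n)} (h : State G x σ) :
    StateRel G x (oddBaseCmd.run n σ) (G.oddBase x.1) := by
  refine ⟨h.fill (by omega), fun i j => ?_⟩
  beta_reduce
  rw [oddBaseCmd, entry_fill_self, SimpleGraph.mem_oddBase, Term.holds_and, Term.holds_and,
    h.holds_inS (v := i) rfl, h.holds_inS (v := j) rfl, Term.holds_get, entryEnv_zero, entryEnv_one,
    h.adj i j]

theorem StateRel.oddStep {x : Finset (Fin n) × Finset (Fin n)} {R : Finset (Fin n × Fin n)}
    (h : StateRel G x σ R) : StateRel G x (oddStepCmd.run n σ) (G.oddStep x.1 R) := by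
  refine ⟨h.1.assign (by omega), fun i j => ?_⟩
  beta_reduce
  rw [oddStepCmd, entry_assign_self, SimpleGraph.mem_oddStep]
  simp [inS, h.1.rest _ _, h.1.adj _ _, h.2 _ _]

theorem StateRel.odd {x : Finset (Fin n) × Finset (Fin n)} {R : Finset (Fin n × Fin n)}
    (h : StateRel G x σ R) :
    StateRel G x ((Cmd.iter (.iter oddStepCmd)).run n σ) ((G.oddStep x.1)^[n * n] R) := by
  have : (Cmd.iter (.iter oddStepCmd)).run n σ = (oddStepCmd.run n)^[n * n] σ := by
    rw [Function.iterate_mul]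
    rfl
  rw [this]
  exact iterate_rel (r := fun σ R => StateRel G x σ R) (fun _ _ h => h.oddStep) _ h

/-- The matrices represent the graph, the pruned set `x.1` of remaining vertices, the solution, the
odd walks and the degrees. -/
structure Analysed (G : SimpleGraph (Fin n)) (x : Finset (Fin n) × Finset (Fin n))
    (σ : ℕ → ℕ → ℕ → ℕ) : Prop extends State G x σ where
  two_le : ∀ v ∈ x.1, 2 ≤ (G.nb x.1 v).card
  odd : IsRel σ 4 (G.OddWalk x.1)
  degs : ∀ i j : Fin n, σ 6 i j = (G.nb x.1 j).card

theorem Analysed.fill {x : Finset (Fin n) × Finset (Fin n)} (h : Analysed G x σ) {a : ℕ} {t : Term}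
    (ha : 7 ≤ a) : Analysed G x ((Cmd.fill a t).run n σ) where
  toState := h.toState.fill (by omega)
  two_le := h.two_le
  odd := h.odd.congr (run_fill_of_ne (by omega))
  degs i j := by rw [run_fill_of_ne (by omega), h.degs]

theorem Analysed.eval_deg {x : Finset (Fin n) × Finset (Fin n)} (h : Analysed G x σ) {ρ : ℕ → ℕ}
    {y : ℕ} {v : Fin n} (hv : ρ y = v) : (deg y).eval n σ ρ = (G.nb x.1 v).card := by
  rw [deg, Term.eval, hv, h.degs]

theorem Analysed.holds_sameComp {x : Finset (Fin n) × Finset (Fin n)} (h : Analysed G x σ)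
    {ρ : ℕ → ℕ} {y z : ℕ} {v w : Fin n} (hy : y ≠ 9) (hz : z ≠ 9) (hv : ρ y = v) (hw : ρ z = w)
    (hvS : v ∈ x.1) : (sameComp y z).Holds n σ ρ ↔ w ∈ G.comp x.1 v := by
  rw [SimpleGraph.mem_comp_iff_oddWalk hvS (h.two_le v hvS)]
  simp [sameComp, inS, hy, hz, hv, hw, h.odd _ _, h.adj _ _, h.rest _ _]

theorem Analysed.holds_thetaTerm {x : Finset (Fin n) × Finset (Fin n)} (h : Analysed G x σ)
    {ρ : ℕ → ℕ} {y z : ℕ} {v w : Fin n} (hy : y < 8) (hz : z < 8) (hv : ρ y = v) (hw : ρ z = w) :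
    (thetaTerm y z).Holds n σ ρ ↔ G.ThetaPair x.1 v w := by
  have hy8 : y ≠ 8 := by omega
  have hy9 : y ≠ 9 := by omega
  have hz8 : z ≠ 8 := by omega
  have hz9 : z ≠ 9 := by omega
  simp [thetaTerm, SimpleGraph.ThetaPair, inS, deg, Term.eval, hy8, hy9, hz8, hz9, hv, hw,
    h.adj _ _, h.rest _ _, h.degs, Fin.val_inj]

theorem Analysed.bad {x : Finset (Fin n) × Finset (Fin n)} (h : Analysed G x σ) :
    IsSet ((Cmd.fill 7 badTerm).run n σ) 7 (G.badPart x.1) := by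
  intro i v
  rw [entry_fill_self, SimpleGraph.mem_badPart, SimpleGraph.not_choosableOn_comp_iff h.two_le,
    badTerm, Term.holds_and, h.holds_inS (v := v) rfl]
  refine and_congr_right fun hv => ?_
  simp only [Term.holds_or, Term.holds_ex, Term.holds_and, Term.holds_not, Term.holds_all,
    Term.holds_eq, Term.holds_get, entryEnv_one]
  refine or_congr (h.odd v v) (exists_congr fun z => ?_)
  rw [h.holds_sameComp (v := v) (w := z) (by omega) (by omega) (by simp) (by simp) hv,
    h.eval_deg (v := z) (by simp)]
  refine and_congr_right fun _ => and_congr (by simp [Term.eval])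
    (not_congr (exists_congr fun w => ?_))
  rw [h.holds_inS (v := w) (by simp), h.holds_thetaTerm (v := z) (w := w) (by omega) (by omega)
    (by simp) (by simp)]
  refine and_congr_right fun _ => and_congr_right fun _ => forall_congr' fun t => ?_
  rw [h.holds_sameComp (v := v) (w := t) (by omega) (by omega) (by simp) (by simp) hv,
    h.eval_deg (v := t) (by simp)]
  simp only [Term.eval, Function.update_self, ne_eq]
  simp only [Function.update_apply]
  simp only [Nat.reduceEqDiff, if_true, if_false, Fin.val_inj]
  tauto

theorem Analysed.select {x : Finset (Fin n) × Finset (Fin n)} (h : Analysed G x σ)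
    (h7 : IsSet σ 7 (G.badPart x.1)) :
    IsSet ((Cmd.fill 8 selTerm).run n σ) 8 (G.selected x.1) := by
  intro i v
  rw [entry_fill_self, selTerm, SimpleGraph.mem_selected, Term.holds_and,
    Term.holds_get, entryEnv_one, h7 v v, Term.holds_all]
  refine and_congr_right fun _ => forall_congr' fun w => ?_
  simp only [Term.holds_or, Term.holds_and, Term.holds_not, Term.holds_le, Term.holds_get]
  rw [h.eval_deg (v := w) (by simp), h.eval_deg (v := v) (by simp)]
  simp only [Term.eval, Function.update_self, ne_eq, OfNat.one_ne_ofNat, not_false_eq_true,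
    Function.update_of_ne, entryEnv_one, h7 w w, Fin.val_fin_le]
  tauto

theorem State.round {x : Finset (Fin n) × Finset (Fin n)} (h : State G x σ) :
    State G (G.round x) (roundCmd.run n σ) := by
  set P := G.pruneStep^[n] x.1 with hP
  have hcard : Fintype.card (Fin n) = n := Fintype.card_fin n
  have h₁ : State G (P, x.2) ((Cmd.iter pruneCmd).run n σ) := by
    have := iterate_rel (f := pruneCmd.run n)
      (g := fun x : Finset (Fin n) × Finset (Fin n) => (G.pruneStep x.1, x.2))
      (r := fun σ x => State G x σ) (fun _ _ h => h.prune) n h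
    have e : ∀ m, (fun x : Finset (Fin n) × Finset (Fin n) => (G.pruneStep x.1, x.2))^[m] x =
        (G.pruneStep^[m] x.1, x.2) := by
      intro m
      induction m with
      | zero => rfl
      | succ m ih => rw [Function.iterate_succ_apply', ih, Function.iterate_succ_apply']
    rwa [e] at this
  have h₂ := h₁.oddBase.odd
  have hodd : IsRel ((Cmd.iter (.iter oddStepCmd)).run n (oddBaseCmd.run n
      ((Cmd.iter pruneCmd).run n σ))) 4 (G.OddWalk P) := fun i j => by
    rw [h₂.2 i j]
    beta_reduce
    rw [SimpleGraph.mem_iterate_oddStep _ (by simp)]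
  have htwo := (SimpleGraph.prunesTo_iterate (G := G) x.1).two_le
  rw [hcard] at htwo
  have h₃ : Analysed G (P, x.2) ((Cmd.fill 6 (degTerm 1)).run n _) :=
    { toState := h₂.1.fill (by omega)
      two_le := htwo
      odd := hodd.congr (run_fill_of_ne (by omega))
      degs := fun i j => by
        simp only [Cmd.run, Function.update_self]
        exact h₂.1.eval_degTerm (v := j) (by omega) rfl }
  have h₄ := h₃.bad
  have h₅ := (h₃.fill (a := 7) (t := badTerm) le_rfl).select h₄
  have h₆ := (h₃.fill (a := 7) (t := badTerm) le_rfl).fill (a := 8) (t := selTerm) (by omega)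
  set τ := (Cmd.fill 8 selTerm).run n ((Cmd.fill 7 badTerm).run n ((Cmd.fill 6 (degTerm 1)).run n
    ((Cmd.iter (.iter oddStepCmd)).run n (oddBaseCmd.run n ((Cmd.iter pruneCmd).run n σ))))) with hτ
  set τ' := (Cmd.assign 2 (.and (inS 1) (.not (.get 8 1 1)))).run n τ with hτ'
  have hrun : roundCmd.run n σ = (Cmd.assign 1 (.or (.get 1 1 1) (.get 8 1 1))).run n τ' := rfl
  have hround : G.round x = (P \ G.selected P, x.2 ∪ G.selected P) := by
    simp only [SimpleGraph.round, hcard, hP]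
  have h8 : IsSet τ' 8 (G.selected P) := h₅.congr (run_assign_of_ne (by omega) (by omega))
  have h1 : IsSet τ' 1 x.2 := h₆.sol.congr (run_assign_of_ne (by omega) (by omega))
  rw [hrun, hround]
  refine ⟨(h₆.adj.congr (run_assign_of_ne (by omega) (by omega))).congr
    (run_assign_of_ne (by omega) (by omega)), ?_, fun i j => ?_⟩
  · have : IsSet τ' 2 (P \ G.selected P) := fun i j => by
      rw [hτ', entry_assign_self, Term.holds_and, h₆.toState.holds_inS (v := j) rfl,
        Term.holds_not, Term.holds_get, entryEnv_one, h₅ j j, Finset.mem_sdiff]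
    exact this.congr (run_assign_of_ne (by omega) (by omega))
  · rw [entry_assign_self, Term.holds_or, Term.holds_get, Term.holds_get, entryEnv_one, h1 j j,
      h8 j j, Finset.mem_union]

/-- The input store represents the matrices whose entries are the cells of its arrays. -/
theorem models_inputGraph (G : SimpleGraph (Fin n)) :
    Models n (fun a i j => (inputGraph G).arr a (i * n + j)) (fun _ => 0) (inputGraph G) where
  size := by simp [inputGraph]
  vars x := by simp [inputGraph]
  arrs a i j _ _ := rfl

theorem state_inputGraph (G : SimpleGraph (Fin n)) : State G (Finset.univ, ∅)
    ((Cmd.fill 2 (.num 1)).run n fun a i j => (inputGraph G).arr a (i * n + j)) where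
  adj i j := by
    rw [Entry, run_fill_of_ne (by omega)]
    constructor
    · intro h
      obtain ⟨i', j', hadj, he⟩ : ∃ i' j' : Fin n, G.Adj i' j' ∧ (i : ℕ) * n + j = i' * n + j' := by
        by_contra hcon
        exact h (if_neg fun h => hcon h.2)
      obtain ⟨h1, h2⟩ := cell_inj j.2 j'.2 he
      rwa [Fin.ext h1, Fin.ext h2]
    · intro h
      exact (if_pos ⟨rfl, i, j, h, rfl⟩).trans_ne one_ne_zero
  rest i j := by
    rw [entry_fill_self]
    simp
  sol i j := by
    rw [Entry, run_fill_of_ne (by omega)]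
    simp [inputGraph]

/-- The solution of the greedy algorithm. -/
noncomputable def greedySolution (G : SimpleGraph (Fin n)) : Finset (Fin n) :=
  (G.round^[n] (Finset.univ, ∅)).2

/-- The program for the greedy algorithm. -/
def greedyProg : Prog := mainCmd.compile 0

theorem runs_greedyProg (G : SimpleGraph (Fin n)) :
    Runs greedyProg (inputGraph G) (mainCmd.cost.eval n) fun s =>
      outputSet n s = greedySolution G := by
  refine (mainCmd.runs_compile 0 mainCmd_ok (models_inputGraph G)).mono le_rfl fun s ⟨hm, _⟩ => ?_
  have hst := iterate_rel (f := roundCmd.run n) (g := G.round) (r := fun σ x => State G x σ)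
    (fun _ _ h => h.round) n (state_inputGraph G)
  ext v
  have hv := hst.sol v v
  have h0 := hm.arrs 1 0 v (by have := v.2; omega) v.2
  have hrow := hst.sol ⟨0, by have := v.2; omega⟩ v
  rw [zero_mul, zero_add] at h0
  rw [outputSet, Finset.mem_filter, h0, greedySolution]
  simp only [Finset.mem_univ, true_and]
  exact hrow

end Correctness

end RAM

section Approximation

variable {n : ℕ}

theorem SimpleGraph.isChoosableDeletionSet_iff {G : SimpleGraph (Fin n)} {A : Finset (Fin n)} :
    G.IsChoosableDeletionSet 2 A ↔ G.ChoosableOn (Finset.univ \ A) := by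
  have hmem : ∀ v, v ∈ Finset.univ \ A ↔ v ∉ A := fun v => by simp
  constructor
  · intro h L hL
    obtain ⟨f, hf⟩ := h (fun v => L v) fun v => hL v
    classical
    refine ⟨fun v => if hv : v ∉ A then f ⟨v, hv⟩ else 0, fun v hv => ?_, fun v hv w hw hvw => ?_⟩
    · have hv' := (hmem v).1 hv
      simpa [hv'] using hf ⟨v, hv'⟩
    · have hv' := (hmem v).1 (by exact_mod_cast hv)
      have hw' := (hmem w).1 (by exact_mod_cast hw)
      simp only [hv', hw', not_false_eq_true, dif_pos]
      exact f.valid (v := ⟨v, hv'⟩) (w := ⟨w, hw'⟩) hvw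
  · intro h L hL
    classical
    obtain ⟨f, hf, hp⟩ := h (fun v => if hv : v ∉ A then L ⟨v, hv⟩ else {0, 1}) fun v => by
      by_cases hv : v ∉ A
      · rw [dif_pos hv, hL]
      · rw [dif_neg hv, Finset.card_pair zero_ne_one]
    refine ⟨SimpleGraph.Coloring.mk (fun v => f v) ?_, fun v => ?_⟩
    · intro v w hvw
      exact hp v (by exact_mod_cast (hmem v).2 v.2) w (by exact_mod_cast (hmem w).2 w.2) hvw
    · have := hf v ((hmem v).2 v.2)
      rwa [dif_pos (show (v : Fin n) ∉ A from v.2)] at this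

theorem RAM.greedySolution_correct (G : SimpleGraph (Fin n)) :
    G.IsChoosableDeletionSet 2 (greedySolution G) ∧
      ∀ B : Finset (Fin n), G.IsChoosableDeletionSet 2 B →
        ((greedySolution G).card : ℝ) ≤ 36 * Real.log n * B.card := by
  obtain ⟨h₁, h₂⟩ := SimpleGraph.greedy_correct (G := G)
    (S := fun i => (G.round^[i] (Finset.univ, ∅)).1)
    (A := fun i => (G.round^[i] (Finset.univ, ∅)).2)
    (P := fun i => G.pruneStep^[Fintype.card (Fin n)] (G.round^[i] (Finset.univ, ∅)).1) rfl rfl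
    (fun i => by
      simp only [Function.iterate_succ_apply']
      exact SimpleGraph.greedyStep_round _)
  rw [Fintype.card_fin] at h₁ h₂
  refine ⟨SimpleGraph.isChoosableDeletionSet_iff.2 h₁, fun B hB => ?_⟩
  by_cases hn : 2 ≤ n
  · refine (h₂ B (SimpleGraph.isChoosableDeletionSet_iff.1 hB)).trans
      (SimpleGraph.potential_le hn ?_)
    exact (Finset.card_le_univ _).trans (Fintype.card_fin n).le
  · -- With at most one vertex, the empty set is a deletion set, and the solution is empty.
    have hsub : Subsingleton (Fin n) := Fin.subsingleton_iff_le_one.2 (by omega)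
    have h0 : G.ChoosableOn (Finset.univ \ ∅) := fun L hL => by
      have hne : ∀ v, (L v).Nonempty := fun v => Finset.card_pos.1 (by rw [hL]; omega)
      exact ⟨fun v => (hne v).choose, fun v _ => (hne v).choose_spec,
        fun v _ w _ hvw => (hvw.ne (Subsingleton.elim v w)).elim⟩
    have hcard : (greedySolution G).card ≤ 0 := by
      have h3 := h₂ ∅ h0
      simp only [SimpleGraph.potential, Finset.card_empty, Finset.empty_inter, Nat.cast_zero,
        mul_zero, zero_mul, ite_self, add_zero] at h3
      exact_mod_cast h3
    have hlog : 0 ≤ Real.log n := Real.log_natCast_nonneg n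
    have : ((greedySolution G).card : ℝ) ≤ 0 := by exact_mod_cast hcard
    exact this.trans (by positivity)

end Approximation

theorem mainTheorem4 :
    ∃ (p : RAM.Prog) (C : ℝ), p.IsPolyTimeOnGraphs ∧
      p.ApproximatesMinChoosableDel 2 (fun n => C * Real.log n) := by
  refine ⟨RAM.greedyProg, 36, ⟨RAM.mainCmd.cost, fun n G => ?_⟩, fun n G => ?_⟩
  · obtain ⟨t, s, he, ht, -⟩ := RAM.runs_greedyProg G
    exact ⟨t, s, he, ht⟩
  · obtain ⟨t, s, he, -, hs⟩ := RAM.runs_greedyProg G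
    obtain ⟨h₁, h₂⟩ := RAM.greedySolution_correct G
    exact ⟨t, s, he, hs ▸ h₁, fun B hB => hs ▸ h₂ B hB⟩
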